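/- Let $\langle x\rangle=(1+|x|^2)^{1/2}$, let $V:\mathbb R^3\to\mathbb R$ be measurable, not almost everywhere zero, with $|V(x)|\le C\langle x\rangle^{-\beta}$ for all $x$, for some constants $C$ and $\beta>7$, and let $H=\Delta^2+V$ be the self-adjoint operator on $L^2(\mathbb R^3)$ with domain $H^4(\mathbb R^3)$. Put $v=|V|^{1/2}$, $U(x)=1$ if $V(x)\ge 0$ and $U(x)=-1$ if $V(x)<0$, let $G_0$ be the integral operator with kernel $-\frac{|x-y|}{8\pi}$, $T=U+vG_0v$, $P=\|V\|_1^{-1}\,v\langle\cdot,v\rangle$ the orthogonal projection of $L^2(\mathbb R^3)$ onto the span of $v$, and $Q=I-P$. Assume that zero is a regular point of the spectrum of $H$, i.e. that $QTQ$ is invertible on $QL^2(\mathbb R^3)$. For $\lambda>0$ let $R_V^\pm(\lambda^4)=\lim_{\epsilon\to0^+}\big(H-(\lambda^4\pm i\epsilon)\big)^{-1}$ be the limiting resolvents, the limit being taken in the operator norm from $L^{2,\sigma}$ to $L^{2,-\sigma}$ for every $\sigma>\frac32$, where $L^{2,\sigma}=\{f:\langle\cdot\rangle^\sigma f\in L^2(\mathbb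 R^3)\}$. For a kernel $\mathcal E(\lambda)(x,y)$, write $\mathcal E=O_2(\lambda\langle x\rangle\langle y\rangle)$ on $(0,\lambda_0)$ if it is twice continuously differentiable in $\lambda\in(0,\lambda_0)$ for all $x,y$ and there is a constant $C'$ with $$|\mathcal E(\lambda)(x,y)|+\lambda|\partial_\lambda\mathcal E(\lambda)(x,y)|+\lambda^2|\partial_\lambda^2\mathcal E(\lambda)(x,y)|\le C'\lambda\langle x\rangle\langle y\rangle\qquad\text{for all }0<\lambda<\lambda_0,\ x,y\in\mathbb R^3 .$$ Then there are $\lambda_0>0$ and a kernel $C_0(x,y)$, independent of $\lambda$ and of the choice of sign, such that for $0<\lambda<\lambda_0$ both limits $R_V^\pm(\lambda^4)$ exist and are integral operators with kernels satisfying $$R_V^\pm(\lambda^4)(x,y)=C_0(x,y)+O_2(\lambda\langle x\rangle\langle y\rangle)\quad\text{on }(0,\lambda_0).$$ In particular, $R_V^+(\lambda^4)(x,y)-R_V^-(\lambda^4)(x,y)=O_2(\lambda\langle x\rangle\langle y\rangle)$ on $(0,\lambda_0)$. -/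

import Mathlib

open MeasureTheory Filter Topology Set

noncomputable section

namespace FourthOrder

/-- Euclidean three-space. -/
abbrev E3 := EuclideanSpace ℝ (Fin 3)

/-- The complex Hilbert space `L²(ℝ³)`. -/
abbrev L2 := Lp ℂ 2 (volume : Measure E3)

/-- The Japanese bracket `⟨x⟩ = (1 + |x|²)^{1/2}`. -/
def jb (x : E3) : ℝ := Real.sqrt (1 + ‖x‖ ^ 2)

/-! ### The operator `H = Δ² + V` and its resolvent -/

/-- `HGraph V u w` says that `u` lies in the domain of `H = Δ² + V` and that `H u = w`.
The domain is `{u ∈ L² : Δ² u ∈ L²} = H⁴(ℝ³)`, where `Δ²` is taken in the sense of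
(tempered) distributions; for bounded `V` this is the self-adjoint realization. -/
def HGraph (V : E3 → ℝ) (u w : L2) : Prop :=
  ∃ g : L2,
    Laplacian.laplacian (Laplacian.laplacian (Lp.toTemperedDistribution u))
      = Lp.toTemperedDistribution g ∧
    ∀ᵐ x ∂(volume : Measure E3), w x = g x + (V x : ℂ) * u x

/-- `IsResolventAt V z R` says that the bounded operator `R` is the two-sided inverse
`(H - z)⁻¹` of `H - z : D(H) → L²`. There is at most one such `R`. -/
def IsResolventAt (V : E3 → ℝ) (z : ℂ) (R : L2 →L[ℂ] L2) : Prop :=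
  (∀ f : L2, HGraph V (R f) (f + z • R f)) ∧
  (∀ u w : L2, HGraph V u w → R (w - z • u) = u)

/-- The norm of the weighted space `L^{2,σ}(ℝ³) = {f : ⟨·⟩^σ f ∈ L²}`. -/
def wNorm (σ : ℝ) (f : E3 → ℂ) : ENNReal :=
  eLpNorm (fun x => ((jb x ^ σ : ℝ) : ℂ) * f x) 2 volume

/-- `IsLimitingKernel V s lam K`, for `s = ± 1` and `lam > 0`, says that the limiting resolvent
`R_V^±(lam⁴) = lim_{ε → 0+} (H - (lam⁴ ± iε))⁻¹` exists, as a limit in the operator norm from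
`L^{2,σ}` to `L^{2,-σ}` for every `σ > 3/2`, and that it is the integral operator
with kernel `K(x,y)`. -/
def IsLimitingKernel (V : E3 → ℝ) (s lam : ℝ) (K : E3 → E3 → ℂ) : Prop :=
  AEStronglyMeasurable (Function.uncurry K) (volume : Measure (E3 × E3)) ∧
  (∀ ε : ℝ, 0 < ε →
    ∃ R : L2 →L[ℂ] L2, IsResolventAt V ((lam : ℂ) ^ 4 + (s : ℂ) * (ε : ℂ) * Complex.I) R) ∧
  ∀ σ : ℝ, 3 / 2 < σ →
    (∀ f : L2, wNorm σ f < ⊤ →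
      ∀ᵐ x ∂(volume : Measure E3), Integrable (fun y => K x y * f y) volume) ∧
    ∀ η : ℝ, 0 < η → ∀ᶠ ε : ℝ in 𝓝[>] (0 : ℝ),
      ∀ R : L2 →L[ℂ] L2,
        IsResolventAt V ((lam : ℂ) ^ 4 + (s : ℂ) * (ε : ℂ) * Complex.I) R →
        ∀ f : L2, wNorm (-σ) (fun x => R f x - ∫ y, K x y * f y)
          ≤ ENNReal.ofReal η * wNorm σ f

/-! ### Regularity of zero energy -/

/-- `v = |V|^{1/2}`. -/
def sqrtAbs (V : E3 → ℝ) (x : E3) : ℝ := Real.sqrt |V x|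

/-- `U = sign V`, with the convention `sign 0 = 1` (so that `U² = 1` and `V = v U v`). -/
def signV (V : E3 → ℝ) (x : E3) : ℝ := if 0 ≤ V x then 1 else -1

/-- The kernel `G₀(x,y) = -|x-y| / (8π)` of `(Δ²)⁻¹`. -/
def G0 (x y : E3) : ℝ := -‖x - y‖ / (8 * Real.pi)

/-- `T = U + v G₀ v`. -/
def opT (V : E3 → ℝ) (ψ : E3 → ℂ) (x : E3) : ℂ :=
  (signV V x : ℂ) * ψ x
    + (sqrtAbs V x : ℂ) * ∫ y, (G0 x y : ℂ) * (sqrtAbs V y : ℂ) * ψ y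

/-- `P = ‖V‖₁⁻¹ v ⟨·, v⟩`, the orthogonal projection onto the span of `v`. -/
def opP (V : E3 → ℝ) (ψ : E3 → ℂ) (x : E3) : ℂ :=
  (sqrtAbs V x : ℂ) * (∫ y, ψ y * (sqrtAbs V y : ℂ)) / ((∫ y, |V y| : ℝ) : ℂ)

/-- `Q = I - P`. -/
def opQ (V : E3 → ℝ) (ψ : E3 → ℂ) (x : E3) : ℂ := ψ x - opP V ψ x

/-- The subspace `Q L²` of `L²` (the range of the projection `Q`, i.e. its fixed vectors). -/
def QL2 (V : E3 → ℝ) : Set L2 := {ψ | opQ V ψ =ᵐ[volume] ψ}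

/-- Zero is a regular point of the spectrum of `Δ² + V`: the operator `Q T Q` is invertible
(that is, bijective; the inverse is then automatically bounded) on `Q L²`. -/
def ZeroIsRegular (V : E3 → ℝ) : Prop :=
  ∀ f ∈ QL2 V, ∃! ψ : L2, ψ ∈ QL2 V ∧ opQ V (opT V (opQ V ψ)) =ᵐ[volume] f

/-! ### Symbol-type error terms -/

/-- `E(λ)(x,y) = O_k(g(λ,x,y))` for `0 < λ < lam0`: the kernel `E` is `k` times continuously
differentiable in `λ` and `∑_{j ≤ k} λ^j |∂_λ^j E(λ)(x,y)| ≤ C g(λ,x,y)`, with a constant `C`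
that does not depend on `λ`, `x`, `y`. -/
def IsOk (k : ℕ) (lam0 : ℝ) (E : ℝ → E3 → E3 → ℂ) (g : ℝ → E3 → E3 → ℝ) : Prop :=
  (∀ x y : E3, ContDiffOn ℝ k (fun lam => E lam x y) (Ioo 0 lam0)) ∧
  ∃ C : ℝ, ∀ lam ∈ Ioo 0 lam0, ∀ x y : E3,
    ∑ j ∈ Finset.range (k + 1), lam ^ j * ‖iteratedDeriv j (fun l => E l x y) lam‖
      ≤ C * g lam x y

end FourthOrder

end

/-!
For `λ > 0` the boundary value of the free resolvent `(Δ² - λ⁴ ∓ i0)⁻¹` is the integral operator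
with kernel `λ⁻¹ f(λ|x-y|)`, where `f(z) = (e^{iz} - e^{-z}) / (8πz)` for the upper sign and `f`
is replaced by its complex conjugate for the lower one. Everything after the limiting absorption
principle uses only what the two profiles have in common, the structure `IsProfile`:
`f(0) = a ≠ 0`, `f'(0) = -1/(8π)`, and boundedness of `f⁽ʲ⁾(s)` and `s f⁽ʲ⁾(s)`.

*The limit exists.* With `v = |V|^{1/2}`, `U = sign V` and `M = U + v R₀ v`, the symmetric
resolvent identity `(H - z)⁻¹ = R₀ - R₀ v M⁻¹ v R₀` (`resolvent_ae_eq`) gives the perturbed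
resolvent as an integral operator. The free kernels are bounded and converge uniformly as `z`
tends to `λ⁴`, and `⟨·⟩^{-σ} ∈ L²` for `σ > 3/2`, so once `M` is invertible at `λ⁴` the kernels of
the perturbed resolvent converge uniformly, which is stronger than the required convergence in
weighted spaces (`isLimitingKernel_resKer`).

*The singularity at zero energy has rank one.* The kernel `λ⁻¹ f(λ|x-y|)` equals
`(a/λ) p(x) p(y) + F(x,y)` with `p(x) = f(λ|x|)/a = 1 + O₂(λ⟨x⟩)` and
`F(x,y) = (|x| + |y| - |x-y|)/(8π) + O₂(λ⟨x⟩⟨y⟩)`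
(`IsProfile.profKer_decomp`, `IsProfile.symLim_regP`, `IsProfile.symLim_regF`).
Splitting off `p ⊗ p`, and not the constant kernel, is what makes the error `O(λ⟨x⟩⟨y⟩)` where one
would expect `O(λ|x-y|²)`: up to the product of `f(λ|x|) - a` and `f(λ|y|) - a`, it is a second
difference `g(λ|x-y|) - g(λ|x|) - g(λ|y|)` of a function `g` that vanishes to second order at zero
(`norm_triple_le`).

*Removing the singularity.* `M` is the Schur complement of the bordered operator
`(φ, c) ↦ ((U + v F v) φ - c v p, ∫ v p φ + (λ/a) c)` on `L² × ℂ`, which contains no negative power of `λ`, and the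
kernel of `R₀ - R₀ v M⁻¹ v R₀` can be written through the inverse of the bordered operator alone,
the terms in `λ⁻¹` cancelling (`resKer_eq_bordKer`). At `λ = 0` the bordered operator does not
depend on the profile. It is invertible there because solving with it amounts to inverting
`U + v F v` compressed to the orthogonal complement of `v`, where `F` may be replaced by `G₀` since the
terms `|x|` and `|y|` are removed by the two projections; this is the regularity of zero
(`isUnit_bordOp_zero`). Inversion preserves bounds of the form `O₂(λ)` (`SymBd.ringInverse`), and
the expansion follows, with a leading term common to both signs (`IsProfile.resKer_expansion`).

*Two derivatives in operator norm.* Each derivative in `λ` of `f(λ|x-y|)` costs a factor `|x-y|`.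
Kernels are therefore weighted by `⟨x⟩⁻²⟨y⟩⁻²`, which makes them twice differentiable paths of
bounded continuous functions (`IsProfile.contDiffOn_profPath`), and the weights are compensated by
replacing `v` with `⟨·⟩² v`. The latter lies in `L²` because `β > 7`.
-/

noncomputable section

namespace FourthOrder

/-! ### Resolvents of symmetric relations -/

section Abstract

variable {𝓗 : Type*} [NormedAddCommGroup 𝓗] [InnerProductSpace ℂ 𝓗]

/-- A linear relation `G` on a Hilbert space (the graph of an operator) is symmetric when the
quadratic form `⟨u, g⟩` is real on it. -/
def SymmRel (G : Submodule ℂ (𝓗 × 𝓗)) : Prop :=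
  ∀ p ∈ G, (inner ℂ p.1 p.2 : ℂ).im = 0

/-- `G - z` is surjective. -/
def SurjAt (G : Submodule ℂ (𝓗 × 𝓗)) (z : ℂ) : Prop :=
  ∀ f : 𝓗, ∃ u : 𝓗, (u, f + z • u) ∈ G

/-- The relation `G + D`, for a bounded operator `D`. -/
def addRel (G : Submodule ℂ (𝓗 × 𝓗)) (D : 𝓗 →L[ℂ] 𝓗) : Submodule ℂ (𝓗 × 𝓗) where
  carrier := {p | (p.1, p.2 - D p.1) ∈ G}
  add_mem' := by
    intro a b ha hb
    have := G.add_mem ha hb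
    simp only [Set.mem_ofPred_eq, Prod.fst_add, Prod.snd_add, map_add] at this ⊢
    convert this using 1
    ext <;> simp
    abel
  zero_mem' := by
    simp only [Set.mem_ofPred_eq, Prod.fst_zero, Prod.snd_zero, map_zero, sub_zero]
    exact G.zero_mem
  smul_mem' := by
    intro c a ha
    have := G.smul_mem c ha
    simp only [Set.mem_ofPred_eq, Prod.smul_fst, Prod.smul_snd, map_smul] at this ⊢
    convert this using 1
    ext <;> simp [smul_sub]

theorem mem_addRel {G : Submodule ℂ (𝓗 × 𝓗)} {D : 𝓗 →L[ℂ] 𝓗} {u w : 𝓗} :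
    (u, w) ∈ addRel G D ↔ (u, w - D u) ∈ G := Iff.rfl

/-- The basic resolvent estimate `|Im z| ‖u‖ ≤ ‖(G - z) u‖`, from the imaginary part of
`⟨u, (G - z) u⟩`. -/
theorem SymmRel.norm_le {G : Submodule ℂ (𝓗 × 𝓗)} (hG : SymmRel G) {z : ℂ}
    {u f : 𝓗} (h : (u, f + z • u) ∈ G) : |z.im| * ‖u‖ ≤ ‖f‖ := by
  have h1 := hG _ h
  simp only [inner_add_right, inner_smul_right, Complex.add_im, Complex.mul_im,
    inner_self_eq_norm_sq_to_K] at h1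
  have h2 : (inner ℂ u f : ℂ).im = - (z.im * ‖u‖ ^ 2) := by
    have h3 : ((‖u‖ : ℂ) ^ 2).re = ‖u‖ ^ 2 := by norm_cast
    have h4 : ((‖u‖ : ℂ) ^ 2).im = 0 := by norm_cast
    change _ + (z.re * ((‖u‖ : ℂ) ^ 2).im + z.im * ((‖u‖ : ℂ) ^ 2).re) = 0 at h1
    rw [h3, h4] at h1
    linarith
  have h3 : |(inner ℂ u f : ℂ).im| ≤ ‖u‖ * ‖f‖ :=
    (Complex.abs_im_le_norm _).trans (norm_inner_le_norm u f)
  rw [h2, abs_neg, abs_mul, abs_of_nonneg (sq_nonneg ‖u‖)] at h3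
  rcases (norm_nonneg u).eq_or_lt with h0 | h0
  · rw [← h0]; simp
  · have : ‖u‖ * (|z.im| * ‖u‖) ≤ ‖u‖ * ‖f‖ := by nlinarith
    exact le_of_mul_le_mul_left this h0

/-- A symmetric relation that is surjective at a non-real `z` has a bounded resolvent there. -/
theorem SymmRel.exists_resolvent {G : Submodule ℂ (𝓗 × 𝓗)} (hG : SymmRel G) {z : ℂ}
    (hz : z.im ≠ 0) (hs : SurjAt G z) :
    ∃ R : 𝓗 →L[ℂ] 𝓗, ‖R‖ ≤ |z.im|⁻¹ ∧ (∀ f, (R f, f + z • R f) ∈ G) ∧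
      ∀ u w, (u, w) ∈ G → R (w - z • u) = u := by
  have hz' : 0 < |z.im| := abs_pos.mpr hz
  have huniq : ∀ f u u' : 𝓗, (u, f + z • u) ∈ G → (u', f + z • u') ∈ G → u = u' := by
    intro f u u' h h'
    have h1 := G.sub_mem h h'
    have h2 : (u - u', (0 : 𝓗) + z • (u - u')) ∈ G := by
      convert h1 using 1
      ext <;> simp [smul_sub]
    have h3 := hG.norm_le h2
    rw [norm_zero] at h3
    have h4 : ‖u - u'‖ ≤ 0 := by
      by_contra hc
      push Not at hc
      nlinarith [mul_pos hz' hc]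
    exact sub_eq_zero.mp (norm_le_zero_iff.mp h4)
  choose r hr using hs
  let L : 𝓗 →ₗ[ℂ] 𝓗 :=
    { toFun := r
      map_add' := by
        intro f g
        apply huniq (f + g) _ _ (hr _)
        convert G.add_mem (hr f) (hr g) using 1
        ext <;> simp
        abel
      map_smul' := by
        intro c f
        apply huniq (c • f) _ _ (hr _)
        convert G.smul_mem c (hr f) using 1
        ext <;> simp
        rw [smul_comm] }
  have hb : ∀ f, ‖L f‖ ≤ |z.im|⁻¹ * ‖f‖ := by
    intro f
    have := hG.norm_le (hr f)
    change ‖r f‖ ≤ _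
    rw [inv_mul_eq_div, le_div_iff₀ hz']
    linarith
  refine ⟨L.mkContinuous _ hb, L.mkContinuous_norm_le (by positivity) hb, hr, ?_⟩
  intro u w h
  apply huniq (w - z • u) _ _ (hr _)
  convert h using 2
  simp

/-- Surjectivity is stable under perturbations that are small relative to the resolvent
(Neumann series). -/
theorem SurjAt.addRel [CompleteSpace 𝓗] {G : Submodule ℂ (𝓗 × 𝓗)} {z : ℂ} {R D : 𝓗 →L[ℂ] 𝓗}
    (hR : ∀ f, (R f, f + z • R f) ∈ G) (hD : ‖D‖ * ‖R‖ < 1) : SurjAt (addRel G D) z := by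
  intro f
  have h1 : ‖-(D ∘L R)‖ < 1 := by
    rw [norm_neg]
    exact (D.opNorm_comp_le R).trans_lt hD
  have hu : IsUnit (1 - -(D ∘L R)) := isUnit_one_sub_of_norm_lt_one h1
  obtain ⟨N, hN⟩ := hu
  set h := ((N⁻¹ : (𝓗 →L[ℂ] 𝓗)ˣ) : 𝓗 →L[ℂ] 𝓗) f
  have h2 : h + D (R h) = f := by
    have : (N : 𝓗 →L[ℂ] 𝓗) h = f := by
      change ((N : 𝓗 →L[ℂ] 𝓗) * ((N⁻¹ : (𝓗 →L[ℂ] 𝓗)ˣ) : 𝓗 →L[ℂ] 𝓗)) f = f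
      rw [Units.mul_inv]; rfl
    rw [hN] at this
    simpa using this
  refine ⟨R h, ?_⟩
  rw [mem_addRel]
  convert hR h using 2
  rw [← h2]; abel

/-- If a symmetric relation is surjective at every non-real point, so is its sum with a bounded
symmetric operator. -/
theorem SymmRel.exists_resolvent_add [CompleteSpace 𝓗] {G : Submodule ℂ (𝓗 × 𝓗)} (hG : SymmRel G)
    (hs : ∀ z : ℂ, z.im ≠ 0 → SurjAt G z) {D : 𝓗 →L[ℂ] 𝓗}
    (hD : ∀ u, (inner ℂ u (D u) : ℂ).im = 0) {z : ℂ} (hz : z.im ≠ 0) :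
    ∃ R : 𝓗 →L[ℂ] 𝓗, (∀ f, (R f, f + z • R f) ∈ FourthOrder.addRel G D) ∧
      ∀ u w, (u, w) ∈ FourthOrder.addRel G D → R (w - z • u) = u := by
  have hGD : SymmRel (FourthOrder.addRel G D) := by
    rintro ⟨u, w⟩ h
    have h1 := hG _ h
    simp only [inner_sub_right, Complex.sub_im, hD u, sub_zero] at h1
    exact h1
  have hpos : 0 < |z.im| := abs_pos.mpr hz
  set t : ℝ := 1 + (‖D‖ + 1) / |z.im| with ht
  have htpos : 1 < t := by rw [ht]; have : 0 < (‖D‖ + 1) / |z.im| := by positivity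
                           linarith
  -- the point `z₁` above (or below) `z` whose distance from the real axis exceeds `‖D‖`
  set z₁ : ℂ := ⟨z.re, t * z.im⟩ with hz₁
  have hz₁im : |z₁.im| = |z.im| + ‖D‖ + 1 := by
    simp only [hz₁, abs_mul, abs_of_pos (by linarith : 0 < t)]
    rw [ht]; field_simp
    ring
  have hne : z₁.im ≠ 0 := by
    apply abs_pos.mp; rw [hz₁im]; positivity
  have hp1 : 0 < |z₁.im| := abs_pos.mpr hne
  obtain ⟨R₀, hR₀, hR₀', -⟩ := hG.exists_resolvent hne (hs z₁ hne)
  have hs1 : SurjAt (FourthOrder.addRel G D) z₁ := by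
    apply SurjAt.addRel hR₀'
    calc ‖D‖ * ‖R₀‖ ≤ ‖D‖ * |z₁.im|⁻¹ := by gcongr
      _ < 1 := by
        rw [← div_eq_mul_inv, div_lt_one hp1, hz₁im]; linarith
  obtain ⟨R₁, hR₁, hR₁', -⟩ := hGD.exists_resolvent hne hs1
  -- going back from `z₁` to `z` is a second small perturbation, as `|z - z₁| < |Im z₁|`
  have hs2 : SurjAt (FourthOrder.addRel (FourthOrder.addRel G D)
      ((z₁ - z) • ContinuousLinearMap.id ℂ 𝓗)) z₁ := by
    apply SurjAt.addRel hR₁'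
    have hd : ‖z₁ - z‖ = |z₁.im| - |z.im| := by
      have : z₁ - z = (((t - 1) * z.im : ℝ) : ℂ) * Complex.I := by
        apply Complex.ext <;> simp [hz₁]
        ring
      rw [this, norm_mul, Complex.norm_I, mul_one, Complex.norm_real, Real.norm_eq_abs, abs_mul,
        abs_of_pos (by linarith : 0 < t - 1)]
      simp only [hz₁, abs_mul, abs_of_pos (by linarith : 0 < t)]
      ring
    have h1 : ‖(z₁ - z) • ContinuousLinearMap.id ℂ 𝓗‖ ≤ |z₁.im| - |z.im| := by
      rw [norm_smul, hd]
      have : 0 ≤ |z₁.im| - |z.im| := hd ▸ norm_nonneg _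
      exact mul_le_of_le_one_right this ContinuousLinearMap.norm_id_le
    have h0 : 0 ≤ |z₁.im| - |z.im| := hd ▸ norm_nonneg _
    calc _ ≤ (|z₁.im| - |z.im|) * |z₁.im|⁻¹ := by gcongr
      _ < 1 := by rw [← div_eq_mul_inv, div_lt_one hp1]; linarith
  have hs3 : SurjAt (FourthOrder.addRel G D) z := by
    intro f
    obtain ⟨u, hu⟩ := hs2 f
    refine ⟨u, ?_⟩
    rw [mem_addRel] at hu
    convert hu using 2
    simp [sub_smul]
    abel
  obtain ⟨R, -, h1, h2⟩ := hGD.exists_resolvent hz hs3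
  exact ⟨R, h1, h2⟩

end Abstract

/-! ### The free operator on the Fourier side -/

section FreeOperator

open Laplacian FourierTransform

/-- The symbol `(2π|ξ|)⁴` of `Δ²`, for the Fourier transform with kernel `e^{-2πi x·ξ}`. -/
def symb (ξ : E3) : ℝ := (2 * Real.pi * ‖ξ‖) ^ 4

theorem symb_temperate : (fun ξ : E3 => (symb ξ : ℂ)).HasTemperateGrowth := by
  have : (fun ξ : E3 => (symb ξ : ℂ)) =
      fun ξ : E3 => ((2 * Real.pi : ℝ) : ℂ) ^ 4 * (Complex.ofReal (‖ξ‖ ^ 2)) ^ 2 := by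
    ext ξ; simp only [symb]; push_cast; ring
  rw [this]
  fun_prop

theorem continuous_symb : Continuous symb := by unfold symb; fun_prop

theorem laplacian_eq_fourierInv (T : TemperedDistribution E3 ℂ) :
    Δ T = 𝓕⁻ (TemperedDistribution.smulLeftCLM ℂ
      (fun ξ : E3 => -((2 * Real.pi : ℝ) : ℂ) ^ 2 * Complex.ofReal (‖ξ‖ ^ 2)) (𝓕 T)) := by
  have ht : (fun x : E3 ↦ Complex.ofReal (‖x‖ ^ 2)).HasTemperateGrowth := by fun_prop
  have h1 : (fun ξ : E3 => -((2 * Real.pi : ℝ) : ℂ) ^ 2 * Complex.ofReal (‖ξ‖ ^ 2)) =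
      (-((2 * Real.pi : ℝ) : ℂ) ^ 2) • (fun x : E3 ↦ Complex.ofReal (‖x‖ ^ 2)) := rfl
  rw [TemperedDistribution.laplacian_eq_fourierMultiplierCLM, h1,
    TemperedDistribution.smulLeftCLM_smul ht, smul_apply,
    FourierTransform.fourierInv_smul, TemperedDistribution.fourierMultiplierCLM_apply,
    ← Complex.coe_smul]
  congr 1
  push_cast
  rfl

theorem fourier_bilaplacian (T : TemperedDistribution E3 ℂ) :
    𝓕 (Δ (Δ T)) = TemperedDistribution.smulLeftCLM ℂ (fun ξ : E3 => (symb ξ : ℂ)) (𝓕 T) := by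
  have ht : (fun ξ : E3 => -((2 * Real.pi : ℝ) : ℂ) ^ 2 *
      Complex.ofReal (‖ξ‖ ^ 2)).HasTemperateGrowth := by fun_prop
  rw [laplacian_eq_fourierInv, laplacian_eq_fourierInv, fourier_fourierInv_eq,
    fourier_fourierInv_eq, TemperedDistribution.smulLeftCLM_smulLeftCLM_apply ht ht]
  congr 2
  ext ξ
  simp only [symb, Pi.mul_apply]
  push_cast
  ring

/-- `Δ² u = g` in the sense of distributions means `ĝ = (2π|ξ|)⁴ û`. -/
theorem bilaplacian_eq_iff (u g : L2) :
    Δ (Δ (Lp.toTemperedDistribution u)) = Lp.toTemperedDistribution g ↔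
      ∀ᵐ ξ ∂(volume : Measure E3), (𝓕 g : L2) ξ = (symb ξ : ℂ) * (𝓕 u : L2) ξ := by
  have hF : Δ (Δ (Lp.toTemperedDistribution u)) = Lp.toTemperedDistribution g ↔
      TemperedDistribution.smulLeftCLM ℂ (fun ξ : E3 => (symb ξ : ℂ))
        (Lp.toTemperedDistribution (𝓕 u : L2)) = Lp.toTemperedDistribution (𝓕 g : L2) := by
    rw [← Lp.fourier_toTemperedDistribution_eq, ← Lp.fourier_toTemperedDistribution_eq,
      ← fourier_bilaplacian]
    constructor
    · intro h; rw [h]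
    · intro h
      have := congrArg (fun T => (𝓕⁻ T : TemperedDistribution E3 ℂ)) h
      simpa using this
  rw [hF]
  have hval : ∀ φ : SchwartzMap E3 ℂ, TemperedDistribution.smulLeftCLM ℂ
      (fun ξ : E3 => (symb ξ : ℂ)) (Lp.toTemperedDistribution (𝓕 u : L2)) φ =
        ∫ ξ, φ ξ * ((symb ξ : ℂ) * (𝓕 u : L2) ξ) := by
    intro φ
    rw [TemperedDistribution.smulLeftCLM_apply_apply, Lp.toTemperedDistribution_apply]
    apply integral_congr_ae
    filter_upwards with ξ
    rw [SchwartzMap.smulLeftCLM_apply_apply symb_temperate]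
    simp only [smul_eq_mul]
    ring
  constructor
  · intro h
    have hli1 : LocallyIntegrable (fun ξ : E3 => (symb ξ : ℂ) * (𝓕 u : L2) ξ) volume := by
      have h1 : LocallyIntegrable (𝓕 u : L2) volume :=
        (Lp.memLp (𝓕 u : L2)).locallyIntegrable (by norm_num)
      have h2 : Continuous (fun ξ : E3 => (symb ξ : ℂ)) :=
        Complex.continuous_ofReal.comp continuous_symb
      rw [locallyIntegrable_iff]
      intro K hK
      exact (h1.integrableOn_isCompact hK).continuousOn_mul h2.continuousOn hK
    have hli2 : LocallyIntegrable (𝓕 g : L2) volume :=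
        (Lp.memLp (𝓕 g : L2)).locallyIntegrable (by norm_num)
    apply ae_eq_of_integral_contDiff_smul_eq hli2 hli1
    intro φ hφ hφc
    have hφ₁ : HasCompactSupport (Complex.ofRealCLM ∘ φ) := hφc.comp_left rfl
    have hφ₂ : ContDiff ℝ (⊤ : ℕ∞) (Complex.ofRealCLM ∘ φ) := by fun_prop
    have h3 := congrArg (fun T => T (hφ₁.toSchwartzMap hφ₂)) h
    simp only [hval, Lp.toTemperedDistribution_apply] at h3
    simpa using h3.symm
  · intro h
    ext φ
    rw [hval, Lp.toTemperedDistribution_apply]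
    apply integral_congr_ae
    filter_upwards [h] with ξ hξ
    rw [hξ, smul_eq_mul]

/-- The graph of `Δ²` on `L²`. -/
def freeRel : Submodule ℂ (L2 × L2) where
  carrier := {p | ∀ᵐ ξ ∂(volume : Measure E3), (𝓕 p.2 : L2) ξ = (symb ξ : ℂ) * (𝓕 p.1 : L2) ξ}
  add_mem' := by
    intro a b ha hb
    simp only [Set.mem_ofPred_eq, Prod.fst_add, Prod.snd_add, FourierTransform.fourier_add] at *
    filter_upwards [ha, hb, Lp.coeFn_add (𝓕 a.1 : L2) (𝓕 b.1), Lp.coeFn_add (𝓕 a.2 : L2) (𝓕 b.2)]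
      with ξ h1 h2 h3 h4
    rw [h3, h4]
    simp only [Pi.add_apply, h1, h2]
    ring
  zero_mem' := by
    have h0 : (𝓕 (0 : L2) : L2) = 0 := by
      simpa only [zero_smul] using FourierTransform.fourier_smul (0 : ℂ) (0 : L2)
    simp only [Set.mem_ofPred_eq, Prod.fst_zero, Prod.snd_zero, h0]
    filter_upwards [Lp.coeFn_zero ℂ 2 (volume : Measure E3)] with ξ h
    rw [h]; simp
  smul_mem' := by
    intro c a ha
    simp only [Set.mem_ofPred_eq, Prod.smul_fst, Prod.smul_snd,
      FourierTransform.fourier_smul] at *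
    filter_upwards [ha, Lp.coeFn_smul c (𝓕 a.1 : L2), Lp.coeFn_smul c (𝓕 a.2 : L2)]
      with ξ h1 h3 h4
    rw [h3, h4]
    simp only [Pi.smul_apply, h1, smul_eq_mul]
    ring

theorem mem_freeRel {u g : L2} : (u, g) ∈ freeRel ↔
    ∀ᵐ ξ ∂(volume : Measure E3), (𝓕 g : L2) ξ = (symb ξ : ℂ) * (𝓕 u : L2) ξ := Iff.rfl

/-- `Δ²` is multiplication by a real function on the Fourier side. -/
theorem freeRel_symm : SymmRel freeRel := by
  rintro ⟨u, g⟩ h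
  rw [mem_freeRel] at h
  simp only
  rw [← Lp.inner_fourier_eq, L2.inner_def]
  have : ∀ᵐ ξ ∂(volume : Measure E3), inner ℂ ((𝓕 u : L2) ξ) ((𝓕 g : L2) ξ) =
      ((symb ξ * ‖(𝓕 u : L2) ξ‖ ^ 2 : ℝ) : ℂ) := by
    filter_upwards [h] with ξ hξ
    rw [hξ, RCLike.inner_apply, mul_assoc, RCLike.mul_conj]
    push_cast
    rfl
  rw [integral_congr_ae this, integral_complex_ofReal]
  exact Complex.ofReal_im _

theorem freeRel_surj (z : ℂ) (hz : z.im ≠ 0) : SurjAt freeRel z := by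
  intro f
  have hne : ∀ ξ, (symb ξ : ℂ) - z ≠ 0 := by
    intro ξ h
    apply hz
    have := congrArg Complex.im h
    simpa using this
  have hcont : Continuous (fun ξ : E3 => ((symb ξ : ℂ) - z)⁻¹) := by
    apply Continuous.inv₀ _ hne
    exact (Complex.continuous_ofReal.comp continuous_symb).sub continuous_const
  have hb : ∀ ξ, ‖((symb ξ : ℂ) - z)⁻¹‖ ≤ |z.im|⁻¹ := by
    intro ξ
    rw [norm_inv]
    apply inv_anti₀ (abs_pos.mpr hz)
    have := Complex.abs_im_le_norm ((symb ξ : ℂ) - z)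
    simpa using this
  have hm : MemLp (fun ξ => ((symb ξ : ℂ) - z)⁻¹ * (𝓕 f : L2) ξ) 2 volume := by
    apply (Lp.memLp (𝓕 f : L2)).of_le_mul (c := |z.im|⁻¹)
    · exact hcont.aestronglyMeasurable.mul (Lp.aestronglyMeasurable _)
    · filter_upwards with ξ
      rw [norm_mul]
      gcongr
      exact hb ξ
  refine ⟨𝓕⁻ (hm.toLp : L2), ?_⟩
  rw [mem_freeRel, FourierTransform.fourier_add, FourierTransform.fourier_smul,
    fourier_fourierInv_eq]
  filter_upwards [Lp.coeFn_add (𝓕 f : L2) (z • hm.toLp), Lp.coeFn_smul z (hm.toLp : L2),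
    hm.coeFn_toLp] with ξ h1 h2 h3
  rw [h1, Pi.add_apply, h2, Pi.smul_apply, h3, smul_eq_mul]
  field_simp [hne ξ]
  ring

end FreeOperator

/-! ### Multiplication and integral operators on `L²` -/

section IntegralOperators

open BoundedContinuousFunction

theorem memLp_mul_of_bound {m : E3 → ℂ} (hm : AEStronglyMeasurable m volume) {C : ℝ}
    (hC : ∀ x, ‖m x‖ ≤ C) (f : L2) : MemLp (fun x => m x * f x) 2 (volume : Measure E3) :=
  (Lp.memLp f).of_le_mul (c := C) (hm.mul (Lp.aestronglyMeasurable f))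
    (Eventually.of_forall fun x => by rw [norm_mul]; gcongr; exact hC x)

/-- Multiplication by a bounded measurable function, as an operator on `L²`. -/
def mulL (m : E3 → ℂ) (hm : AEStronglyMeasurable m volume) (C : ℝ) (hC : ∀ x, ‖m x‖ ≤ C) :
    L2 →L[ℂ] L2 :=
  have hmem := memLp_mul_of_bound hm hC
  LinearMap.mkContinuous
    { toFun := fun f => (hmem f).toLp
      map_add' := by
        intro f g
        rw [← MemLp.toLp_add]
        apply MemLp.toLp_congr
        filter_upwards [Lp.coeFn_add f g] with x hx
        simp only [hx, Pi.add_apply]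
        ring
      map_smul' := by
        intro c f
        simp only [RingHom.id_apply]
        rw [← MemLp.toLp_const_smul]
        apply MemLp.toLp_congr
        filter_upwards [Lp.coeFn_smul c f] with x hx
        simp only [hx, Pi.smul_apply, smul_eq_mul]
        ring } C
    (by
      intro f
      have : 0 ≤ C := (norm_nonneg _).trans (hC 0)
      apply Lp.norm_le_mul_norm_of_ae_le_mul
      filter_upwards [(hmem f).coeFn_toLp] with x hx
      simp only [LinearMap.coe_mk, AddHom.coe_mk, hx, norm_mul]
      gcongr
      exact hC x)

theorem mulL_ae (m : E3 → ℂ) (hm : AEStronglyMeasurable m volume) (C : ℝ)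
    (hC : ∀ x, ‖m x‖ ≤ C) (f : L2) :
    mulL m hm C hC f =ᵐ[volume] fun x => m x * f x :=
  (memLp_mul_of_bound hm hC f).coeFn_toLp

/-- Bounded continuous functions of one variable. -/
abbrev B1 := E3 →ᵇ ℂ

/-- Bounded continuous kernels. -/
abbrev B2 := (E3 × E3) →ᵇ ℂ

section weight

variable (w : E3 → ℂ) (hw : MemLp w 2 (volume : Measure E3))

/-- The `L²` norm of a weight. -/
def wt : ℝ := (eLpNorm w 2 (volume : Measure E3)).toReal

theorem wt_nonneg : 0 ≤ wt w := ENNReal.toReal_nonneg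

include hw in
theorem integrable_weight_mul (ψ : L2) : Integrable (fun y => w y * ψ y) volume :=
  hw.integrable_mul (Lp.memLp ψ)

include hw in
theorem integral_norm_weight_mul_le (ψ : L2) : ∫ y, ‖w y * ψ y‖ ≤ wt w * ‖ψ‖ := by
  have h1 : eLpNorm (fun y => w y * ψ y) 1 (volume : Measure E3) ≤
      eLpNorm w 2 volume * eLpNorm ψ 2 volume := by
    have := eLpNorm_smul_le_mul_eLpNorm (p := 2) (q := 2) (r := 1) (μ := (volume : Measure E3))
      (Lp.aestronglyMeasurable ψ) hw.1
    exact this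
  rw [integral_norm_eq_lintegral_enorm (integrable_weight_mul w hw ψ).1,
    ← eLpNorm_one_eq_lintegral_enorm, wt, Lp.norm_def, ← ENNReal.toReal_mul]
  exact ENNReal.toReal_mono (ENNReal.mul_ne_top hw.2.ne (Lp.eLpNorm_ne_top ψ)) h1

include hw in
theorem memLp_weight_mul (h : B1) : MemLp (fun x => w x * h x) 2 (volume : Measure E3) :=
  hw.of_le_mul (c := ‖h‖) (hw.1.mul h.continuous.aestronglyMeasurable)
    (Eventually.of_forall fun x => by
      rw [norm_mul, mul_comm]; gcongr; exact h.norm_coe_le_norm x)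

theorem norm_toLp_weight_mul_le (h : B1) :
    ‖(memLp_weight_mul w hw h).toLp‖ ≤ wt w * ‖h‖ := by
  rw [Lp.norm_toLp]
  have h1 : eLpNorm (fun x => w x * h x) 2 volume ≤ ENNReal.ofReal ‖h‖ * eLpNorm w 2 volume :=
    eLpNorm_le_mul_eLpNorm_of_ae_le_mul (Eventually.of_forall fun x => by
      rw [norm_mul, mul_comm]; gcongr; exact h.norm_coe_le_norm x) 2
  calc _ ≤ (ENNReal.ofReal ‖h‖ * eLpNorm w 2 volume).toReal :=
        ENNReal.toReal_mono (ENNReal.mul_ne_top ENNReal.ofReal_ne_top hw.2.ne) h1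
    _ = _ := by
        rw [ENNReal.toReal_mul, ENNReal.toReal_ofReal (norm_nonneg _), mul_comm]; rfl

/-- The map `h ↦ w h` from bounded continuous functions to `L²`. -/
def vecL : B1 →L[ℂ] L2 :=
  have hmem := memLp_weight_mul w hw
  LinearMap.mkContinuous
    { toFun := fun h => (hmem h).toLp
      map_add' := by
        intro f g
        rw [← MemLp.toLp_add]
        apply MemLp.toLp_congr
        filter_upwards with x
        simp only [BoundedContinuousFunction.coe_add, Pi.add_apply]
        ring
      map_smul' := by
        intro c f
        simp only [RingHom.id_apply]
        rw [← MemLp.toLp_const_smul]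
        apply MemLp.toLp_congr
        filter_upwards with x
        simp only [BoundedContinuousFunction.coe_smul, Pi.smul_apply, smul_eq_mul]
        ring } (wt w)
    (norm_toLp_weight_mul_le w hw)

theorem vecL_ae (h : B1) : vecL w hw h =ᵐ[volume] fun x => w x * h x :=
  (memLp_weight_mul w hw h).coeFn_toLp

theorem norm_vecL_le (h : B1) : ‖vecL w hw h‖ ≤ wt w * ‖h‖ :=
  norm_toLp_weight_mul_le w hw h

include hw in
theorem integrable_bcf_mul (h : B1) (ψ : L2) :
    Integrable (fun y => h y * (w y * ψ y)) volume :=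
  (integrable_weight_mul w hw ψ).bdd_mul (c := ‖h‖) h.continuous.aestronglyMeasurable
    (Eventually.of_forall fun x => h.norm_coe_le_norm x)

include hw in
theorem norm_integral_bcf_mul_le (h : B1) (ψ : L2) :
    ‖∫ y, h y * (w y * ψ y)‖ ≤ wt w * ‖h‖ * ‖ψ‖ := by
  calc ‖∫ y, h y * (w y * ψ y)‖ ≤ ∫ y, ‖h‖ * ‖w y * ψ y‖ := by
        apply norm_integral_le_of_norm_le ((integrable_weight_mul w hw ψ).norm.const_mul _)
        filter_upwards with x
        rw [norm_mul]
        gcongr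
        exact h.norm_coe_le_norm x
    _ = ‖h‖ * ∫ y, ‖w y * ψ y‖ := integral_const_mul _ _
    _ ≤ ‖h‖ * (wt w * ‖ψ‖) := by gcongr; exact integral_norm_weight_mul_le w hw ψ
    _ = _ := by ring

/-- The bilinear pairing `∫ h w ψ`. -/
def pairL : B1 →L[ℂ] L2 →L[ℂ] ℂ :=
  LinearMap.mkContinuous₂
    (LinearMap.mk₂ ℂ (fun (h : B1) (ψ : L2) => ∫ y, h y * (w y * ψ y))
      (by
        intro h h' ψ
        rw [← integral_add (integrable_bcf_mul w hw h ψ) (integrable_bcf_mul w hw h' ψ)]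
        congr 1; ext y; simp; ring)
      (by
        intro c h ψ
        rw [smul_eq_mul, ← integral_const_mul]
        congr 1; ext y; simp; ring)
      (by
        intro h ψ ψ'
        rw [← integral_add (integrable_bcf_mul w hw h ψ) (integrable_bcf_mul w hw h ψ')]
        apply integral_congr_ae
        filter_upwards [Lp.coeFn_add ψ ψ'] with y hy
        rw [hy]; simp; ring)
      (by
        intro c h ψ
        rw [smul_eq_mul, ← integral_const_mul]
        apply integral_congr_ae
        filter_upwards [Lp.coeFn_smul c ψ] with y hy
        rw [hy]; simp; ring)) (wt w)
    (norm_integral_bcf_mul_le w hw)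

theorem pairL_apply (h : B1) (ψ : L2) : pairL w hw h ψ = ∫ y, h y * (w y * ψ y) := rfl

theorem norm_pairL_le (h : B1) : ‖pairL w hw h‖ ≤ wt w * ‖h‖ :=
  ContinuousLinearMap.opNorm_le_bound _ (by have := wt_nonneg w; positivity)
    (norm_integral_bcf_mul_le w hw h)

/-- The slice `κ(x, ·)`. -/
def sliceL (x : E3) : B2 →L[ℂ] B1 :=
  LinearMap.mkContinuous
    { toFun := fun κ => κ.compContinuous ⟨fun y => (x, y), by fun_prop⟩
      map_add' := fun _ _ => rfl
      map_smul' := fun _ _ => rfl } 1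
    (by
      intro κ
      rw [one_mul]
      exact (norm_le (norm_nonneg _)).mpr fun y => κ.norm_coe_le_norm (x, y))

@[simp] theorem sliceL_apply (x : E3) (κ : B2) (y : E3) : sliceL x κ y = κ (x, y) := rfl

theorem norm_sliceL_le (x : E3) (κ : B2) : ‖sliceL x κ‖ ≤ ‖κ‖ :=
  (norm_le (norm_nonneg _)).mpr fun y => κ.norm_coe_le_norm (x, y)

include hw in
theorem continuous_pairL_slice (κ : B2) (ψ : L2) :
    Continuous fun x => pairL w hw (sliceL x κ) ψ := by
  simp only [pairL_apply, sliceL_apply]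
  apply continuous_of_dominated (bound := fun y => ‖κ‖ * ‖w y * ψ y‖)
  · intro x
    exact (integrable_bcf_mul w hw (sliceL x κ) ψ).1
  · intro x
    filter_upwards with y
    rw [norm_mul]
    gcongr
    exact κ.norm_coe_le_norm _
  · exact (integrable_weight_mul w hw ψ).norm.const_mul _
  · filter_upwards with y
    fun_prop

theorem norm_pairL_slice_le (κ : B2) (ψ : L2) (x : E3) :
    ‖pairL w hw (sliceL x κ) ψ‖ ≤ wt w * ‖κ‖ * ‖ψ‖ := by
  have h0 := wt_nonneg w
  refine (norm_integral_bcf_mul_le w hw _ ψ).trans ?_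
  gcongr
  exact norm_sliceL_le x κ

/-- The operator `ψ ↦ ∫ κ(·, y) w(y) ψ(y) dy` from `L²` to bounded continuous functions. -/
def intL : B2 →L[ℂ] L2 →L[ℂ] B1 :=
  LinearMap.mkContinuous₂
    (LinearMap.mk₂ ℂ (fun (κ : B2) (ψ : L2) => ofNormedAddCommGroup
        (fun x => pairL w hw (sliceL x κ) ψ) (continuous_pairL_slice w hw κ ψ) _
        (norm_pairL_slice_le w hw κ ψ))
      (by intro κ κ' ψ; ext x; simp)
      (by intro c κ ψ; ext x; simp)
      (by intro κ ψ ψ'; ext x; simp)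
      (by intro c κ ψ; ext x; simp)) (wt w)
    (by
      intro κ ψ
      have h0 := wt_nonneg w
      exact norm_ofNormedAddCommGroup_le _ (by positivity) (norm_pairL_slice_le w hw κ ψ))

theorem intL_apply (κ : B2) (ψ : L2) (x : E3) :
    intL w hw κ ψ x = pairL w hw (sliceL x κ) ψ := rfl

/-- The integral operator `w κ w` on `L²`, for a bounded continuous kernel `κ`. -/
def opL : B2 →L[ℂ] L2 →L[ℂ] L2 :=
  (ContinuousLinearMap.compL ℂ L2 B1 L2 (vecL w hw)).comp (intL w hw)

theorem opL_apply (κ : B2) (ψ : L2) : opL w hw κ ψ = vecL w hw (intL w hw κ ψ) := rfl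

theorem opL_ae (κ : B2) (ψ : L2) :
    opL w hw κ ψ =ᵐ[volume] fun x => w x * ∫ y, κ (x, y) * (w y * ψ y) :=
  vecL_ae w hw _

end weight

/-! ### The resolvent of `Δ² + V` -/

section resolvent

variable {V : E3 → ℝ} (hV : Measurable V) {C : ℝ} (hC : ∀ x, |V x| ≤ C)

/-- Multiplication by the potential. -/
def potL : L2 →L[ℂ] L2 :=
  mulL (fun x => (V x : ℂ)) (Complex.measurable_ofReal.comp hV).aestronglyMeasurable C
    (by simpa using hC)

theorem potL_ae (f : L2) : potL hV hC f =ᵐ[volume] fun x => (V x : ℂ) * f x := mulL_ae _ _ _ _ f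

/-- The graph of `H = Δ² + V` is the bounded perturbation by `V` of the graph of `Δ²`. -/
theorem hgraph_iff (u w : L2) : HGraph V u w ↔ (u, w) ∈ addRel freeRel (potL hV hC) := by
  rw [mem_addRel, mem_freeRel, ← bilaplacian_eq_iff]
  constructor
  · rintro ⟨g, hg, hw⟩
    have : w - potL hV hC u = g := by
      apply Lp.ext
      filter_upwards [hw, Lp.coeFn_sub w (potL hV hC u), potL_ae hV hC u] with x h1 h2 h3
      rw [h2, Pi.sub_apply, h1, h3]; ring
    rw [this]; exact hg
  · intro h
    refine ⟨_, h, ?_⟩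
    filter_upwards [Lp.coeFn_sub w (potL hV hC u), potL_ae hV hC u] with x h2 h3
    rw [h2, Pi.sub_apply, h3]; ring

include hV hC in
/-- For bounded real `V` every non-real point is in the resolvent set of `H`. -/
theorem exists_isResolventAt {z : ℂ} (hz : z.im ≠ 0) : ∃ R, IsResolventAt V z R := by
  have hD : ∀ u, (inner ℂ u (potL hV hC u) : ℂ).im = 0 := by
    intro u
    rw [L2.inner_def]
    have : ∀ᵐ x ∂(volume : Measure E3), inner ℂ (u x) ((potL hV hC u) x) =
        ((V x * ‖u x‖ ^ 2 : ℝ) : ℂ) := by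
      filter_upwards [potL_ae hV hC u] with x hx
      rw [hx, RCLike.inner_apply, mul_assoc, RCLike.mul_conj]
      push_cast
      rfl
    rw [integral_congr_ae this, integral_complex_ofReal]
    exact Complex.ofReal_im _
  obtain ⟨R, h1, h2⟩ := freeRel_symm.exists_resolvent_add freeRel_surj hD hz
  refine ⟨R, fun f => (hgraph_iff hV hC _ _).mpr (h1 f), fun u w h => ?_⟩
  exact h2 u w ((hgraph_iff hV hC _ _).mp h)

end resolvent

/-- Solutions in `L²` of `Δ² u = z u + h` are unique when `z` is not real. -/
theorem freeRel_unique {z : ℂ} (hz : z.im ≠ 0) {u u' h : L2} (h1 : (u, h + z • u) ∈ freeRel)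
    (h2 : (u', h + z • u') ∈ freeRel) : u = u' := by
  obtain ⟨R, -, -, hR⟩ := freeRel_symm.exists_resolvent hz (freeRel_surj z hz)
  have e1 := hR _ _ h1
  have e2 := hR _ _ h2
  rw [add_sub_cancel_right] at e1 e2
  rw [← e1, e2]

end IntegralOperators

/-! ### The profile of the free resolvent kernel -/

/-- The value `(1 + i) / (8π)` at zero of the profile `f(z) = (e^{iz} - e^{-z}) / (8π z)`. -/
def aCoef : ℂ := (1 + Complex.I) / (8 * Real.pi)

/-- The segment from `-1` to `i`. -/
def seg (t : ℝ) : ℂ := (t : ℂ) * (1 + Complex.I) - 1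

/-- The `j`-th derivative of the profile `f(z) = (e^{iz} - e^{-z}) / (8π z)`, written as the
average `a ∫ ω^j e^{zω}` over the segment of `ω` from `-1` to `i`. -/
def prof (j : ℕ) (z : ℂ) : ℂ := aCoef * ∫ t in (0 : ℝ)..1, seg t ^ j * Complex.exp (z * seg t)

theorem continuous_seg : Continuous seg := by unfold seg; fun_prop

theorem norm_seg_le {t : ℝ} (ht : t ∈ Icc (0 : ℝ) 1) : ‖seg t‖ ≤ 1 := by
  have : seg t = ((t - 1 : ℝ) : ℂ) + (t : ℝ) * Complex.I := by unfold seg; push_cast; ring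
  rw [this, ← sq_le_one_iff₀ (norm_nonneg _), Complex.sq_norm, Complex.normSq_add_mul_I]
  nlinarith [ht.1, ht.2]

theorem norm_exp_seg_le {z : ℂ} (h1 : 0 ≤ z.re) (h2 : 0 ≤ z.im) {t : ℝ} (ht : t ∈ Icc (0 : ℝ) 1) :
    ‖Complex.exp (z * seg t)‖ ≤ 1 := by
  rw [Complex.norm_exp, Real.exp_le_one_iff]
  have : (z * seg t).re = -((1 - t) * z.re) - t * z.im := by
    simp [seg]
    ring
  rw [this]
  nlinarith [ht.1, ht.2, mul_nonneg (sub_nonneg.mpr ht.2) h1, mul_nonneg ht.1 h2]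

/-- The derivatives of the profile are bounded on the closed first quadrant, where `e^{zw}` has
modulus at most one for `w` on the segment from `-1` to `i`. -/
theorem norm_prof_le (j : ℕ) {z : ℂ} (h1 : 0 ≤ z.re) (h2 : 0 ≤ z.im) :
    ‖prof j z‖ ≤ ‖aCoef‖ := by
  rw [prof, norm_mul]
  have : ‖∫ t in (0 : ℝ)..1, seg t ^ j * Complex.exp (z * seg t)‖ ≤ 1 * |(1 : ℝ) - 0| := by
    apply intervalIntegral.norm_integral_le_of_norm_le_const
    intro t ht
    rw [uIoc_of_le zero_le_one] at ht
    have ht' : t ∈ Icc (0 : ℝ) 1 := Ioc_subset_Icc_self ht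
    rw [norm_mul, norm_pow]
    exact mul_le_one₀ (pow_le_one₀ (norm_nonneg _) (norm_seg_le ht')) (norm_nonneg _)
      (norm_exp_seg_le h1 h2 ht')
  simp only [sub_zero, abs_one, mul_one] at this
  exact mul_le_of_le_one_right (norm_nonneg _) this

theorem hasDerivAt_prof (j : ℕ) (z : ℂ) : HasDerivAt (prof j) (prof (j + 1) z) z := by
  unfold prof
  apply HasDerivAt.const_mul
  have hc : ∀ (j : ℕ) (z : ℂ), Continuous fun t : ℝ => seg t ^ j * Complex.exp (z * seg t) := by
    intro j z
    have := continuous_seg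
    fun_prop
  refine (intervalIntegral.hasDerivAt_integral_of_dominated_loc_of_deriv_le
    (F := fun z t => seg t ^ j * Complex.exp (z * seg t))
    (F' := fun z t => seg t ^ (j + 1) * Complex.exp (z * seg t))
    (bound := fun _ => Real.exp (‖z‖ + 1)) (Metric.ball_mem_nhds z one_pos)
    (Eventually.of_forall fun y => (hc j y).aestronglyMeasurable)
    ((hc j z).intervalIntegrable _ _) (hc (j + 1) z).aestronglyMeasurable ?_
    intervalIntegrable_const ?_).2
  · filter_upwards with t ht y hy
    rw [uIoc_of_le zero_le_one] at ht
    have ht' : t ∈ Icc (0 : ℝ) 1 := Ioc_subset_Icc_self ht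
    rw [norm_mul, norm_pow]
    have h1 : ‖seg t‖ ^ (j + 1) ≤ 1 := pow_le_one₀ (norm_nonneg _) (norm_seg_le ht')
    have h2 : ‖Complex.exp (y * seg t)‖ ≤ Real.exp (‖z‖ + 1) := by
      refine (Complex.norm_exp_le_exp_norm _).trans (Real.exp_le_exp.mpr ?_)
      rw [norm_mul]
      have hy' : ‖y‖ ≤ ‖z‖ + 1 := by
        rw [Metric.mem_ball, dist_eq_norm] at hy
        linarith [norm_le_norm_add_norm_sub' y z]
      calc ‖y‖ * ‖seg t‖ ≤ ‖y‖ * 1 := by gcongr; exact norm_seg_le ht'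
        _ ≤ _ := by linarith
    calc _ ≤ 1 * Real.exp (‖z‖ + 1) := by gcongr
      _ = _ := one_mul _
  · filter_upwards with t ht y hy
    have h1 : HasDerivAt (fun y : ℂ => y * seg t) (seg t) y := by
      simpa using (hasDerivAt_id y).mul_const (seg t)
    refine (h1.cexp.const_mul (seg t ^ j)).congr_deriv ?_
    ring

/-- The derivatives of `z f(z) = (e^{iz} - e^{-z}) / (8π)`. -/
def eProf (j : ℕ) (z : ℂ) : ℂ :=
  (Complex.I ^ j * Complex.exp (Complex.I * z) - (-1) ^ j * Complex.exp (-z)) / (8 * Real.pi)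

theorem hasDerivAt_eProf (j : ℕ) (z : ℂ) : HasDerivAt (eProf j) (eProf (j + 1) z) z := by
  have h1 : HasDerivAt (fun y : ℂ => Complex.I * y) Complex.I z := by
    simpa using (hasDerivAt_id z).const_mul Complex.I
  have h2 : HasDerivAt (fun y : ℂ => -y) (-1) z := (hasDerivAt_id z).neg
  refine (((h1.cexp.const_mul (Complex.I ^ j)).sub
    (h2.cexp.const_mul ((-1) ^ j))).div_const (8 * (Real.pi : ℂ))).congr_deriv ?_
  simp only [eProf]
  ring

theorem norm_eProf_le (j : ℕ) {z : ℂ} (h1 : 0 ≤ z.re) (h2 : 0 ≤ z.im) : ‖eProf j z‖ ≤ 1 := by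
  have hpi : (2 : ℝ) ≤ 8 * Real.pi := by linarith [Real.pi_gt_three]
  have e1 : ‖Complex.exp (Complex.I * z)‖ ≤ 1 := by
    rw [Complex.norm_exp, Real.exp_le_one_iff]; simpa using h2
  have e2 : ‖Complex.exp (-z)‖ ≤ 1 := by
    rw [Complex.norm_exp, Real.exp_le_one_iff]; simpa using h1
  have e3 : ‖(8 * (Real.pi : ℂ))‖ = 8 * Real.pi := by
    rw [norm_mul, Complex.norm_real, Real.norm_of_nonneg Real.pi_pos.le]; norm_num
  rw [eProf, norm_div, e3, div_le_one (by linarith)]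
  refine (norm_sub_le _ _).trans ?_
  rw [norm_mul, norm_mul, norm_pow, norm_pow, Complex.norm_I, norm_neg, norm_one]
  simp only [one_pow, one_mul]
  linarith

/-- The integral over the segment evaluates to `(e^{iz} - e^{-z}) / (8πz)`. -/
theorem mul_prof_zero (z : ℂ) : z * prof 0 z = eProf 0 z := by
  have h : ∫ t in (0 : ℝ)..1, z * (1 + Complex.I) * Complex.exp (z * seg t) =
      Complex.exp (z * seg 1) - Complex.exp (z * seg 0) := by
    apply intervalIntegral.integral_eq_sub_of_hasDerivAt
      (f := fun t : ℝ => Complex.exp (z * seg t))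
    · intro t _
      have h1 : HasDerivAt seg (1 + Complex.I) t := by
        have h2 : HasDerivAt (fun t : ℝ => (t : ℂ) * (1 + Complex.I) - 1) (1 + Complex.I) t := by
          simpa using (Complex.ofRealCLM.hasDerivAt (x := t)).mul_const (1 + Complex.I)
        exact h2
      refine (h1.const_mul z).cexp.congr_deriv ?_
      ring
    · apply Continuous.intervalIntegrable
      have := continuous_seg
      fun_prop
  rw [intervalIntegral.integral_const_mul] at h
  have e1 : z * seg 1 = Complex.I * z := by simp [seg, mul_comm]
  have e2 : z * seg 0 = -z := by simp [seg]
  rw [e1, e2] at h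
  simp only [prof, eProf, aCoef, pow_zero, one_mul]
  rw [← h]
  ring

/-- The recursion obtained by differentiating `z f(z) = (e^{iz} - e^{-z}) / (8π)`. -/
theorem mul_prof_succ (j : ℕ) (z : ℂ) :
    z * prof (j + 1) z = eProf (j + 1) z - (j + 1) * prof j z := by
  induction j generalizing z with
  | zero =>
    have h1 : HasDerivAt (fun y => y * prof 0 y) (1 * prof 0 z + z * prof 1 z) z :=
      (hasDerivAt_id z).mul (hasDerivAt_prof 0 z)
    rw [funext mul_prof_zero] at h1
    have := h1.unique (hasDerivAt_eProf 0 z)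
    simp only [zero_add, Nat.cast_zero] at this ⊢
    linear_combination this
  | succ j ih =>
    have h1 : HasDerivAt (fun y => y * prof (j + 1) y)
        (1 * prof (j + 1) z + z * prof (j + 2) z) z :=
      (hasDerivAt_id z).mul (hasDerivAt_prof (j + 1) z)
    rw [funext ih] at h1
    have := h1.unique
      ((hasDerivAt_eProf (j + 1) z).sub ((hasDerivAt_prof j z).const_mul ((j : ℂ) + 1)))
    push_cast
    linear_combination this

/-- The profile and its derivatives decay like `1/|z|` on the closed first quadrant. -/
theorem norm_mul_prof_le (j : ℕ) {z : ℂ} (h1 : 0 ≤ z.re) (h2 : 0 ≤ z.im) :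
    ‖z * prof j z‖ ≤ 1 + j * ‖aCoef‖ := by
  cases j with
  | zero => rw [mul_prof_zero]; simpa using norm_eProf_le 0 h1 h2
  | succ j =>
    rw [mul_prof_succ]
    refine (norm_sub_le _ _).trans ?_
    have h3 : ‖((j : ℂ) + 1) * prof j z‖ ≤ ((j : ℝ) + 1) * ‖aCoef‖ := by
      rw [norm_mul]
      have : ‖(j : ℂ) + 1‖ = (j : ℝ) + 1 := by
        have := Complex.norm_natCast (j + 1); push_cast at this; exact this
      rw [this]
      gcongr
      exact norm_prof_le j h1 h2
    push_cast
    linarith [norm_eProf_le (j + 1) h1 h2]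

theorem prof_zero_zero : prof 0 0 = aCoef := by simp [prof]

theorem prof_one_zero : prof 1 0 = -1 / (8 * Real.pi) := by
  have := mul_prof_succ 0
  have h : ∫ t in (0 : ℝ)..1, seg t = (Complex.I - 1) / 2 := by
    unfold seg
    rw [intervalIntegral.integral_sub (by apply Continuous.intervalIntegrable; fun_prop)
      (by simp), intervalIntegral.integral_mul_const, intervalIntegral.integral_ofReal]
    simp
    ring
  simp only [prof, zero_mul, Complex.exp_zero, mul_one, pow_one, h, aCoef]
  field_simp
  ring_nf
  simp
  ring

theorem aCoef_ne_zero : aCoef ≠ 0 := by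
  unfold aCoef
  have : (1 + Complex.I) ≠ 0 := by
    intro h; have := congrArg Complex.re h; simp at this
  have h2 : (8 * (Real.pi : ℂ)) ≠ 0 := by
    simp [Real.pi_ne_zero]
  exact div_ne_zero this h2

/-- The properties of the profile of a limiting free resolvent kernel `λ⁻¹ f(λ|x-y|)` on which the
low-energy expansion rests; `f j` is the `j`-th derivative of the profile. The outgoing profile
and its complex conjugate, the incoming one, share them. -/
structure IsProfile (a : ℂ) (f : ℕ → ℝ → ℂ) (C : ℝ) : Prop where
  ne_zero : a ≠ 0
  zero_zero : f 0 0 = a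
  one_zero : f 1 0 = -1 / (8 * Real.pi)
  hasDerivAt : ∀ j s, HasDerivAt (f j) (f (j + 1) s) s
  bound : ∀ j ≤ 3, ∀ s, 0 ≤ s → ‖f j s‖ ≤ C
  bound_mul : ∀ j ≤ 3, ∀ s, 0 ≤ s → s * ‖f j s‖ ≤ C

theorem isProfile_prof : IsProfile aCoef (fun j s => prof j s) (1 + 3 * ‖aCoef‖) where
  ne_zero := aCoef_ne_zero
  zero_zero := by simpa using prof_zero_zero
  one_zero := by simpa using prof_one_zero
  hasDerivAt := fun j s => (hasDerivAt_prof j s).comp_ofReal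
  bound := by
    intro j _ s hs
    refine (norm_prof_le j (by simpa using hs) (by simp)).trans ?_
    linarith [norm_nonneg aCoef]
  bound_mul := by
    intro j hj s hs
    have := norm_mul_prof_le j (z := s) (by simpa using hs) (by simp)
    rw [norm_mul, Complex.norm_real, Real.norm_of_nonneg hs] at this
    refine this.trans ?_
    have : (j : ℝ) ≤ 3 := by exact_mod_cast hj
    gcongr

theorem IsProfile.conj {a : ℂ} {f : ℕ → ℝ → ℂ} {C : ℝ} (h : IsProfile a f C) :
    IsProfile (starRingEnd ℂ a) (fun j s => starRingEnd ℂ (f j s)) C where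
  ne_zero := by simpa using h.ne_zero
  zero_zero := by rw [h.zero_zero]
  one_zero := by rw [h.one_zero]; simp [Complex.conj_ofNat]
  hasDerivAt := fun j s => (h.hasDerivAt j s).star
  bound := by simpa using h.bound
  bound_mul := by simpa using h.bound_mul

/-! ### The Fourier transform of the free resolvent kernel -/

section FreeKernel

open FourierTransform Laplacian

/-- The free resolvent kernel `(e^{iks} - e^{-ks}) / (8π k² s)` at distance `s`, with `k⁴` the
spectral parameter. -/
def greenR (k : ℂ) (s : ℝ) : ℂ := k⁻¹ * prof 0 (k * s)

theorem continuous_greenR (k : ℂ) : Continuous (greenR k) := by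
  have : Continuous (prof 0) :=
    continuous_iff_continuousAt.mpr fun z => (hasDerivAt_prof 0 z).continuousAt
  unfold greenR
  fun_prop

theorem mul_greenR {k : ℂ} (hk : k ≠ 0) (s : ℝ) :
    (s : ℂ) * greenR k s = (Complex.exp (Complex.I * k * s) - Complex.exp (-(k * s))) /
      (8 * Real.pi * k ^ 2) := by
  have := mul_prof_zero (k * s)
  simp only [eProf, pow_zero, one_mul, ← mul_assoc] at this
  have hpi : (Real.pi : ℂ) ≠ 0 := by simp [Real.pi_ne_zero]
  unfold greenR
  field_simp
  rw [mul_comm (s : ℂ) k, this]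
  field_simp

/-- The kernel decays exponentially, here recorded in polynomial form. -/
theorem greenR_decay {k : ℂ} (h1 : 0 < k.re) (h2 : 0 < k.im) :
    ∃ D, ∀ s, 0 ≤ s → ‖greenR k s‖ ≤ D * (1 + s) ^ (-(4 : ℝ)) := by
  have hk : k ≠ 0 := by rintro rfl; simp at h1
  have hk' : 0 < ‖k‖ := norm_pos_iff.mpr hk
  set c := min k.re k.im
  have hc : 0 < c := lt_min h1 h2
  set D₁ := ‖k‖⁻¹ * ‖aCoef‖ * 16
  set D₂ := 24 * Real.exp c / c ^ 4
  have hD₁ : 0 ≤ D₁ := by positivity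
  have hD₂ : 0 ≤ D₂ := by positivity
  have key : ∀ s : ℝ, 0 ≤ s → (1 + s) ^ 4 * Real.exp (-(c * s)) ≤ D₂ := by
    intro s hs
    have := Real.pow_div_factorial_le_exp (c * (1 + s)) (by positivity) 4
    rw [show c * (1 + s) = c + c * s by ring, Real.exp_add, ← show c * (1 + s) = c + c * s by ring,
      mul_pow, div_le_iff₀ (by positivity)] at this
    simp only [Nat.factorial] at this
    rw [Real.exp_neg, ← div_eq_mul_inv, div_le_iff₀ (Real.exp_pos _)]
    simp only [D₂]
    rw [div_mul_eq_mul_div, le_div_iff₀ (by positivity)]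
    push_cast at this
    linarith
  refine ⟨D₁ + D₂ / ‖k‖ ^ 2, fun s hs => ?_⟩
  have hpos : (0 : ℝ) < (1 + s) ^ 4 := by positivity
  have hrp : (1 + s) ^ (-(4 : ℝ)) = ((1 + s) ^ 4)⁻¹ := by
    rw [Real.rpow_neg (by positivity)]
    norm_cast
  rw [hrp, ← div_eq_mul_inv, le_div_iff₀ hpos]
  rcases le_or_gt s 1 with h | h
  · have e1 : ‖greenR k s‖ ≤ ‖k‖⁻¹ * ‖aCoef‖ := by
      rw [greenR, norm_mul, norm_inv]
      gcongr
      apply norm_prof_le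
      · simp; positivity
      · simp; positivity
    have e2 : (1 + s) ^ 4 ≤ 16 := by
      calc (1 + s) ^ 4 ≤ 2 ^ 4 := by gcongr; linarith
        _ = 16 := by norm_num
    calc _ ≤ ‖k‖⁻¹ * ‖aCoef‖ * 16 := by gcongr
      _ ≤ _ := by
        have : 0 ≤ D₂ / ‖k‖ ^ 2 := by positivity
        linarith
  · have e1 : s * ‖greenR k s‖ ≤ Real.exp (-(c * s)) / ‖k‖ ^ 2 := by
      have := congrArg norm (mul_greenR hk s)
      rw [norm_mul, Complex.norm_real, Real.norm_of_nonneg hs] at this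
      rw [this, norm_div]
      have e3 : ‖8 * (Real.pi : ℂ) * k ^ 2‖ = 8 * Real.pi * ‖k‖ ^ 2 := by
        rw [norm_mul, norm_mul, Complex.norm_real, Real.norm_of_nonneg Real.pi_pos.le, norm_pow]
        norm_num
      have e4 : ‖Complex.exp (Complex.I * k * s)‖ ≤ Real.exp (-(c * s)) := by
        rw [Complex.norm_exp]
        apply Real.exp_le_exp.mpr
        simp
        exact mul_le_mul_of_nonneg_right (min_le_right _ _) hs
      have e5 : ‖Complex.exp (-(k * s))‖ ≤ Real.exp (-(c * s)) := by
        rw [Complex.norm_exp]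
        apply Real.exp_le_exp.mpr
        simp
        exact mul_le_mul_of_nonneg_right (min_le_left _ _) hs
      rw [e3, div_le_div_iff₀ (by have := Real.pi_pos; positivity) (by positivity)]
      have e6 := norm_sub_le (Complex.exp (Complex.I * k * s)) (Complex.exp (-(k * s)))
      calc _ ≤ 2 * Real.exp (-(c * s)) * ‖k‖ ^ 2 := by gcongr; linarith
        _ ≤ _ := by
          have : 0 ≤ Real.exp (-(c * s)) * ‖k‖ ^ 2 := by positivity
          nlinarith [Real.pi_gt_three]
    have e2 : ‖greenR k s‖ ≤ Real.exp (-(c * s)) / ‖k‖ ^ 2 := by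
      nlinarith [norm_nonneg (greenR k s)]
    calc _ ≤ Real.exp (-(c * s)) / ‖k‖ ^ 2 * (1 + s) ^ 4 := by gcongr
      _ = (1 + s) ^ 4 * Real.exp (-(c * s)) / ‖k‖ ^ 2 := by ring
      _ ≤ D₂ / ‖k‖ ^ 2 := by gcongr; exact key s hs
      _ ≤ _ := by linarith

theorem integrable_greenR_norm {k : ℂ} (h1 : 0 < k.re) (h2 : 0 < k.im) :
    Integrable (fun x : E3 => greenR k ‖x‖) volume := by
  obtain ⟨D, hD⟩ := greenR_decay h1 h2
  have hi : Integrable (fun x : E3 => D * (1 + ‖x‖) ^ (-(4 : ℝ))) volume :=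
    (integrable_one_add_norm (by simp; norm_num)).const_mul D
  refine hi.mono' ((continuous_greenR k).comp continuous_norm).aestronglyMeasurable ?_
  filter_upwards with x
  exact hD _ (norm_nonneg x)

/-- The Fourier transform of `e^{-κ|t|}` on the line. -/
theorem integral_exp_neg_abs {κ : ℂ} (hκ : 0 < κ.re) (N : ℝ) :
    Integrable (fun t : ℝ => Complex.exp (-(N * t * Complex.I)) * Complex.exp (-(κ * |t|))) volume ∧
    ∫ t : ℝ, Complex.exp (-(N * t * Complex.I)) * Complex.exp (-(κ * |t|)) =
      2 * κ / (κ ^ 2 + N ^ 2) := by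
  have hr1 : (-(N * Complex.I) - κ).re < 0 := by simpa using hκ
  have hr2 : 0 < (-(N * Complex.I) + κ).re := by simpa using hκ
  have hn1 : -(N * Complex.I) - κ ≠ 0 := by intro h; rw [h] at hr1; simp at hr1
  have hn2 : -(N * Complex.I) + κ ≠ 0 := by intro h; rw [h] at hr2; simp at hr2
  set F := fun t : ℝ => Complex.exp (-(N * t * Complex.I)) * Complex.exp (-(κ * |t|))
  have hp : EqOn F (fun t : ℝ => Complex.exp ((-(N * Complex.I) - κ) * t)) (Ioi 0) := by
    intro t ht
    simp only [F]
    rw [abs_of_pos ht, ← Complex.exp_add]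
    congr 1; ring
  have hm : EqOn F (fun t : ℝ => Complex.exp ((-(N * Complex.I) + κ) * t)) (Iic 0) := by
    intro t ht
    simp only [F]
    rw [abs_of_nonpos ht, ← Complex.exp_add]
    congr 1; push_cast; ring
  have i1 : IntegrableOn F (Ioi 0) :=
    (integrableOn_exp_mul_complex_Ioi hr1 0).congr_fun hp.symm measurableSet_Ioi
  have i2 : IntegrableOn F (Iic 0) :=
    (integrableOn_exp_mul_complex_Iic hr2 0).congr_fun hm.symm measurableSet_Iic
  refine ⟨?_, ?_⟩
  · rw [← integrableOn_univ, ← Iic_union_Ioi (a := (0 : ℝ))]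
    exact i2.union i1
  · rw [← setIntegral_univ, ← Iic_union_Ioi (a := (0 : ℝ)),
      setIntegral_union (Iic_disjoint_Ioi le_rfl) measurableSet_Ioi i2 i1,
      setIntegral_congr_fun measurableSet_Iic hm, setIntegral_congr_fun measurableSet_Ioi hp,
      integral_exp_mul_complex_Ioi hr1, integral_exp_mul_complex_Iic hr2]
    have hden : κ ^ 2 + (N : ℂ) ^ 2 = -((-(N * Complex.I) - κ) * (-(N * Complex.I) + κ)) := by
      ring_nf; simp
    rw [hden]
    simp only [Complex.ofReal_zero, mul_zero, Complex.exp_zero]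
    field_simp
    ring

/-- Euclidean plane. -/
abbrev E2 := EuclideanSpace ℝ (Fin 2)

/-- Splitting off the first coordinate of Euclidean three-space. -/
def splitE : E3 ≃ᵐ ℝ × E2 :=
  ((MeasurableEquiv.toLp 2 (Fin 3 → ℝ)).symm.trans
    (MeasurableEquiv.piFinSuccAbove (fun _ => ℝ) 0)).trans
    ((MeasurableEquiv.refl ℝ).prodCongr (MeasurableEquiv.toLp 2 (Fin 2 → ℝ)))

theorem splitE_measurePreserving : MeasurePreserving splitE volume volume := by
  have m1 := PiLp.volume_preserving_ofLp (Fin 3)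
  have m2 := volume_preserving_piFinSuccAbove (fun _ : Fin 3 => ℝ) 0
  have m3 := (MeasurePreserving.id (volume : Measure ℝ)).prod
    (PiLp.volume_preserving_toLp (Fin 2))
  exact m3.comp (m2.comp m1)

theorem splitE_fst (x : E3) : (splitE x).1 = x 0 := rfl

theorem norm_eq_splitE (x : E3) : ‖x‖ = √((splitE x).1 ^ 2 + ‖(splitE x).2‖ ^ 2) := by
  have h : ‖(splitE x).2‖ ^ 2 = x 1 ^ 2 + x 2 ^ 2 := by
    rw [EuclideanSpace.norm_sq_eq, Fin.sum_univ_two]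
    simp only [Real.norm_eq_abs, sq_abs]
    rfl
  rw [h, splitE_fst, EuclideanSpace.norm_eq, Fin.sum_univ_three]
  simp only [Real.norm_eq_abs, sq_abs]
  congr 1; ring

/-- The primitive of `s ↦ s greenR k s` that vanishes at infinity. -/
def greenPrim (k : ℂ) (s : ℝ) : ℂ :=
  (Complex.exp (Complex.I * k * s) / (Complex.I * k) + Complex.exp (-(k * s)) / k) /
    (8 * Real.pi * k ^ 2)

theorem hasDerivAt_greenPrim {k : ℂ} (hk : k ≠ 0) (s : ℝ) :
    HasDerivAt (greenPrim k) (s * greenR k s) s := by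
  rw [mul_greenR hk]
  have e1 : HasDerivAt (fun s : ℝ => Complex.exp (Complex.I * k * s))
      (Complex.exp (Complex.I * k * s) * (Complex.I * k)) s := by
    have : HasDerivAt (fun s : ℝ => Complex.I * k * (s : ℂ)) (Complex.I * k) s := by
      simpa using (Complex.ofRealCLM.hasDerivAt (x := s)).const_mul (Complex.I * k)
    exact this.cexp
  have e2 : HasDerivAt (fun s : ℝ => Complex.exp (-(k * s)))
      (Complex.exp (-(k * s)) * (-k)) s := by
    have : HasDerivAt (fun s : ℝ => -(k * (s : ℂ))) (-k) s := by
      simpa using! ((Complex.ofRealCLM.hasDerivAt (x := s)).const_mul k).neg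
    exact this.cexp
  refine (((e1.div_const (Complex.I * k)).add (e2.div_const k)).div_const _).congr_deriv ?_
  have : Complex.I ≠ 0 := Complex.I_ne_zero
  field_simp
  ring

theorem tendsto_greenPrim {k : ℂ} (h1 : 0 < k.re) (h2 : 0 < k.im) :
    Tendsto (greenPrim k) atTop (𝓝 0) := by
  have e1 : Tendsto (fun s : ℝ => Complex.exp (Complex.I * k * s)) atTop (𝓝 0) := by
    rw [Complex.tendsto_exp_nhds_zero_iff]
    have : ∀ s : ℝ, (Complex.I * k * s).re = -(k.im * s) := by intro s; simp
    simp only [this]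
    exact tendsto_neg_atTop_atBot.comp (tendsto_id.const_mul_atTop h2)
  have e2 : Tendsto (fun s : ℝ => Complex.exp (-(k * s))) atTop (𝓝 0) := by
    rw [Complex.tendsto_exp_nhds_zero_iff]
    have : ∀ s : ℝ, (-(k * s)).re = -(k.re * s) := by intro s; simp
    simp only [this]
    exact tendsto_neg_atTop_atBot.comp (tendsto_id.const_mul_atTop h1)
  have := ((e1.div_const (Complex.I * k)).add (e2.div_const k)).div_const (8 * Real.pi * k ^ 2)
  simp only [zero_div, add_zero] at this
  exact this

/-- The integral of the free kernel over the planes orthogonal to an axis. -/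
theorem integral_plane_greenR {k : ℂ} (h1 : 0 < k.re) (h2 : 0 < k.im) (t : ℝ) (ht : t ≠ 0) :
    ∫ y : E2, greenR k √(t ^ 2 + ‖y‖ ^ 2) = -(2 * Real.pi * greenPrim k |t|) := by
  have hk : k ≠ 0 := by rintro rfl; simp at h1
  rw [integral_fun_norm_addHaar volume (fun ρ : ℝ => greenR k √(t ^ 2 + ρ ^ 2))]
  have hfr : Module.finrank ℝ E2 = 2 := by simp
  have hball : (volume : Measure E2).real (Metric.ball 0 1) = Real.pi := by
    rw [Measure.real, EuclideanSpace.volume_ball_fin_two]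
    simp [Real.pi_pos.le]
  have hpos : ∀ ρ : ℝ, 0 < t ^ 2 + ρ ^ 2 := fun ρ => by positivity
  have hd : ∀ ρ : ℝ, HasDerivAt (fun ρ : ℝ => greenPrim k √(t ^ 2 + ρ ^ 2))
      (ρ * greenR k √(t ^ 2 + ρ ^ 2)) ρ := by
    intro ρ
    have hs : HasDerivAt (fun ρ : ℝ => √(t ^ 2 + ρ ^ 2)) (2 * ρ / (2 * √(t ^ 2 + ρ ^ 2))) ρ := by
      have h0 : HasDerivAt (fun ρ : ℝ => t ^ 2 + ρ ^ 2) (2 * ρ) ρ := by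
        simpa using (hasDerivAt_pow 2 ρ).const_add (t ^ 2)
      exact h0.sqrt (hpos ρ).ne'
    have hne : (√(t ^ 2 + ρ ^ 2) : ℂ) ≠ 0 := by
      exact_mod_cast (Real.sqrt_pos.mpr (hpos ρ)).ne'
    refine ((hasDerivAt_greenPrim hk √(t ^ 2 + ρ ^ 2)).scomp ρ hs).congr_deriv ?_
    rw [Complex.real_smul]
    push_cast
    field_simp
  have hint : IntegrableOn (fun ρ : ℝ => (ρ : ℂ) * greenR k √(t ^ 2 + ρ ^ 2)) (Ioi 0) := by
    obtain ⟨D, hD⟩ := greenR_decay h1 h2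
    have hD0 : 0 ≤ D := by
      have := (norm_nonneg _).trans (hD 0 le_rfl)
      simpa using this
    have hi : IntegrableOn (fun ρ : ℝ => D * (1 + ‖ρ‖) ^ (-(3 : ℝ))) (Ioi 0) :=
      ((integrable_one_add_norm (by simp)).const_mul D).integrableOn
    refine hi.mono' ?_ ?_
    · apply Continuous.aestronglyMeasurable
      have := continuous_greenR k
      fun_prop
    · filter_upwards [ae_restrict_mem measurableSet_Ioi] with ρ hρ
      have hρ : (0 : ℝ) < ρ := hρ
      rw [norm_mul, Complex.norm_real, Real.norm_of_nonneg hρ.le]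
      have hle : ρ ≤ √(t ^ 2 + ρ ^ 2) := Real.le_sqrt_of_sq_le (by nlinarith [sq_nonneg t])
      have e1 : (1 + √(t ^ 2 + ρ ^ 2)) ^ (-(4 : ℝ)) ≤ (1 + ρ) ^ (-(4 : ℝ)) :=
        Real.rpow_le_rpow_of_nonpos (by linarith) (by linarith) (by norm_num)
      have e2 : (1 + ρ) ^ (-(3 : ℝ)) = (1 + ρ) * (1 + ρ) ^ (-(4 : ℝ)) := by
        rw [show (-(3 : ℝ)) = 1 + (-4) by norm_num, Real.rpow_add (by linarith), Real.rpow_one]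
      have e3 : 0 ≤ (1 + ρ) ^ (-(4 : ℝ)) := Real.rpow_nonneg (by linarith) _
      calc _ ≤ ρ * (D * (1 + √(t ^ 2 + ρ ^ 2)) ^ (-(4 : ℝ))) := by
            gcongr; exact hD _ (Real.sqrt_nonneg _)
        _ ≤ (1 + ρ) * (D * (1 + ρ) ^ (-(4 : ℝ))) := by gcongr; linarith
        _ = _ := by rw [e2]; ring
  have hlim : Tendsto (fun ρ : ℝ => greenPrim k √(t ^ 2 + ρ ^ 2)) atTop (𝓝 0) := by
    apply (tendsto_greenPrim h1 h2).comp
    apply tendsto_atTop_mono (fun ρ => ?_) tendsto_id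
    exact Real.le_sqrt_of_sq_le (by simp only [id]; nlinarith [sq_nonneg t])
  have hI := integral_Ioi_of_hasDerivAt_of_tendsto (a := 0) (hd 0).continuousAt.continuousWithinAt
    (fun ρ _ => hd ρ) hint hlim
  rw [hfr, hball]
  have e : ∫ ρ in Ioi (0 : ℝ), ρ ^ (2 - 1) • greenR k √(t ^ 2 + ρ ^ 2) =
      ∫ ρ in Ioi (0 : ℝ), (ρ : ℂ) * greenR k √(t ^ 2 + ρ ^ 2) := by
    congr 1; ext ρ; simp
  rw [e, hI]
  have e0 : √(t ^ 2 + 0 ^ 2) = |t| := by rw [zero_pow two_ne_zero, add_zero, Real.sqrt_sq_eq_abs]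
  rw [e0]
  simp only [zero_sub, nsmul_eq_mul, Complex.real_smul]
  push_cast
  ring

/-- The Fourier transform of the free kernel at a point of the first axis: integrating over the
planes orthogonal to the axis leaves a one-dimensional Fourier transform of a combination of
`e^{ik|t|}` and `e^{-k|t|}`. -/
theorem fourier_greenR_single {k : ℂ} (h1 : 0 < k.re) (h2 : 0 < k.im) (η : ℝ) :
    𝓕 (fun x : E3 => greenR k ‖x‖) (EuclideanSpace.single 0 η) =
      (((2 * Real.pi * η : ℝ) : ℂ) ^ 4 - k ^ 4)⁻¹ := by
  have hk : k ≠ 0 := by rintro rfl; simp at h1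
  set N : ℝ := 2 * Real.pi * η
  rw [Real.fourier_eq']
  set H : ℝ × E2 → ℂ := fun p =>
    Complex.exp (-(N * p.1 * Complex.I)) * greenR k √(p.1 ^ 2 + ‖p.2‖ ^ 2)
  have hH : ∀ x : E3, Complex.exp (((-2 * Real.pi * inner ℝ x (EuclideanSpace.single 0 η) : ℝ) : ℂ)
      * Complex.I) • greenR k ‖x‖ = H (splitE x) := by
    intro x
    simp only [H]
    rw [← norm_eq_splitE, splitE_fst, smul_eq_mul, EuclideanSpace.inner_single_right]
    congr 2
    simp [N]
    ring
  have hHi : Integrable H (volume.prod volume) := by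
    have : Integrable (H ∘ splitE) volume := by
      refine (integrable_greenR_norm h1 h2).mono ?_ ?_
      · apply Continuous.aestronglyMeasurable
        have : H ∘ splitE = fun x : E3 =>
          Complex.exp (-(N * (x 0 : ℝ) * Complex.I)) * greenR k ‖x‖ := by
          ext x; simp only [H, Function.comp]; rw [← norm_eq_splitE, splitE_fst]
        rw [this]
        have := continuous_greenR k
        fun_prop
      · filter_upwards with x
        simp only [H, Function.comp]
        rw [← norm_eq_splitE, norm_mul, Complex.norm_exp]
        simp
    exact (splitE_measurePreserving.integrable_comp_emb splitE.measurableEmbedding).mp this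
  calc _ = ∫ x : E3, H (splitE x) := by congr 1; ext x; exact hH x
    _ = ∫ p, H p := splitE_measurePreserving.integral_comp' H
    _ = ∫ t : ℝ, ∫ y : E2, H (t, y) := integral_prod H hHi
    _ = ∫ t : ℝ, (-(4 * k ^ 2))⁻¹ * ((Complex.I * k)⁻¹ *
          (Complex.exp (-(N * t * Complex.I)) * Complex.exp (-(-(Complex.I * k) * |t|))) +
          k⁻¹ * (Complex.exp (-(N * t * Complex.I)) * Complex.exp (-(k * |t|)))) := by
        apply integral_congr_ae
        filter_upwards [compl_mem_ae_iff.mpr (measure_singleton (0 : ℝ))] with t ht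
        simp only [H]
        rw [integral_const_mul, integral_plane_greenR h1 h2 t ht, greenPrim]
        have hpi : (Real.pi : ℂ) ≠ 0 := by simp [Real.pi_ne_zero]
        have := Complex.I_ne_zero
        rw [show -(-(Complex.I * k) * ((|t| : ℝ) : ℂ)) = Complex.I * k * ((|t| : ℝ) : ℂ) by ring]
        field_simp
        ring
    _ = _ := by
        have hr : 0 < (-(Complex.I * k)).re := by simpa using h2
        obtain ⟨i1, v1⟩ := integral_exp_neg_abs hr N
        obtain ⟨i2, v2⟩ := integral_exp_neg_abs h1 N
        rw [integral_const_mul, integral_add (i1.const_mul _) (i2.const_mul _),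
          integral_const_mul, integral_const_mul, v1, v2]
        have him : (k ^ 2).im ≠ 0 := by
          rw [pow_two, Complex.mul_im]
          positivity
        have n1 : (N : ℂ) ^ 2 - k ^ 2 ≠ 0 := by
          intro h
          apply him
          rw [← sub_eq_zero.mp h, ← Complex.ofReal_pow, Complex.ofReal_im]
        have n2 : k ^ 2 + (N : ℂ) ^ 2 ≠ 0 := by
          intro h
          apply him
          rw [eq_neg_of_add_eq_zero_left h, ← Complex.ofReal_pow, ← Complex.ofReal_neg,
            Complex.ofReal_im]
        have e1 : (-(Complex.I * k)) ^ 2 + (N : ℂ) ^ 2 = (N : ℂ) ^ 2 - k ^ 2 := by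
          ring_nf; simp
        have e2 : (N : ℂ) ^ 4 - k ^ 4 = ((N : ℂ) ^ 2 - k ^ 2) * (k ^ 2 + (N : ℂ) ^ 2) := by ring
        rw [e1, e2]
        have := Complex.I_ne_zero
        field_simp
        ring

/-- The Fourier transform of the free resolvent kernel. -/
theorem fourier_greenR {k : ℂ} (h1 : 0 < k.re) (h2 : 0 < k.im) (ξ : E3) :
    𝓕 (fun x : E3 => greenR k ‖x‖) ξ = ((symb ξ : ℂ) - k ^ 4)⁻¹ := by
  have hn : ‖ξ‖ = ‖(EuclideanSpace.single 0 ‖ξ‖ : E3)‖ := by simp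
  -- the reflection that takes `ξ` to the first axis; the kernel is radial
  set A := (ℝ ∙ (ξ - EuclideanSpace.single 0 ‖ξ‖))ᗮ.reflection
  have hA : A ξ = EuclideanSpace.single 0 ‖ξ‖ := Submodule.reflection_sub hn
  have h3 := Real.fourier_comp_linearIsometry A (fun x : E3 => greenR k ‖x‖) ξ
  have h4 : (fun x : E3 => greenR k ‖x‖) ∘ A = fun x : E3 => greenR k ‖x‖ := by
    ext x; simp
  rw [h4, hA, fourier_greenR_single h1 h2] at h3
  rw [h3]
  simp [symb]

/-! ### The free resolvent as an integral operator -/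

/-- `g` is the convolution kernel of `(Δ² - z)⁻¹`, as expressed by its Fourier transform. -/
structure IsFreeKernel (z : ℂ) (g : E3 → ℂ) : Prop where
  continuous : Continuous g
  integrable : Integrable g volume
  even : ∀ x, g (-x) = g x
  bounded : ∃ C, ∀ x, ‖g x‖ ≤ C
  fourier : ∀ ξ, 𝓕 g ξ = ((symb ξ : ℂ) - z)⁻¹

theorem isFreeKernel_greenR {k : ℂ} (h1 : 0 < k.re) (h2 : 0 < k.im) :
    IsFreeKernel (k ^ 4) (fun x : E3 => greenR k ‖x‖) where
  continuous := (continuous_greenR k).comp continuous_norm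
  integrable := integrable_greenR_norm h1 h2
  even := fun x => by rw [norm_neg]
  bounded := by
    refine ⟨‖k‖⁻¹ * ‖aCoef‖, fun x => ?_⟩
    rw [greenR, norm_mul, norm_inv]
    gcongr
    apply norm_prof_le
    · simp; positivity
    · simp; positivity
  fourier := fourier_greenR h1 h2

/-- Complex conjugation of the kernel conjugates the spectral parameter. -/
theorem IsFreeKernel.conj {z : ℂ} {g : E3 → ℂ} (h : IsFreeKernel z g) :
    IsFreeKernel (starRingEnd ℂ z) (fun x => starRingEnd ℂ (g x)) where
  continuous := Complex.continuous_conj.comp h.continuous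
  integrable := by
    refine h.integrable.mono
      (Complex.continuous_conj.comp h.continuous).aestronglyMeasurable ?_
    filter_upwards with x
    simp
  even := fun x => by rw [h.even]
  bounded := by simpa using h.bounded
  fourier := by
    intro ξ
    have h1 := h.fourier (-ξ)
    rw [Real.fourier_eq'] at h1 ⊢
    have h2 := congrArg (starRingEnd ℂ) h1
    rw [← integral_conj] at h2
    rw [show starRingEnd ℂ (((symb (-ξ) : ℂ) - z)⁻¹) = ((symb ξ : ℂ) - starRingEnd ℂ z)⁻¹ by
      simp [symb, Complex.conj_ofNat]] at h2
    rw [← h2]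
    congr 1
    ext x
    simp only [smul_eq_mul, map_mul, ← Complex.exp_conj, Complex.conj_I, Complex.conj_ofReal,
      inner_neg_right]
    congr 2
    push_cast
    ring

theorem fourier_laplacian_schwartz (χ : SchwartzMap E3 ℂ) (ξ : E3) :
    𝓕 (Δ χ) ξ = -(2 * Real.pi) ^ 2 * ‖ξ‖ ^ 2 * 𝓕 χ ξ := by
  have ht : (fun x : E3 => ‖x‖ ^ 2).HasTemperateGrowth := by fun_prop
  rw [SchwartzMap.laplacian_eq_fourierMultiplierCLM, SchwartzMap.fourierMultiplierCLM_apply,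
    ← Complex.coe_smul, FourierTransform.fourier_smul, fourier_fourierInv_eq,
    smul_apply]
  have := SchwartzMap.smulLeftCLM_apply_apply (F := ℂ) ht (𝓕 χ) ξ
  change _ • (SchwartzMap.smulLeftCLM ℂ (fun x : E3 => ‖x‖ ^ 2) (𝓕 χ)) ξ = _
  rw [this]
  simp only [smul_eq_mul, Complex.real_smul]
  push_cast
  ring

theorem fourier_bilaplacian_schwartz (χ : SchwartzMap E3 ℂ) (ξ : E3) :
    𝓕 (Δ (Δ χ)) ξ = symb ξ * 𝓕 χ ξ := by
  rw [fourier_laplacian_schwartz, fourier_laplacian_schwartz, symb]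
  push_cast
  ring

open scoped Convolution

/-- Convolution with the kernel inverts `Δ² - z` on Schwartz functions. -/
theorem IsFreeKernel.convolution_schwartz {z : ℂ} (hz : z.im ≠ 0) {g : E3 → ℂ}
    (h : IsFreeKernel z g) (χ : SchwartzMap E3 ℂ) (x : E3) :
    ∫ t, (Δ (Δ χ) - z • χ) t * g (x - t) = χ x := by
  set ψ : SchwartzMap E3 ℂ := Δ (Δ χ) - z • χ
  set G : E3 → ℂ := (⇑ψ) ⋆[ContinuousLinearMap.mul ℂ ℂ, volume] g
  obtain ⟨C, hC⟩ := h.bounded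
  have hcont : Continuous G := by
    apply BddAbove.continuous_convolution_right_of_integrable _ _ ψ.integrable h.continuous
    exact ⟨C, by rintro _ ⟨y, rfl⟩; exact hC y⟩
  have hint : Integrable G volume := ψ.integrable.integrable_convolution _ h.integrable
  have hF : 𝓕 G = ⇑(𝓕 χ : SchwartzMap E3 ℂ) := by
    ext ξ
    rw [Real.fourier_mul_convolution_eq ψ.integrable h.integrable, h.fourier,
      ← SchwartzMap.fourier_coe]
    have hψ : (𝓕 ψ) ξ = ((symb ξ : ℂ) - z) * (𝓕 χ) ξ := by
      have hs : 𝓕 ψ = 𝓕 (Δ (Δ χ)) - z • 𝓕 χ := by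
        rw [← FourierTransform.fourier_smul]
        exact map_sub (FourierTransform.fourierCLM ℂ (SchwartzMap E3 ℂ)) (Δ (Δ χ)) (z • χ)
      rw [hs, sub_apply, smul_apply, fourier_bilaplacian_schwartz,
        smul_eq_mul]
      ring
    have hne : (symb ξ : ℂ) - z ≠ 0 := by
      intro h0
      apply hz
      have := congrArg Complex.im h0
      simpa using this
    rw [hψ]
    field_simp
  have h1 : 𝓕⁻ (𝓕 G) = G := hcont.fourierInv_fourier_eq hint
    (by rw [hF]; exact (𝓕 χ : SchwartzMap E3 ℂ).integrable)
  have h2 : G = χ := by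
    rw [← h1, hF, ← SchwartzMap.fourierInv_coe, fourierInv_fourier_eq]
  exact congrFun h2 x

/-- For integrable `h ∈ L²`, convolution with the kernel solves `(Δ² - z) u = h`. -/
theorem IsFreeKernel.solve {z : ℂ} (hz : z.im ≠ 0) {g : E3 → ℂ} (hg : IsFreeKernel z g) (h : L2)
    (hh : Integrable h volume) {u : L2} (hu : (u, h + z • u) ∈ freeRel) :
    u =ᵐ[volume] fun x => ∫ y, g (x - y) * h y := by
  obtain ⟨C, hC⟩ := hg.bounded
  set U : E3 → ℂ := fun x => ∫ y, h y * g (x - y)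
  have hUi : Integrable U volume :=
    hh.integrable_convolution (ContinuousLinearMap.mul ℂ ℂ) hg.integrable
  have hUb : ∀ x, ‖U x‖ ≤ (∫ y, ‖h y‖) * C := by
    intro x
    rw [← integral_mul_const]
    apply norm_integral_le_of_norm_le (hh.norm.mul_const C)
    filter_upwards with y
    rw [norm_mul]
    gcongr
    exact hC _
  have hUm : MemLp U 2 volume := by
    rw [memLp_two_iff_integrable_sq_norm hUi.1]
    refine (hUi.norm.mul_const ((∫ y, ‖h y‖) * C)).mono' (hUi.1.norm.pow 2) ?_
    filter_upwards with x
    rw [Real.norm_of_nonneg (by positivity), pow_two]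
    gcongr
    exact hUb x
  have hrel : (hUm.toLp U, h + z • hUm.toLp U) ∈ freeRel := by
    rw [mem_freeRel, ← bilaplacian_eq_iff]
    ext χ
    rw [TemperedDistribution.laplacian_apply_apply, TemperedDistribution.laplacian_apply_apply,
      Lp.toTemperedDistribution_apply, Lp.toTemperedDistribution_apply]
    set ψ : SchwartzMap E3 ℂ := Δ (Δ χ) - z • χ with hψ
    have hψb : ∃ B, ∀ x, ‖ψ x‖ ≤ B := by
      refine ⟨‖ψ.toBoundedContinuousFunction‖, fun x => ?_⟩
      exact ψ.toBoundedContinuousFunction.norm_coe_le_norm x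
    obtain ⟨B, hB⟩ := hψb
    have hprod : Integrable (fun p : E3 × E3 => ψ p.1 * (h p.2 * g (p.1 - p.2)))
        (volume.prod volume) := by
      apply (hh.convolution_integrand (ContinuousLinearMap.mul ℂ ℂ) hg.integrable).bdd_mul (c := B)
      · exact (ψ.continuous.comp continuous_fst).aestronglyMeasurable
      · filter_upwards with p using hB _
    have hswap : ∫ x, ψ x * U x = ∫ y, χ y * h y := by
      calc ∫ x, ψ x * U x = ∫ x, ∫ y, ψ x * (h y * g (x - y)) := by
            congr 1; ext x; rw [integral_const_mul]
        _ = ∫ y, ∫ x, ψ x * (h y * g (x - y)) := integral_integral_swap hprod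
        _ = _ := by
            congr 1; ext y
            rw [← hg.convolution_schwartz hz χ y, ← integral_mul_const]
            congr 1; ext x
            rw [← hg.even (x - y), neg_sub]
            ring
    have i1 : Integrable (fun x => ψ x * U x) volume :=
      hUi.bdd_mul ψ.continuous.aestronglyMeasurable (Eventually.of_forall hB)
    have hχb : ∀ x, ‖χ x‖ ≤ ‖χ.toBoundedContinuousFunction‖ :=
      fun x => χ.toBoundedContinuousFunction.norm_coe_le_norm x
    have i2 : Integrable (fun x => χ x * U x) volume :=
      hUi.bdd_mul χ.continuous.aestronglyMeasurable (Eventually.of_forall hχb)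
    have i3 : Integrable (fun x => χ x * h x) volume :=
      hh.bdd_mul χ.continuous.aestronglyMeasurable (Eventually.of_forall hχb)
    calc ∫ x, (Δ (Δ χ)) x • (hUm.toLp U) x = ∫ x, (ψ x * U x + z * (χ x * U x)) := by
          apply integral_congr_ae
          filter_upwards [hUm.coeFn_toLp] with x hx
          rw [hx, smul_eq_mul, hψ, sub_apply, smul_apply, smul_eq_mul]
          ring
      _ = ∫ x, (χ x * h x + z * (χ x * U x)) := by
          rw [integral_add i1 (i2.const_mul z), integral_add i3 (i2.const_mul z), hswap]
      _ = _ := by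
          apply integral_congr_ae
          filter_upwards [hUm.coeFn_toLp, Lp.coeFn_add h (z • hUm.toLp U),
            Lp.coeFn_smul z (hUm.toLp U)] with x h1 h2 h3
          rw [h2, Pi.add_apply, h3, Pi.smul_apply, h1, smul_eq_mul, smul_eq_mul]
          ring
  rw [freeRel_unique hz hu hrel]
  filter_upwards [hUm.coeFn_toLp] with x hx
  rw [hx]
  simp only [U, mul_comm]

end FreeKernel

/-! ### Resolvent kernels by the symmetric resolvent identity -/

/-- Integration of an integrable function against a bounded continuous kernel, as a Bochner
integral of slices. -/
def sliceInt (κ : B2) (f : E3 → ℂ) : B1 := ∫ y, f y • sliceL y κ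

theorem integrable_slice {κ : B2} (hκ : Continuous fun y => sliceL y κ) {f : E3 → ℂ}
    (hf : Integrable f volume) : Integrable (fun y => f y • sliceL y κ) volume := by
  refine (hf.norm.mul_const ‖κ‖).mono' (hf.1.smul hκ.aestronglyMeasurable) ?_
  filter_upwards with y
  rw [norm_smul]
  gcongr
  exact norm_sliceL_le y κ

/-- A continuous functional commutes with `sliceInt`. -/
theorem map_sliceInt {κ : B2} (hκ : Continuous fun y => sliceL y κ) {f : E3 → ℂ}
    (hf : Integrable f volume) (Λ : B1 →L[ℂ] ℂ) :
    Integrable (fun y => Λ (sliceL y κ) * f y) volume ∧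
      ∫ y, Λ (sliceL y κ) * f y = Λ (sliceInt κ f) := by
  have h1 := integrable_slice hκ hf
  have h2 : ∀ y, Λ (f y • sliceL y κ) = Λ (sliceL y κ) * f y := by
    intro y; rw [map_smul, smul_eq_mul, mul_comm]
  refine ⟨?_, ?_⟩
  · simpa only [h2] using Λ.integrable_comp h1
  · rw [sliceInt, ← Λ.integral_comp_comm h1]
    simp only [h2]

theorem sliceInt_apply {κ : B2} (hκ : Continuous fun y => sliceL y κ)
    (hsymm : ∀ x y, κ (x, y) = κ (y, x)) {f : E3 → ℂ} (hf : Integrable f volume) (x : E3) :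
    sliceInt κ f x = ∫ y, κ (x, y) * f y := by
  have := (map_sliceInt hκ hf (BoundedContinuousFunction.evalCLM ℂ x)).2
  simp only [BoundedContinuousFunction.evalCLM_apply, sliceL_apply] at this
  rw [← this]
  simp only [hsymm x]

section

variable {V : E3 → ℝ}

/-- The weight `v = |V|^{1/2}`, as a complex-valued function. -/
def vC (V : E3 → ℝ) (x : E3) : ℂ := (sqrtAbs V x : ℂ)

theorem measurable_sqrtAbs (hV : Measurable V) : Measurable (sqrtAbs V) := by
  unfold sqrtAbs
  exact (hV.abs).sqrt

theorem measurable_signV (hV : Measurable V) : Measurable (signV V) := by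
  unfold signV
  exact Measurable.ite (measurableSet_le measurable_const hV) measurable_const measurable_const

theorem abs_signV (x : E3) : |signV V x| = 1 := by unfold signV; split_ifs <;> simp

theorem signV_mul_self (x : E3) : signV V x * signV V x = 1 := by
  unfold signV; split_ifs <;> simp

theorem sqrtAbs_sign_sqrtAbs (x : E3) : sqrtAbs V x * (signV V x * sqrtAbs V x) = V x := by
  have h : sqrtAbs V x * sqrtAbs V x = |V x| := Real.mul_self_sqrt (abs_nonneg _)
  rw [mul_left_comm, h]
  unfold signV
  split_ifs with h0
  · rw [abs_of_nonneg h0, one_mul]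
  · rw [abs_of_neg (not_le.mp h0)]; ring

/-- Multiplication by `U = sign V`. -/
def sgnL (hV : Measurable V) : L2 →L[ℂ] L2 :=
  mulL (fun x => (signV V x : ℂ))
    (Complex.measurable_ofReal.comp (measurable_signV hV)).aestronglyMeasurable 1
    (fun x => by rw [Complex.norm_real, Real.norm_eq_abs, abs_signV])

theorem sgnL_ae (hV : Measurable V) (f : L2) :
    sgnL hV f =ᵐ[volume] fun x => (signV V x : ℂ) * f x := mulL_ae _ _ _ _ f

variable (hV : Measurable V) (hv : MemLp (vC V) 2 (volume : Measure E3))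

/-- `M = U + v R₀ v`, for the free resolvent kernel `κ`. -/
def birman (κ : B2) : L2 →L[ℂ] L2 := sgnL hV + opL (vC V) hv κ

/-- The kernel of `R₀ - R₀ v M⁻¹ v R₀`, for the (symmetric) kernel `κ` of `R₀`. -/
def resKer (κ : B2) (x y : E3) : ℂ :=
  κ (x, y) - pairL (vC V) hv (sliceL x κ)
    (Ring.inverse (birman hV hv κ) (vecL (vC V) hv (sliceL y κ)))

/-- Integration of `f` against the kernel `resKer` applies `R₀ - R₀ v M⁻¹ v R₀` to `f`: bounded
operators commute with the Bochner integral of slices that defines `R₀ f`. -/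
theorem integrable_resKer_mul {κ : B2} (hκ : Continuous fun y => sliceL y κ)
    (hsymm : ∀ x y, κ (x, y) = κ (y, x)) {f : E3 → ℂ} (hf : Integrable f volume) (x : E3) :
    Integrable (fun y => resKer hV hv κ x y * f y) volume ∧
      ∫ y, resKer hV hv κ x y * f y = sliceInt κ f x - pairL (vC V) hv (sliceL x κ)
        (Ring.inverse (birman hV hv κ) (vecL (vC V) hv (sliceInt κ f))) := by
  set Λ : B1 →L[ℂ] ℂ := BoundedContinuousFunction.evalCLM ℂ x -
    (pairL (vC V) hv (sliceL x κ)).comp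
      ((Ring.inverse (birman hV hv κ)).comp (vecL (vC V) hv)) with hΛ
  have h1 := map_sliceInt hκ hf Λ
  have h2 : ∀ y, Λ (sliceL y κ) = resKer hV hv κ x y := by
    intro y
    rw [hΛ, sub_apply, BoundedContinuousFunction.evalCLM_apply, sliceL_apply, hsymm y x]
    rfl
  simp only [h2] at h1
  exact h1

theorem continuous_resKer {κ : B2} (hκ : Continuous fun y => sliceL y κ) :
    Continuous (Function.uncurry (resKer hV hv κ)) := by
  refine Continuous.sub (f := fun p : E3 × E3 => κ p) κ.continuous ?_
  have h1 : Continuous fun p : E3 × E3 => pairL (vC V) hv (sliceL p.1 κ) :=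
    (pairL (vC V) hv).continuous.comp (hκ.comp continuous_fst)
  have h2 : Continuous fun p : E3 × E3 =>
      Ring.inverse (birman hV hv κ) (vecL (vC V) hv (sliceL p.2 κ)) :=
    (Ring.inverse (birman hV hv κ)).continuous.comp
      ((vecL (vC V) hv).continuous.comp (hκ.comp continuous_snd))
  exact h1.clm_apply h2

/-- The symmetric resolvent identity: `(H - z)⁻¹ = R₀ - R₀ v M⁻¹ v R₀`. -/
theorem resolvent_ae_eq {C : ℝ} (hC : ∀ x, |V x| ≤ C) {z : ℂ} (hz : z.im ≠ 0) {g : E3 → ℂ}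
    (hg : IsFreeKernel z g) {κ : B2} (hκg : ∀ x y, κ (x, y) = g (x - y))
    (hκ : Continuous fun y => sliceL y κ) (hM : IsUnit (birman hV hv κ)) {R : L2 →L[ℂ] L2}
    (hR : IsResolventAt V z R) (f : L2) (hf : Integrable f volume) :
    R f =ᵐ[volume] fun x => ∫ y, resKer hV hv κ x y * f y := by
  have hsymm : ∀ x y, κ (x, y) = κ (y, x) := by
    intro x y; rw [hκg, hκg, ← hg.even, neg_sub]
  set u := R f
  -- `W = U v R f`
  have hvb : ∀ x, ‖(signV V x * sqrtAbs V x : ℂ)‖ ≤ √C := by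
    intro x
    rw [norm_mul, Complex.norm_real, Complex.norm_real, Real.norm_eq_abs, abs_signV, one_mul,
      sqrtAbs, Real.norm_of_nonneg (Real.sqrt_nonneg _)]
    exact Real.sqrt_le_sqrt (hC x)
  have hvm : AEStronglyMeasurable (fun x => (signV V x * sqrtAbs V x : ℂ)) volume :=
    ((Complex.measurable_ofReal.comp (measurable_signV hV)).mul
      (Complex.measurable_ofReal.comp (measurable_sqrtAbs hV))).aestronglyMeasurable
  set W : L2 := mulL _ hvm _ hvb u with hW
  have hWae := mulL_ae _ hvm _ hvb u
  rw [← hW] at hWae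
  have hVW : potL hV hC u =ᵐ[volume] fun x => vC V x * W x := by
    filter_upwards [hWae, potL_ae hV hC u] with x h1 h2
    rw [h1, h2, vC, ← sqrtAbs_sign_sqrtAbs (V := V) x]
    push_cast
    ring
  have hVi : Integrable (potL hV hC u) volume :=
    (integrable_congr hVW).mpr (integrable_weight_mul _ hv W)
  have h1 := (hgraph_iff hV hC _ _).mp (hR.1 f)
  rw [mem_addRel] at h1
  have h2 : (u, (f - potL hV hC u) + z • u) ∈ freeRel := by
    convert h1 using 2
    abel
  have hhi : Integrable (f - potL hV hC u : L2) volume :=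
    (integrable_congr (Lp.coeFn_sub f (potL hV hC u))).mpr (hf.sub hVi)
  have h3 := hg.solve hz _ hhi h2
  have h4 : u =ᵐ[volume] fun x => sliceInt κ f x - intL (vC V) hv κ W x := by
    filter_upwards [h3] with x hx
    rw [hx, sliceInt_apply hκ hsymm hf, intL_apply, pairL_apply, ← integral_sub]
    · apply integral_congr_ae
      filter_upwards [Lp.coeFn_sub f (potL hV hC u), hVW] with y h5 h6
      rw [h5, Pi.sub_apply, h6, sliceL_apply, ← hκg]
      ring
    · exact hf.bdd_mul (c := ‖κ‖) (by fun_prop)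
        (Eventually.of_forall fun y => κ.norm_coe_le_norm _)
    · exact integrable_bcf_mul _ hv _ W
  have h5 : birman hV hv κ W = vecL (vC V) hv (sliceInt κ f) := by
    apply Lp.ext
    rw [birman, add_apply, opL_apply]
    filter_upwards [Lp.coeFn_add (sgnL hV W) (vecL (vC V) hv (intL (vC V) hv κ W)), sgnL_ae hV W,
      vecL_ae _ hv (intL (vC V) hv κ W), vecL_ae _ hv (sliceInt κ f), hWae, h4]
      with x e1 e2 e3 e4 e5 e6
    rw [e1, Pi.add_apply, e2, e3, e4, e5, e6]
    have : (signV V x : ℂ) * signV V x = 1 := by exact_mod_cast signV_mul_self x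
    rw [← mul_assoc, ← mul_assoc, this, vC]
    ring
  have h6 : W = Ring.inverse (birman hV hv κ) (vecL (vC V) hv (sliceInt κ f)) := by
    rw [← h5]
    change W = (Ring.inverse (birman hV hv κ) * birman hV hv κ) W
    rw [Ring.inverse_mul_cancel _ hM]
    rfl
  filter_upwards [h4] with x hx
  rw [hx, (integrable_resKer_mul hV hv hκ hsymm hf x).2, ← h6, intL_apply]

/-- The bound for `A N B - A₀ N₀ B₀` obtained by changing one factor at a time tends to zero: here
`d` bounds the change of the free kernel, `m` that of the inverse, and `n`, `q` bound the factors
kept. -/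
theorem tendsto_telescope {ι : Type*} {l : Filter ι} {d n m q : ι → ℝ} {n₀ q₀ : ℝ} (c r t : ℝ)
    (hd : Tendsto d l (𝓝 0)) (hn : Tendsto n l (𝓝 n₀)) (hm : Tendsto m l (𝓝 0))
    (hq : Tendsto q l (𝓝 q₀)) :
    Tendsto (fun i => d i + (c * d i * (n i * q i) + r * (m i * q i) + r * (t * (c * d i)))) l
      (𝓝 0) := by
  have := hd.add ((((hd.const_mul c).mul (hn.mul hq)).add ((hm.mul hq).const_mul r)).add
    (((hd.const_mul c).const_mul t).const_mul r))
  simpa only [mul_zero, zero_mul, add_zero] using this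

/-- The resolvent kernel depends continuously, in the uniform norm, on the free kernel. -/
theorem tendsto_resKer {κ₀ : B2} (hM : IsUnit (birman hV hv κ₀)) {δ : ℝ} (hδ : 0 < δ) :
    ∀ᶠ κ in 𝓝 κ₀, IsUnit (birman hV hv κ) ∧
      ∀ x y, ‖resKer hV hv κ x y - resKer hV hv κ₀ x y‖ ≤ δ := by
  have hcb : Continuous (birman hV hv) := continuous_const.add (opL (vC V) hv).continuous
  have hci : ContinuousAt (fun κ => Ring.inverse (birman hV hv κ)) κ₀ := by
    obtain ⟨x, hx⟩ := hM
    have h := NormedRing.inverse_continuousAt x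
    rw [hx] at h
    exact ContinuousAt.comp (f := birman hV hv) h hcb.continuousAt
  obtain ⟨N, hN⟩ : ∃ N : B2 → (L2 →L[ℂ] L2), N = fun κ => Ring.inverse (birman hV hv κ) :=
    ⟨_, rfl⟩
  rw [← hN] at hci
  set c := wt (vC V)
  have t1 : Tendsto (fun κ : B2 => ‖κ - κ₀‖) (𝓝 κ₀) (𝓝 0) := by
    have := (continuous_id (X := B2)).tendsto κ₀
    exact tendsto_iff_norm_sub_tendsto_zero.mp this
  have t2 : Tendsto (fun κ : B2 => ‖N κ - N κ₀‖) (𝓝 κ₀) (𝓝 0) :=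
    tendsto_iff_norm_sub_tendsto_zero.mp hci
  have t3 : Tendsto (fun κ : B2 => c * ‖κ‖) (𝓝 κ₀) (𝓝 (c * ‖κ₀‖)) :=
    (continuous_norm.tendsto κ₀).const_mul c
  have t4 : Tendsto (fun κ : B2 => ‖N κ‖) (𝓝 κ₀) (𝓝 ‖N κ₀‖) := Tendsto.norm hci
  have hE := tendsto_telescope c (c * ‖κ₀‖) ‖N κ₀‖ t1 t4 t2 t3
  have hunit : ∀ᶠ κ in 𝓝 κ₀, IsUnit (birman hV hv κ) :=
    hcb.continuousAt.eventually (Units.isOpen.mem_nhds hM)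
  filter_upwards [hunit, hE.eventually (ge_mem_nhds hδ)] with κ h1 h2
  refine ⟨h1, fun x y => le_trans ?_ h2⟩
  have hc : 0 ≤ c := wt_nonneg _
  have hp : ∀ κ : B2, ‖pairL (vC V) hv (sliceL x κ)‖ ≤ c * ‖κ‖ := fun κ =>
    (norm_pairL_le _ hv _).trans (by gcongr; exact norm_sliceL_le _ _)
  have hb : ∀ κ : B2, ‖vecL (vC V) hv (sliceL y κ)‖ ≤ c * ‖κ‖ := fun κ =>
    (norm_vecL_le _ hv _).trans (by gcongr; exact norm_sliceL_le _ _)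
  have hid : resKer hV hv κ x y - resKer hV hv κ₀ x y = (κ - κ₀) (x, y) -
      (pairL (vC V) hv (sliceL x (κ - κ₀)) (N κ (vecL (vC V) hv (sliceL y κ))) +
      pairL (vC V) hv (sliceL x κ₀) ((N κ - N κ₀) (vecL (vC V) hv (sliceL y κ))) +
      pairL (vC V) hv (sliceL x κ₀) (N κ₀ (vecL (vC V) hv (sliceL y (κ - κ₀))))) := by
    simp only [resKer, map_sub, sub_apply, BoundedContinuousFunction.coe_sub, Pi.sub_apply, hN]
    ring
  rw [hid]
  refine (norm_sub_le _ _).trans (add_le_add ((κ - κ₀).norm_coe_le_norm _) ?_)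
  refine (norm_add_le _ _).trans (add_le_add ((norm_add_le _ _).trans (add_le_add ?_ ?_)) ?_)
  all_goals
    refine (ContinuousLinearMap.le_opNorm _ _).trans ?_
    gcongr
    · exact hp _
    · refine (ContinuousLinearMap.le_opNorm _ _).trans ?_
      gcongr
      exact hb _

end

/-! ### Weighted spaces and the limiting absorption principle -/

theorem jb_pos (x : E3) : 0 < jb x := Real.sqrt_pos.mpr (by positivity)

theorem one_le_jb (x : E3) : 1 ≤ jb x := Real.one_le_sqrt.mpr (by nlinarith [sq_nonneg ‖x‖])

theorem norm_le_jb (x : E3) : ‖x‖ ≤ jb x := Real.le_sqrt_of_sq_le (by linarith)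

theorem continuous_jb : Continuous jb := by unfold jb; fun_prop

theorem integrable_jb_rpow {r : ℝ} (hr : r < -3) :
    Integrable (fun x : E3 => jb x ^ r) volume := by
  have h := integrable_rpow_neg_one_add_norm_sq (E := E3) (μ := volume) (r := -r)
    (by simp; linarith)
  refine h.congr (Eventually.of_forall fun x => ?_)
  simp only [jb, Real.sqrt_eq_rpow]
  rw [← Real.rpow_mul (by positivity)]
  congr 1; ring

theorem continuous_jb_rpow (σ : ℝ) : Continuous fun x : E3 => jb x ^ σ :=
  continuous_jb.rpow_const fun x => Or.inl (jb_pos x).ne'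

theorem memLp_jb_rpow {σ : ℝ} (hσ : 3 / 2 < σ) :
    MemLp (fun x : E3 => ((jb x ^ (-σ) : ℝ) : ℂ)) 2 volume := by
  have hm : AEStronglyMeasurable (fun x : E3 => ((jb x ^ (-σ) : ℝ) : ℂ)) volume :=
    (Complex.continuous_ofReal.comp (continuous_jb_rpow _)).aestronglyMeasurable
  rw [memLp_two_iff_integrable_sq_norm hm]
  refine (integrable_jb_rpow (r := -σ * 2) (by linarith)).congr (Eventually.of_forall fun x => ?_)
  simp only
  rw [Complex.norm_real, Real.norm_of_nonneg (Real.rpow_nonneg (jb_pos x).le _),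
    ← Real.rpow_natCast, ← Real.rpow_mul (jb_pos x).le]
  norm_num

/-- By Cauchy–Schwarz, `‖f‖₁ ≤ ‖⟨·⟩^{-σ}‖₂ ‖⟨·⟩^σ f‖₂`; the first factor is finite for
`σ > 3/2`. -/
theorem eLpNorm_one_le_wNorm {σ : ℝ} {f : E3 → ℂ} (hf : AEStronglyMeasurable f volume) :
    eLpNorm f 1 volume ≤
      eLpNorm (fun x : E3 => ((jb x ^ (-σ) : ℝ) : ℂ)) 2 volume * wNorm σ f := by
  have h1 : f = (fun x : E3 => ((jb x ^ (-σ) : ℝ) : ℂ)) •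
      (fun x : E3 => ((jb x ^ σ : ℝ) : ℂ) * f x) := by
    ext x
    simp only [Pi.smul_apply', smul_eq_mul]
    rw [← mul_assoc, ← Complex.ofReal_mul, ← Real.rpow_add (jb_pos x)]
    simp
  conv_lhs => rw [h1]
  apply eLpNorm_smul_le_mul_eLpNorm (p := 2) (q := 2) (r := 1)
  · exact (Complex.continuous_ofReal.comp (continuous_jb_rpow _)).aestronglyMeasurable.mul hf
  · exact (Complex.continuous_ofReal.comp (continuous_jb_rpow _)).aestronglyMeasurable

/-- Limiting absorption: if the free kernels at `λ⁴ ± iε` converge uniformly to `κ₀` and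
`M = U + v κ₀ v` is invertible, the limiting resolvent exists with kernel `resKer κ₀`. -/
theorem isLimitingKernel_resKer {V : E3 → ℝ} (hV : Measurable V)
    (hv : MemLp (vC V) 2 (volume : Measure E3)) {C : ℝ} (hC : ∀ x, |V x| ≤ C) {s lam : ℝ}
    (hs : s ≠ 0) {κ₀ : B2} (hM : IsUnit (birman hV hv κ₀))
    (hκ₀ : Continuous fun y => sliceL y κ₀) (hsymm : ∀ x y, κ₀ (x, y) = κ₀ (y, x))
    (g : ℝ → E3 → ℂ) (κ : ℝ → B2)
    (hg : ∀ ε : ℝ, 0 < ε → IsFreeKernel ((lam : ℂ) ^ 4 + (s : ℂ) * (ε : ℂ) * Complex.I) (g ε))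
    (hκg : ∀ ε : ℝ, 0 < ε → ∀ x y, κ ε (x, y) = g ε (x - y))
    (hκ : ∀ ε : ℝ, 0 < ε → Continuous fun y => sliceL y (κ ε))
    (hlim : Tendsto κ (𝓝[>] 0) (𝓝 κ₀)) :
    IsLimitingKernel V s lam (resKer hV hv κ₀) := by
  have him : ∀ ε : ℝ, 0 < ε → ((lam : ℂ) ^ 4 + (s : ℂ) * (ε : ℂ) * Complex.I).im ≠ 0 := by
    intro ε hε
    have : ((lam : ℂ) ^ 4 + (s : ℂ) * (ε : ℂ) * Complex.I).im = s * ε := by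
      simp [← Complex.ofReal_pow]
    rw [this]
    exact mul_ne_zero hs hε.ne'
  refine ⟨(continuous_resKer hV hv hκ₀).aestronglyMeasurable,
    fun ε hε => exists_isResolventAt hV hC (him ε hε), fun σ hσ => ⟨?_, ?_⟩⟩
  · intro f hf
    have hf1 : Integrable f volume := by
      rw [← memLp_one_iff_integrable]
      exact ⟨Lp.aestronglyMeasurable f, (eLpNorm_one_le_wNorm (Lp.aestronglyMeasurable f)).trans_lt
        (ENNReal.mul_lt_top (memLp_jb_rpow hσ).2 hf)⟩
    filter_upwards with x
    exact (integrable_resKer_mul hV hv hκ₀ hsymm hf1 x).1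
  · intro η hη
    set A := eLpNorm (fun x : E3 => ((jb x ^ (-σ) : ℝ) : ℂ)) 2 volume
    have hA : A < ⊤ := (memLp_jb_rpow hσ).2
    set δ : ℝ := η / (A.toReal * A.toReal + 1)
    have hδ : 0 < δ := by positivity
    filter_upwards [hlim.eventually (tendsto_resKer hV hv hM hδ), self_mem_nhdsWithin]
      with ε h1 hε R hR f
    have hε : 0 < ε := hε
    rcases eq_or_ne (wNorm σ f) ⊤ with htop | htop
    · rw [htop, ENNReal.mul_top (by simpa using hη)]
      exact le_top
    have hf1 : Integrable f volume := by
      rw [← memLp_one_iff_integrable]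
      exact ⟨Lp.aestronglyMeasurable f, (eLpNorm_one_le_wNorm (Lp.aestronglyMeasurable f)).trans_lt
        (ENNReal.mul_lt_top hA htop.lt_top)⟩
    have hRf := resolvent_ae_eq hV hv hC (him ε hε) (hg ε hε) (hκg ε hε) (hκ ε hε) h1.1 hR f hf1
    have hsymmε : ∀ x y, κ ε (x, y) = κ ε (y, x) := by
      intro x y; rw [hκg ε hε, hκg ε hε, ← (hg ε hε).even, neg_sub]
    have hpt : ∀ᵐ x ∂(volume : Measure E3),
        ‖R f x - ∫ y, resKer hV hv κ₀ x y * f y‖ ≤ δ * ∫ y, ‖f y‖ := by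
      filter_upwards [hRf] with x hx
      rw [hx, ← integral_sub (integrable_resKer_mul hV hv (hκ ε hε) hsymmε hf1 x).1
        (integrable_resKer_mul hV hv hκ₀ hsymm hf1 x).1, ← integral_const_mul]
      apply norm_integral_le_of_norm_le (hf1.norm.const_mul δ)
      filter_upwards with y
      rw [← sub_mul, norm_mul]
      gcongr
      exact h1.2 x y
    have hI : ENNReal.ofReal (∫ y, ‖f y‖) = eLpNorm f 1 volume := by
      rw [integral_norm_eq_lintegral_enorm hf1.1, eLpNorm_one_eq_lintegral_enorm,
        ENNReal.ofReal_toReal]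
      exact hf1.2.ne
    calc wNorm (-σ) (fun x => R f x - ∫ y, resKer hV hv κ₀ x y * f y)
        ≤ ENNReal.ofReal (δ * ∫ y, ‖f y‖) * A := by
          apply eLpNorm_le_mul_eLpNorm_of_ae_le_mul
          filter_upwards [hpt] with x hx
          rw [norm_mul, mul_comm]
          gcongr
      _ = ENNReal.ofReal δ * eLpNorm f 1 volume * A := by
          rw [ENNReal.ofReal_mul hδ.le, hI]
      _ ≤ ENNReal.ofReal δ * (A * wNorm σ f) * A := by
          gcongr
          exact eLpNorm_one_le_wNorm (Lp.aestronglyMeasurable f)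
      _ = ENNReal.ofReal δ * (A * A) * wNorm σ f := by ring
      _ ≤ _ := by
          gcongr
          rw [← ENNReal.ofReal_toReal hA.ne, ← ENNReal.ofReal_mul ENNReal.toReal_nonneg,
            ← ENNReal.ofReal_mul hδ.le]
          apply ENNReal.ofReal_le_ofReal
          simp only [δ]
          rw [div_mul_eq_mul_div, div_le_iff₀ (by positivity)]
          nlinarith

/-! ### The boundary values of the free resolvent kernel -/

open Classical in
/-- A function as a bounded continuous function (zero if it is not one). -/
def mkB {X : Type*} [TopologicalSpace X] (h : X → ℂ) : BoundedContinuousFunction X ℂ :=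
  if H : Continuous h ∧ ∃ C, ∀ x, ‖h x‖ ≤ C then
    BoundedContinuousFunction.ofNormedAddCommGroup h H.1 _ H.2.choose_spec
  else 0

theorem mkB_apply {X : Type*} [TopologicalSpace X] {h : X → ℂ} (hc : Continuous h) {C : ℝ}
    (hb : ∀ x, ‖h x‖ ≤ C) (x : X) : mkB h x = h x := by
  have H : Continuous h ∧ ∃ C, ∀ x, ‖h x‖ ≤ C := ⟨hc, C, hb⟩
  rw [mkB, dif_pos H]
  rfl

/-- The kernel `λ⁻¹ f(λ|x-y|)`. -/
def profKer (f : ℕ → ℝ → ℂ) (lam : ℝ) : B2 :=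
  mkB fun p => (lam : ℂ)⁻¹ * f 0 (lam * ‖p.1 - p.2‖)

theorem IsProfile.continuous {a : ℂ} {f : ℕ → ℝ → ℂ} {C : ℝ} (h : IsProfile a f C) (j : ℕ) :
    Continuous (f j) :=
  continuous_iff_continuousAt.mpr fun s => (h.hasDerivAt j s).continuousAt

theorem IsProfile.profKer_apply {a : ℂ} {f : ℕ → ℝ → ℂ} {C : ℝ} (h : IsProfile a f C) {lam : ℝ}
    (hl : 0 < lam) (x y : E3) : profKer f lam (x, y) = (lam : ℂ)⁻¹ * f 0 (lam * ‖x - y‖) := by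
  have hc := h.continuous 0
  refine mkB_apply (by fun_prop) (C := ‖(lam : ℂ)⁻¹‖ * C) (fun p => ?_) (x, y)
  rw [norm_mul]
  gcongr
  exact h.bound 0 (by norm_num) _ (by positivity)

/-- The slices of a kernel `G(|x-y|)` with `G` Lipschitz depend continuously on the point, for the
uniform norm. -/
theorem continuous_slice_of_radial {κ : B2} {G : ℝ → ℂ} {L : ℝ}
    (hκ : ∀ x y, κ (x, y) = G ‖x - y‖)
    (hG : ∀ s t, 0 ≤ s → 0 ≤ t → ‖G s - G t‖ ≤ L * |s - t|) :
    Continuous fun y => sliceL y κ := by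
  have hL : 0 ≤ L := by
    have := (norm_nonneg _).trans (hG 1 0 (by norm_num) le_rfl)
    simpa using this
  apply LipschitzWith.continuous (K := ⟨L, hL⟩)
  apply LipschitzWith.of_dist_le_mul
  intro y y'
  rw [BoundedContinuousFunction.dist_le (by positivity)]
  intro x
  rw [sliceL_apply, sliceL_apply, hκ, hκ, dist_eq_norm]
  refine (hG _ _ (norm_nonneg _) (norm_nonneg _)).trans ?_
  change L * _ ≤ L * _
  gcongr
  refine (abs_norm_sub_norm_le _ _).trans ?_
  rw [dist_eq_norm]
  simp

theorem IsProfile.lipschitz {a : ℂ} {f : ℕ → ℝ → ℂ} {C : ℝ} (h : IsProfile a f C) {s t : ℝ}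
    (hs : 0 ≤ s) (ht : 0 ≤ t) : ‖f 0 s - f 0 t‖ ≤ C * |s - t| :=
  (convex_Ici (0 : ℝ)).norm_image_sub_le_of_norm_hasDerivWithin_le (f := f 0)
    (fun x _ => (h.hasDerivAt 0 x).hasDerivWithinAt)
    (fun x hx => h.bound 1 (by norm_num) x hx) ht hs

theorem IsProfile.continuous_slice {a : ℂ} {f : ℕ → ℝ → ℂ} {C : ℝ} (h : IsProfile a f C) {lam : ℝ}
    (hl : 0 < lam) : Continuous fun y => sliceL y (profKer f lam) := by
  apply continuous_slice_of_radial (G := fun s => (lam : ℂ)⁻¹ * f 0 (lam * s)) (L := C)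
    (h.profKer_apply hl)
  intro s t hs ht
  rw [← mul_sub, norm_mul, norm_inv, Complex.norm_real, Real.norm_of_nonneg hl.le]
  have := h.lipschitz (mul_nonneg hl.le hs) (mul_nonneg hl.le ht)
  rw [← mul_sub, abs_mul, abs_of_pos hl] at this
  calc lam⁻¹ * ‖f 0 (lam * s) - f 0 (lam * t)‖ ≤ lam⁻¹ * (C * (lam * |s - t|)) := by gcongr
    _ = _ := by field_simp

theorem IsProfile.profKer_symm {a : ℂ} {f : ℕ → ℝ → ℂ} {C : ℝ} (h : IsProfile a f C) {lam : ℝ}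
    (hl : 0 < lam) (x y : E3) : profKer f lam (x, y) = profKer f lam (y, x) := by
  rw [h.profKer_apply hl, h.profKer_apply hl, norm_sub_rev]

/-- The free resolvent kernel at spectral parameter `k⁴`. -/
def freeKer (k : ℂ) : B2 := mkB fun p => greenR k ‖p.1 - p.2‖

theorem freeKer_apply {k : ℂ} (h1 : 0 < k.re) (h2 : 0 ≤ k.im) (x y : E3) :
    freeKer k (x, y) = greenR k ‖x - y‖ := by
  have hc := continuous_greenR k
  refine mkB_apply (by fun_prop) (C := ‖k‖⁻¹ * ‖aCoef‖) (fun p => ?_) (x, y)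
  rw [greenR, norm_mul, norm_inv]
  gcongr
  apply norm_prof_le
  · simp; positivity
  · simp; positivity

theorem freeKer_ofReal {lam : ℝ} (hl : 0 < lam) :
    freeKer lam = profKer (fun j s => prof j s) lam := by
  ext ⟨x, y⟩
  rw [freeKer_apply (by simpa using hl) (by simp), isProfile_prof.profKer_apply hl, greenR]
  push_cast
  rfl

theorem continuous_slice_freeKer {k : ℂ} (h1 : 0 < k.re) (h2 : 0 ≤ k.im) :
    Continuous fun y => sliceL y (freeKer k) := by
  apply continuous_slice_of_radial (L := ‖aCoef‖) (freeKer_apply h1 h2)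
  intro s t hs ht
  have hk : k ≠ 0 := by rintro rfl; simp at h1
  have hd : ∀ s : ℝ, HasDerivAt (greenR k) (prof 1 (k * s)) s := by
    intro s
    have e1 : HasDerivAt (fun s : ℝ => k * (s : ℂ)) k s := by
      simpa using (Complex.ofRealCLM.hasDerivAt (x := s)).const_mul k
    refine ((HasDerivAt.comp s (hasDerivAt_prof 0 (k * s)) e1).const_mul k⁻¹).congr_deriv ?_
    field_simp
  exact (convex_Ici (0 : ℝ)).norm_image_sub_le_of_norm_hasDerivWithin_le
    (fun x _ => (hd x).hasDerivWithinAt)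
    (fun x hx => norm_prof_le 1 (by simp; exact mul_nonneg h1.le hx)
      (by simp; exact mul_nonneg h2 hx)) ht hs

/-- The free kernel is Lipschitz in the spectral parameter, in the uniform norm. -/
theorem norm_freeKer_sub_le {lam : ℝ} (hl : 0 < lam) {k : ℂ} (h1 : lam / 2 ≤ k.re) (h2 : 0 ≤ k.im) :
    ‖freeKer k - freeKer lam‖ ≤ (2 / lam) ^ 2 * (1 + 2 * ‖aCoef‖) * ‖k - lam‖ := by
  rw [BoundedContinuousFunction.norm_le (by positivity)]
  rintro ⟨x, y⟩
  rw [BoundedContinuousFunction.coe_sub, Pi.sub_apply, freeKer_apply (by linarith) h2,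
    freeKer_apply (by simpa using hl) (by simp)]
  set s := ‖x - y‖
  have hs : 0 ≤ s := norm_nonneg _
  set S : Set ℂ := {k | lam / 2 ≤ k.re} ∩ {k | 0 ≤ k.im}
  have hS : Convex ℝ S := (convex_halfSpace_re_ge _).inter (convex_halfSpace_im_ge _)
  have hd : ∀ k ∈ S, HasDerivAt (fun k => greenR k s)
      ((k⁻¹) ^ 2 * (k * s * prof 1 (k * s) - prof 0 (k * s))) k := by
    intro k hk
    have hk0 : k ≠ 0 := by
      rintro rfl
      have : lam / 2 ≤ 0 := by simpa using hk.1
      linarith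
    have e1 : HasDerivAt (fun k : ℂ => k * (s : ℂ)) s k := by
      simpa using (hasDerivAt_id k).mul_const (s : ℂ)
    refine ((hasDerivAt_inv hk0).mul
      (HasDerivAt.comp k (hasDerivAt_prof 0 (k * s)) e1)).congr_deriv ?_
    simp only [Function.comp]
    field_simp
    ring
  refine hS.norm_image_sub_le_of_norm_hasDerivWithin_le
    (fun k hk => (hd k hk).hasDerivWithinAt) ?_ ⟨by simp; linarith, by simp⟩ ⟨h1, h2⟩
  intro k hk
  have hk1 : lam / 2 ≤ k.re := hk.1
  have hk2 : 0 ≤ k.im := hk.2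
  have r1 : 0 ≤ (k * s).re := by simp; exact mul_nonneg (by linarith) hs
  have r2 : 0 ≤ (k * s).im := by simp; exact mul_nonneg hk2 hs
  have hkn : lam / 2 ≤ ‖k‖ := hk1.trans (Complex.re_le_norm k)
  rw [norm_mul, norm_pow, norm_inv]
  have hinv : ‖k‖⁻¹ ≤ 2 / lam := by
    rw [← inv_div]
    exact inv_anti₀ (by positivity) hkn
  have hb : ‖k * s * prof 1 (k * s) - prof 0 (k * s)‖ ≤ 1 + 2 * ‖aCoef‖ := by
    refine (norm_sub_le _ _).trans ?_
    have := norm_mul_prof_le 1 r1 r2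
    have h0 := norm_prof_le 0 r1 r2
    push_cast at this
    linarith
  gcongr

/-- The fourth root `k` of `λ⁴ + iε` near `λ`. -/
def rootK (lam ε : ℝ) : ℂ := ((lam : ℂ) ^ 4 + (ε : ℂ) * Complex.I) ^ ((4 : ℕ) : ℂ)⁻¹

theorem rootK_pow (lam ε : ℝ) : rootK lam ε ^ 4 = (lam : ℂ) ^ 4 + (ε : ℂ) * Complex.I :=
  Complex.cpow_nat_inv_pow _ (by norm_num)

/-- For `ε > 0` the fourth root lies in the open first quadrant, where the free kernel decays. -/
theorem rootK_pos (lam : ℝ) {ε : ℝ} (hε : 0 < ε) : 0 < (rootK lam ε).re ∧ 0 < (rootK lam ε).im := by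
  set z := (lam : ℂ) ^ 4 + (ε : ℂ) * Complex.I with hz
  have him : z.im = ε := by simp [hz, ← Complex.ofReal_pow]
  have hz0 : z ≠ 0 := by
    intro h
    rw [h] at him
    simp at him
    linarith
  have harg0 : 0 < z.arg := by
    have h1 : 0 ≤ z.arg := Complex.arg_nonneg_iff.mpr (by rw [him]; exact hε.le)
    rcases h1.eq_or_lt with h | h
    · have := (Complex.arg_eq_zero_iff.mp h.symm).2
      linarith
    · exact h
  have hargpi : z.arg ≤ Real.pi := Complex.arg_le_pi z
  have hl : (Complex.log z * ((4 : ℕ) : ℂ)⁻¹).im = z.arg / 4 := by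
    rw [show ((4 : ℕ) : ℂ)⁻¹ = ((4⁻¹ : ℝ) : ℂ) by push_cast; rfl, Complex.im_mul_ofReal,
      Complex.log_im]
    ring
  have hp := Real.pi_pos
  rw [rootK, ← hz, Complex.cpow_def_of_ne_zero hz0, Complex.exp_re, Complex.exp_im, hl]
  constructor
  · exact mul_pos (Real.exp_pos _) (Real.cos_pos_of_mem_Ioo ⟨by linarith, by linarith⟩)
  · exact mul_pos (Real.exp_pos _) (Real.sin_pos_of_pos_of_lt_pi (by linarith) (by linarith))

theorem tendsto_rootK {lam : ℝ} (hl : 0 < lam) :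
    Tendsto (rootK lam) (𝓝[>] 0) (𝓝 (lam : ℂ)) := by
  have h0 : rootK lam 0 = lam := by
    have := Complex.pow_cpow_nat_inv (x := (lam : ℂ)) (n := 4) (by norm_num)
      (by rw [Complex.arg_ofReal_of_nonneg hl.le]; simp [Real.pi_pos])
      (by rw [Complex.arg_ofReal_of_nonneg hl.le]; positivity)
    simpa [rootK] using this
  have hc : ContinuousAt (rootK lam) 0 := by
    unfold rootK
    refine ContinuousAt.comp (f := fun ε : ℝ => (lam : ℂ) ^ 4 + (ε : ℂ) * Complex.I)
      (g := fun z : ℂ => z ^ ((4 : ℕ) : ℂ)⁻¹) (continuousAt_cpow_const ?_) (by fun_prop)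
    simp [← Complex.ofReal_pow, Complex.ofReal_mem_slitPlane, hl]
  have := hc.tendsto
  rw [h0] at this
  exact this.mono_left nhdsWithin_le_nhds

theorem tendsto_freeKer {lam : ℝ} (hl : 0 < lam) :
    Tendsto (fun ε => freeKer (rootK lam ε)) (𝓝[>] 0) (𝓝 (freeKer lam)) := by
  rw [tendsto_iff_norm_sub_tendsto_zero]
  have h1 := tendsto_rootK hl
  have h2 := (tendsto_iff_norm_sub_tendsto_zero.mp h1).const_mul
    ((2 / lam) ^ 2 * (1 + 2 * ‖aCoef‖))
  rw [mul_zero] at h2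
  refine squeeze_zero' (Eventually.of_forall fun _ => norm_nonneg _) ?_ h2
  have h3 : ∀ᶠ ε in 𝓝[>] (0 : ℝ), lam / 2 ≤ (rootK lam ε).re := by
    have := (Complex.continuous_re.tendsto _).comp h1
    exact this.eventually ((lt_mem_nhds (by simpa using half_lt_self hl)).mono fun _ h => h.le)
  filter_upwards [h3, self_mem_nhdsWithin] with ε h4 h5
  exact norm_freeKer_sub_le hl h4 (rootK_pos lam h5).2.le

section

variable {V : E3 → ℝ} (hV : Measurable V) (hv : MemLp (vC V) 2 (volume : Measure E3))

/-- Limiting absorption from the upper half plane. -/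
theorem isLimitingKernel_plus {C : ℝ} (hC : ∀ x, |V x| ≤ C) {lam : ℝ} (hl : 0 < lam)
    (hM : IsUnit (birman hV hv (profKer (fun j s => prof j s) lam))) :
    IsLimitingKernel V 1 lam (resKer hV hv (profKer (fun j s => prof j s) lam)) := by
  refine isLimitingKernel_resKer hV hv hC one_ne_zero hM (isProfile_prof.continuous_slice hl)
    (isProfile_prof.profKer_symm hl) (fun ε x => greenR (rootK lam ε) ‖x‖)
    (fun ε => freeKer (rootK lam ε)) ?_ ?_ ?_ ?_
  · intro ε hε
    obtain ⟨h1, h2⟩ := rootK_pos lam hε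
    have := isFreeKernel_greenR h1 h2
    rw [rootK_pow] at this
    simpa using this
  · intro ε hε
    exact freeKer_apply (rootK_pos lam hε).1 (rootK_pos lam hε).2.le
  · intro ε hε
    exact continuous_slice_freeKer (rootK_pos lam hε).1 (rootK_pos lam hε).2.le
  · rw [← freeKer_ofReal hl]
    exact tendsto_freeKer hl

/-- Limiting absorption from the lower half plane, by conjugating the free kernels. -/
theorem isLimitingKernel_minus {C : ℝ} (hC : ∀ x, |V x| ≤ C) {lam : ℝ} (hl : 0 < lam)
    (hM : IsUnit (birman hV hv (profKer (fun j s => starRingEnd ℂ (prof j s)) lam))) :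
    IsLimitingKernel V (-1) lam
      (resKer hV hv (profKer (fun j s => starRingEnd ℂ (prof j s)) lam)) := by
  refine isLimitingKernel_resKer hV hv hC (by norm_num) hM
    (isProfile_prof.conj.continuous_slice hl) (isProfile_prof.conj.profKer_symm hl)
    (fun ε x => starRingEnd ℂ (greenR (rootK lam ε) ‖x‖))
    (fun ε => star (freeKer (rootK lam ε))) ?_ ?_ ?_ ?_
  · intro ε hε
    obtain ⟨h1, h2⟩ := rootK_pos lam hε
    have := (isFreeKernel_greenR h1 h2).conj
    rw [rootK_pow] at this
    convert this using 1
    simp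
  · intro ε hε x y
    rw [BoundedContinuousFunction.star_apply,
      freeKer_apply (rootK_pos lam hε).1 (rootK_pos lam hε).2.le]
    rfl
  · intro ε hε
    have h1 := continuous_slice_freeKer (rootK_pos lam hε).1 (rootK_pos lam hε).2.le
    have h2 : (fun y => sliceL y (star (freeKer (rootK lam ε)))) =
        fun y => star (sliceL y (freeKer (rootK lam ε))) := by
      ext y x; rfl
    rw [h2]
    exact continuous_star.comp h1
  · have h1 : profKer (fun j s => starRingEnd ℂ (prof j s)) lam = star (freeKer lam) := by
      ext ⟨x, y⟩
      rw [isProfile_prof.conj.profKer_apply hl, freeKer_ofReal hl,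
        BoundedContinuousFunction.star_apply, isProfile_prof.profKer_apply hl]
      simp
    rw [h1]
    exact (continuous_star.tendsto _).comp (tendsto_freeKer hl)

end

/-! ### Symbol-type bounds for Banach-space valued functions -/

section SymBd

variable {Y Z W : Type*} [NormedAddCommGroup Y] [NormedSpace ℝ Y] [NormedAddCommGroup Z]
  [NormedSpace ℝ Z] [NormedAddCommGroup W] [NormedSpace ℝ W]

/-- `A = O₂(λⁿ)` on `(0, l₀)`, with constant `C`, for a function with values in a normed space. -/
def SymBd (l₀ : ℝ) (n : ℕ) (C : ℝ) (A : ℝ → Y) : Prop :=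
  ∃ A₁ A₂ : ℝ → Y, ∀ l ∈ Ioo 0 l₀, HasDerivAt A (A₁ l) l ∧ HasDerivAt A₁ (A₂ l) l ∧
    ContinuousAt A₂ l ∧ ‖A l‖ ≤ C * l ^ n ∧ l * ‖A₁ l‖ ≤ C * l ^ n ∧ l ^ 2 * ‖A₂ l‖ ≤ C * l ^ n

theorem SymBd.nonneg {l₀ : ℝ} {n : ℕ} {C : ℝ} {A : ℝ → Y} (h : SymBd l₀ n C A) (hl : 0 < l₀) :
    0 ≤ C := by
  obtain ⟨A₁, A₂, h⟩ := h
  have hm : l₀ / 2 ∈ Ioo 0 l₀ := ⟨by linarith, by linarith⟩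
  have h1 := (norm_nonneg _).trans (h _ hm).2.2.2.1
  have h2 : 0 < (l₀ / 2) ^ n := pow_pos hm.1 n
  exact nonneg_of_mul_nonneg_left h1 h2

theorem SymBd.mono {l₀ l₁ : ℝ} {n : ℕ} {C C' : ℝ} {A : ℝ → Y} (h : SymBd l₀ n C A) (hC : C ≤ C')
    (hl : l₁ ≤ l₀) : SymBd l₁ n C' A := by
  obtain ⟨A₁, A₂, h⟩ := h
  refine ⟨A₁, A₂, fun l hm => ?_⟩
  obtain ⟨h1, h2, h3, h4, h5, h6⟩ := h l ⟨hm.1, hm.2.trans_le hl⟩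
  have : C * l ^ n ≤ C' * l ^ n := mul_le_mul_of_nonneg_right hC (pow_nonneg hm.1.le n)
  exact ⟨h1, h2, h3, h4.trans this, h5.trans this, h6.trans this⟩

theorem SymBd.congr {l₀ : ℝ} {n : ℕ} {C : ℝ} {A B : ℝ → Y} (h : SymBd l₀ n C A)
    (hAB : ∀ l ∈ Ioo 0 l₀, A l = B l) : SymBd l₀ n C B := by
  obtain ⟨A₁, A₂, h⟩ := h
  refine ⟨A₁, A₂, fun l hm => ?_⟩
  obtain ⟨h1, h2, h3, h4, h5, h6⟩ := h l hm
  refine ⟨h1.congr_of_eventuallyEq ?_, h2, h3, hAB l hm ▸ h4, h5, h6⟩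
  filter_upwards [isOpen_Ioo.mem_nhds hm] with t ht using (hAB t ht).symm

/-- On a subinterval of `(0, 1)`, a bound of higher order implies one of lower order. -/
theorem SymBd.lower {l₀ : ℝ} {n : ℕ} {C : ℝ} {A : ℝ → Y} (h : SymBd l₀ (n + 1) C A)
    (hl : l₀ ≤ 1) : SymBd l₀ n C A := by
  rcases le_or_gt l₀ 0 with h0 | h0
  · exact ⟨0, 0, fun l hm => absurd (hm.1.trans hm.2) (not_lt.mpr h0)⟩
  have hC := h.nonneg h0
  obtain ⟨A₁, A₂, h⟩ := h
  refine ⟨A₁, A₂, fun l hm => ?_⟩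
  obtain ⟨h1, h2, h3, h4, h5, h6⟩ := h l hm
  have : C * l ^ (n + 1) ≤ C * l ^ n := mul_le_mul_of_nonneg_left
    (pow_le_pow_of_le_one hm.1.le (hm.2.le.trans hl) (Nat.le_succ n)) hC
  exact ⟨h1, h2, h3, h4.trans this, h5.trans this, h6.trans this⟩

theorem symBd_const {l₀ : ℝ} {C : ℝ} {c : Y} (hc : ‖c‖ ≤ C) : SymBd l₀ 0 C fun _ => c := by
  have hC := (norm_nonneg _).trans hc
  exact ⟨0, 0, fun l _ => ⟨hasDerivAt_const _ _, hasDerivAt_const _ _, continuousAt_const,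
    by simpa using hc, by simpa using hC, by simpa using hC⟩⟩

theorem symBd_smul_const {l₀ : ℝ} {C : ℝ} {c : Y} (hc : ‖c‖ ≤ C) :
    SymBd l₀ 1 C fun l : ℝ => l • c := by
  have hC := (norm_nonneg _).trans hc
  refine ⟨fun _ => c, 0, fun l hm => ⟨?_, hasDerivAt_const _ _, continuousAt_const, ?_, ?_, ?_⟩⟩
  · simpa using (hasDerivAt_id l).smul_const c
  · rw [norm_smul, Real.norm_of_nonneg hm.1.le, pow_one, mul_comm]
    gcongr
    exact hm.1.le
  · rw [pow_one, mul_comm]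
    gcongr
    exact hm.1.le
  · simp [mul_nonneg hC hm.1.le]

theorem SymBd.add {l₀ : ℝ} {n : ℕ} {C C' : ℝ} {A B : ℝ → Y} (hA : SymBd l₀ n C A)
    (hB : SymBd l₀ n C' B) : SymBd l₀ n (C + C') fun l => A l + B l := by
  obtain ⟨A₁, A₂, hA⟩ := hA
  obtain ⟨B₁, B₂, hB⟩ := hB
  refine ⟨fun l => A₁ l + B₁ l, fun l => A₂ l + B₂ l, fun l hm => ?_⟩
  obtain ⟨a1, a2, a3, a4, a5, a6⟩ := hA l hm
  obtain ⟨b1, b2, b3, b4, b5, b6⟩ := hB l hm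
  refine ⟨a1.add b1, a2.add b2, a3.add b3, ?_, ?_, ?_⟩
  · linarith [norm_add_le (A l) (B l)]
  · have := mul_le_mul_of_nonneg_left (norm_add_le (A₁ l) (B₁ l)) hm.1.le
    linarith
  · have := mul_le_mul_of_nonneg_left (norm_add_le (A₂ l) (B₂ l)) (sq_nonneg l)
    linarith

theorem SymBd.clm {l₀ : ℝ} {n : ℕ} {C : ℝ} {A : ℝ → Y} (hA : SymBd l₀ n C A) (L : Y →L[ℝ] Z)
    {M : ℝ} (hL : ‖L‖ ≤ M) : SymBd l₀ n (M * C) fun l => L (A l) := by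
  obtain ⟨A₁, A₂, hA⟩ := hA
  refine ⟨fun l => L (A₁ l), fun l => L (A₂ l), fun l hm => ?_⟩
  obtain ⟨a1, a2, a3, a4, a5, a6⟩ := hA l hm
  have hM : 0 ≤ M := (norm_nonneg _).trans hL
  have hb : ∀ y, ‖L y‖ ≤ M * ‖y‖ := fun y => L.le_of_opNorm_le hL y
  refine ⟨L.hasFDerivAt.comp_hasDerivAt l a1, L.hasFDerivAt.comp_hasDerivAt l a2,
    L.continuous.continuousAt.comp a3, ?_, ?_, ?_⟩
  · rw [mul_assoc]; exact (hb _).trans (mul_le_mul_of_nonneg_left a4 hM)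
  · calc l * ‖L (A₁ l)‖ ≤ l * (M * ‖A₁ l‖) := mul_le_mul_of_nonneg_left (hb _) hm.1.le
      _ = M * (l * ‖A₁ l‖) := by ring
      _ ≤ M * (C * l ^ n) := mul_le_mul_of_nonneg_left a5 hM
      _ = _ := by ring
  · calc l ^ 2 * ‖L (A₂ l)‖ ≤ l ^ 2 * (M * ‖A₂ l‖) :=
          mul_le_mul_of_nonneg_left (hb _) (sq_nonneg l)
      _ = M * (l ^ 2 * ‖A₂ l‖) := by ring
      _ ≤ M * (C * l ^ n) := mul_le_mul_of_nonneg_left a6 hM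
      _ = _ := by ring

theorem SymBd.neg {l₀ : ℝ} {n : ℕ} {C : ℝ} {A : ℝ → Y} (hA : SymBd l₀ n C A) :
    SymBd l₀ n C fun l => -A l := by
  have := hA.clm (-ContinuousLinearMap.id ℝ Y) (M := 1)
    (by rw [norm_neg]; exact ContinuousLinearMap.norm_id_le)
  simpa using this

theorem SymBd.sub {l₀ : ℝ} {n : ℕ} {C C' : ℝ} {A B : ℝ → Y} (hA : SymBd l₀ n C A)
    (hB : SymBd l₀ n C' B) : SymBd l₀ n (C + C') fun l => A l - B l := by
  simpa only [sub_eq_add_neg] using hA.add hB.neg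

/-- The product rule: `O₂(λⁿ)` times `O₂(λᵐ)` is `O₂(λⁿ⁺ᵐ)`. -/
theorem SymBd.bilin {l₀ : ℝ} {n m : ℕ} {C C' : ℝ} {A : ℝ → Y} {B : ℝ → Z} (hA : SymBd l₀ n C A)
    (hB : SymBd l₀ m C' B) (L : Y →L[ℝ] Z →L[ℝ] W) {M : ℝ} (hL : ‖L‖ ≤ M) :
    SymBd l₀ (n + m) (4 * M * C * C') fun l => L (A l) (B l) := by
  rcases le_or_gt l₀ 0 with h0 | h0
  · exact ⟨0, 0, fun l hm => absurd (hm.1.trans hm.2) (not_lt.mpr h0)⟩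
  have hC := hA.nonneg h0
  have hC' := hB.nonneg h0
  have hM : 0 ≤ M := L.opNorm_nonneg.trans hL
  have hb : ∀ y z, ‖L y z‖ ≤ M * ‖y‖ * ‖z‖ := fun y z =>
    (L.le_opNorm₂ y z).trans (by gcongr)
  obtain ⟨A₁, A₂, hA⟩ := hA
  obtain ⟨B₁, B₂, hB⟩ := hB
  refine ⟨fun l => L (A l) (B₁ l) + L (A₁ l) (B l),
    fun l => (L (A l) (B₂ l) + L (A₁ l) (B₁ l)) + (L (A₁ l) (B₁ l) + L (A₂ l) (B l)),
    fun l hm => ?_⟩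
  obtain ⟨a1, a2, a3, a4, a5, a6⟩ := hA l hm
  obtain ⟨b1, b2, b3, b4, b5, b6⟩ := hB l hm
  have hd : ∀ {F : ℝ → Y} {G : ℝ → Z} {F' : Y} {G' : Z}, HasDerivAt F F' l → HasDerivAt G G' l →
      HasDerivAt (fun l => L (F l) (G l)) (L (F l) G' + L F' (G l)) l := by
    intro F G F' G' hF hG
    have h := (L.hasFDerivAt.comp_hasDerivAt l hF).clm_apply hG
    rw [add_comm]
    exact h
  have hpos := hm.1.le
  have hprod : ∀ {y : Y} {z : Z} {p q : ℝ}, 0 ≤ p → 0 ≤ q → p * ‖y‖ ≤ C * l ^ n →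
      q * ‖z‖ ≤ C' * l ^ m → p * q * ‖L y z‖ ≤ M * C * C' * l ^ (n + m) := by
    intro y z p q hp hq h1 h2
    calc p * q * ‖L y z‖ ≤ p * q * (M * ‖y‖ * ‖z‖) := by gcongr; exact hb y z
      _ = M * ((p * ‖y‖) * (q * ‖z‖)) := by ring
      _ ≤ M * ((C * l ^ n) * (C' * l ^ m)) := by gcongr
      _ = _ := by rw [pow_add]; ring
  have e00 := hprod (y := A l) (z := B l) zero_le_one zero_le_one (by simpa using a4)
    (by simpa using b4)
  have e01 := hprod (y := A l) (z := B₁ l) zero_le_one hpos (by simpa using a4) b5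
  have e10 := hprod (y := A₁ l) (z := B l) hpos zero_le_one a5 (by simpa using b4)
  have e02 := hprod (y := A l) (z := B₂ l) zero_le_one (sq_nonneg l) (by simpa using a4) b6
  have e11 := hprod (y := A₁ l) (z := B₁ l) hpos hpos a5 b5
  have e20 := hprod (y := A₂ l) (z := B l) (sq_nonneg l) zero_le_one a6 (by simpa using b4)
  have hK : 0 ≤ M * C * C' * l ^ (n + m) := by positivity
  refine ⟨hd a1 b1, (hd a1 b2).add (hd a2 b1), ?_, ?_, ?_, ?_⟩
  · have hc : ∀ {F : ℝ → Y} {G : ℝ → Z}, ContinuousAt F l → ContinuousAt G l →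
        ContinuousAt (fun l => L (F l) (G l)) l := fun hF hG =>
      (L.continuous.continuousAt.comp hF).clm_apply hG
    exact ((hc a1.continuousAt b3).add (hc a2.continuousAt b2.continuousAt)).add
      ((hc a2.continuousAt b2.continuousAt).add (hc a3 b1.continuousAt))
  · linarith
  · have := mul_le_mul_of_nonneg_left (norm_add_le (L (A l) (B₁ l)) (L (A₁ l) (B l))) hpos
    linarith
  · have t1 := norm_add_le (L (A l) (B₂ l) + L (A₁ l) (B₁ l)) (L (A₁ l) (B₁ l) + L (A₂ l) (B l))
    have t2 := norm_add_le (L (A l) (B₂ l)) (L (A₁ l) (B₁ l))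
    have t3 := norm_add_le (L (A₁ l) (B₁ l)) (L (A₂ l) (B l))
    have := mul_le_mul_of_nonneg_left (t1.trans (add_le_add t2 t3)) (sq_nonneg l)
    linarith

theorem contDiffOn_two_iff {l₀ : ℝ} {A : ℝ → Y} : ContDiffOn ℝ 2 A (Ioo 0 l₀) ↔
    ∃ A₁ A₂ : ℝ → Y, ∀ l ∈ Ioo 0 l₀, HasDerivAt A (A₁ l) l ∧ HasDerivAt A₁ (A₂ l) l ∧
      ContinuousAt A₂ l := by
  have ho : IsOpen (Ioo 0 l₀) := isOpen_Ioo
  have h2 : (2 : WithTop ℕ∞) = 1 + 1 := by norm_num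
  have h1 : (1 : WithTop ℕ∞) = 0 + 1 := by norm_num
  constructor
  · intro h
    rw [h2, contDiffOn_succ_iff_deriv_of_isOpen ho] at h
    obtain ⟨hd, -, h⟩ := h
    rw [h1, contDiffOn_succ_iff_deriv_of_isOpen ho] at h
    obtain ⟨hd', -, h⟩ := h
    refine ⟨deriv A, deriv (deriv A), fun l hm => ⟨?_, ?_, ?_⟩⟩
    · exact (hd.differentiableAt (ho.mem_nhds hm)).hasDerivAt
    · exact (hd'.differentiableAt (ho.mem_nhds hm)).hasDerivAt
    · exact h.continuousOn.continuousAt (ho.mem_nhds hm)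
  · rintro ⟨A₁, A₂, h⟩
    rw [h2, contDiffOn_succ_iff_deriv_of_isOpen ho]
    refine ⟨fun l hm => (h l hm).1.differentiableAt.differentiableWithinAt, by simp, ?_⟩
    have e1 : ∀ l ∈ Ioo 0 l₀, deriv A l = A₁ l := fun l hm => (h l hm).1.deriv
    refine ContDiffOn.congr ?_ e1
    rw [h1, contDiffOn_succ_iff_deriv_of_isOpen ho]
    refine ⟨fun l hm => (h l hm).2.1.differentiableAt.differentiableWithinAt, by simp, ?_⟩
    have e2 : ∀ l ∈ Ioo 0 l₀, deriv A₁ l = A₂ l := fun l hm => (h l hm).2.1.deriv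
    refine ContDiffOn.congr ?_ e2
    rw [contDiffOn_zero]
    exact fun l hm => (h l hm).2.2.continuousWithinAt

theorem SymBd.contDiffOn {l₀ : ℝ} {n : ℕ} {C : ℝ} {A : ℝ → Y} (h : SymBd l₀ n C A) :
    ContDiffOn ℝ 2 A (Ioo 0 l₀) := by
  obtain ⟨A₁, A₂, h⟩ := h
  exact contDiffOn_two_iff.mpr ⟨A₁, A₂, fun l hm => ⟨(h l hm).1, (h l hm).2.1, (h l hm).2.2.1⟩⟩

/-- A twice continuously differentiable path of bounded continuous functions satisfies a symbol
bound as soon as its values do, uniformly. -/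
theorem symBd_of_pointwise {X : Type*} [TopologicalSpace X] [Nonempty X] {l₀ : ℝ} {n : ℕ} {C : ℝ}
    {A : ℝ → BoundedContinuousFunction X ℂ} (hA : ContDiffOn ℝ 2 A (Ioo 0 l₀))
    (h : ∀ x, SymBd l₀ n C fun l => A l x) : SymBd l₀ n C A := by
  obtain ⟨A₁, A₂, hd⟩ := contDiffOn_two_iff.mp hA
  refine ⟨A₁, A₂, fun l hm => ?_⟩
  have ev : ∀ {F : ℝ → BoundedContinuousFunction X ℂ} {F' : BoundedContinuousFunction X ℂ} {t : ℝ}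
      (x : X), HasDerivAt F F' t → HasDerivAt (fun s => F s x) (F' x) t := by
    intro F F' t x hF
    have h := ((BoundedContinuousFunction.evalCLM ℝ x :
      BoundedContinuousFunction X ℂ →L[ℝ] ℂ).hasFDerivAt (x := F t)).comp_hasDerivAt t hF
    exact h
  have key : ∀ x, ‖A l x‖ ≤ C * l ^ n ∧ l * ‖A₁ l x‖ ≤ C * l ^ n ∧
      l ^ 2 * ‖A₂ l x‖ ≤ C * l ^ n := by
    intro x
    obtain ⟨a₁, a₂, ha⟩ := h x
    have e1 : ∀ t ∈ Ioo 0 l₀, A₁ t x = a₁ t := fun t ht =>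
      (ev x (hd t ht).1).unique (ha t ht).1
    have e2 : A₂ l x = a₂ l := by
      apply (ev x (hd l hm).2.1).unique
      apply (ha l hm).2.1.congr_of_eventuallyEq
      filter_upwards [isOpen_Ioo.mem_nhds hm] with t ht using e1 t ht
    rw [e1 l hm, e2]
    exact (ha l hm).2.2.2
  have hpos := hm.1
  refine ⟨(hd l hm).1, (hd l hm).2.1, (hd l hm).2.2, ?_, ?_, ?_⟩
  · exact (BoundedContinuousFunction.norm_le_of_nonempty).mpr fun x => (key x).1
  · rw [mul_comm, ← le_div_iff₀ hpos]
    refine (BoundedContinuousFunction.norm_le_of_nonempty).mpr fun x => ?_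
    rw [le_div_iff₀ hpos, mul_comm]
    exact (key x).2.1
  · rw [mul_comm, ← le_div_iff₀ (by positivity)]
    refine (BoundedContinuousFunction.norm_le_of_nonempty).mpr fun x => ?_
    rw [le_div_iff₀ (by positivity), mul_comm]
    exact (key x).2.2

/-- Pointwise symbol bounds with the constants `C⟨x⟩⟨y⟩` are the error terms `O₂(λ⟨x⟩⟨y⟩)`. -/
theorem isOk_of_symBd {l₀ C : ℝ} {E : ℝ → E3 → E3 → ℂ}
    (h : ∀ x y, SymBd l₀ 1 (C * (jb x * jb y)) fun l => E l x y) :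
    IsOk 2 l₀ E fun l x y => l * jb x * jb y := by
  refine ⟨fun x y => (h x y).contDiffOn, 3 * C, fun l hm x y => ?_⟩
  obtain ⟨A₁, A₂, ha⟩ := h x y
  obtain ⟨a1, a2, -, a4, a5, a6⟩ := ha l hm
  have e1 : deriv (fun l => E l x y) =ᶠ[𝓝 l] A₁ := by
    filter_upwards [isOpen_Ioo.mem_nhds hm] with t ht using (ha t ht).1.deriv
  have e2 : iteratedDeriv 2 (fun l => E l x y) l = A₂ l := by
    rw [iteratedDeriv_succ (n := 1), iteratedDeriv_one, e1.deriv_eq, a2.deriv]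
  rw [Finset.sum_range_succ, Finset.sum_range_succ, Finset.sum_range_one, iteratedDeriv_zero,
    iteratedDeriv_one, e2, e1.eq_of_nhds]
  simp only [pow_zero, one_mul, pow_one] at *
  linarith

end SymBd

/-- Inversion preserves symbol bounds near an invertible element. -/
theorem SymBd.ringInverse {R : Type*} [NormedRing R] [NormedAlgebra ℝ R] [CompleteSpace R]
    {l₀ C : ℝ} (hl₀ : 0 < l₀) {S : ℝ → R} {S₀ : R} (hS₀ : IsUnit S₀)
    (hS : SymBd l₀ 1 C fun l => S l - S₀) :
    ∃ l₁ C₁, 0 < l₁ ∧ l₁ ≤ l₀ ∧ l₁ ≤ 1 ∧ (∀ l ∈ Ioo 0 l₁, IsUnit (S l)) ∧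
      SymBd l₁ 1 C₁ fun l => Ring.inverse (S l) - Ring.inverse S₀ := by
  have hC := hS.nonneg hl₀
  obtain ⟨x, hx⟩ := hS₀
  have hci := NormedRing.inverse_continuousAt x
  rw [hx] at hci
  set K := ‖Ring.inverse S₀‖ + 1 with hK
  have hK0 : 0 ≤ K := by positivity
  have hn : ∀ᶠ X in 𝓝 S₀, IsUnit X ∧ ‖Ring.inverse X‖ ≤ K := by
    have h1 : ∀ᶠ X in 𝓝 S₀, IsUnit X := Units.isOpen.mem_nhds ⟨x, hx⟩
    have h2 : ∀ᶠ X in 𝓝 S₀, ‖Ring.inverse X‖ ≤ K :=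
      hci.norm.eventually ((gt_mem_nhds (by linarith)).mono fun _ h => le_of_lt h)
    exact h1.and h2
  obtain ⟨δ, hδ, hball⟩ := Metric.eventually_nhds_iff.mp hn
  set l₁ := min (min l₀ 1) (δ / (C + 1)) with hl₁
  have hl₁pos : 0 < l₁ := lt_min (lt_min hl₀ one_pos) (by positivity)
  have hle0 : l₁ ≤ l₀ := (min_le_left _ _).trans (min_le_left _ _)
  have hle1 : l₁ ≤ 1 := (min_le_left _ _).trans (min_le_right _ _)
  have hleδ : l₁ ≤ δ / (C + 1) := min_le_right _ _
  obtain ⟨A₁, A₂, hA⟩ := hS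
  have hgood : ∀ l ∈ Ioo 0 l₁, IsUnit (S l) ∧ ‖Ring.inverse (S l)‖ ≤ K := by
    intro l hm
    apply hball
    rw [dist_eq_norm]
    have h1 := (hA l ⟨hm.1, hm.2.trans_le hle0⟩).2.2.2.1
    rw [pow_one] at h1
    have h2 : l * (C + 1) < δ := by
      rw [← lt_div_iff₀ (by positivity)]
      exact hm.2.trans_le hleδ
    nlinarith [hm.1]
  set N := fun l => Ring.inverse (S l) with hN
  set C₁ := K ^ 2 * C + 2 * K ^ 3 * C ^ 2
  refine ⟨l₁, C₁, hl₁pos, hle0, hle1, fun l hm => (hgood l hm).1, ?_⟩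
  refine ⟨fun l => -(N l * A₁ l * N l),
    fun l => -(((-(N l * A₁ l * N l)) * A₁ l + N l * A₂ l) * N l +
      N l * A₁ l * (-(N l * A₁ l * N l))), fun l hm => ?_⟩
  have hm0 : l ∈ Ioo 0 l₀ := ⟨hm.1, hm.2.trans_le hle0⟩
  obtain ⟨a1, a2, a3, a4, a5, a6⟩ := hA l hm0
  have hd : ∀ t ∈ Ioo 0 l₁, HasDerivAt N (-(N t * A₁ t * N t)) t := by
    intro t ht
    have h1 : HasDerivAt S (A₁ t) t := by
      simpa using (hA t ⟨ht.1, ht.2.trans_le hle0⟩).1.add_const S₀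
    obtain ⟨⟨u, hu⟩, -⟩ := hgood t ht
    have h2 := hasFDerivAt_ringInverse (𝕜 := ℝ) u
    rw [hu] at h2
    have h3 := h2.comp_hasDerivAt t h1
    have h4 : ((u⁻¹ : Rˣ) : R) = N t := by rw [hN]; simp only [← hu, Ring.inverse_unit]
    rw [h4] at h3
    refine HasDerivAt.congr_deriv h3 ?_
    simp [ContinuousLinearMap.mulLeftRight_apply]
  have n1 := hd l hm
  have hNK : ‖N l‖ ≤ K := (hgood l hm).2
  have hpos := hm.1
  have b1 : ‖A₁ l‖ ≤ C := by
    rw [pow_one, mul_comm] at a5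
    exact le_of_mul_le_mul_right a5 hpos
  have b2 : l * ‖A₂ l‖ ≤ C := by
    have : l * (l * ‖A₂ l‖) ≤ l * C := by rw [pow_one] at a6; linarith
    exact le_of_mul_le_mul_left this hpos
  have hn1 : ‖N l * A₁ l * N l‖ ≤ K ^ 2 * C := by
    calc _ ≤ ‖N l‖ * ‖A₁ l‖ * ‖N l‖ :=
          (norm_mul_le _ _).trans (mul_le_mul_of_nonneg_right (norm_mul_le _ _) (norm_nonneg _))
      _ ≤ K * C * K := by gcongr
      _ = _ := by ring
  have hC1 : K ^ 2 * C ≤ C₁ := by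
    have : 0 ≤ 2 * K ^ 3 * C ^ 2 := by positivity
    linarith
  refine ⟨n1.sub_const _, ?_, ?_, ?_, ?_, ?_⟩
  · exact ((n1.mul a2).mul n1).neg
  · have c0 := n1.continuousAt
    exact ((((((c0.mul a2.continuousAt).mul c0).neg.mul a2.continuousAt).add (c0.mul a3)).mul
      c0).add ((c0.mul a2.continuousAt).mul ((c0.mul a2.continuousAt).mul c0).neg)).neg
  · have hid : N l - Ring.inverse S₀ = -(N l * (S l - S₀) * Ring.inverse S₀) := by
      have h1 : N l * S l = 1 := Ring.inverse_mul_cancel _ (hgood l hm).1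
      have h2 : S₀ * Ring.inverse S₀ = 1 := Ring.mul_inverse_cancel _ ⟨x, hx⟩
      rw [mul_sub, sub_mul, h1, mul_assoc, h2]
      simp
    change ‖N l - _‖ ≤ _
    rw [hid, norm_neg]
    calc _ ≤ ‖N l‖ * ‖S l - S₀‖ * ‖Ring.inverse S₀‖ :=
          (norm_mul_le _ _).trans (mul_le_mul_of_nonneg_right (norm_mul_le _ _) (norm_nonneg _))
      _ ≤ K * (C * l ^ 1) * K := by gcongr; linarith
      _ = K ^ 2 * C * l ^ 1 := by ring
      _ ≤ _ := by gcongr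
  · rw [norm_neg, pow_one, mul_comm]
    gcongr
    exact hn1.trans hC1
  · have t1 : ‖-(N l * A₁ l * N l) * A₁ l * N l‖ ≤ K ^ 3 * C ^ 2 := by
      calc _ ≤ ‖-(N l * A₁ l * N l)‖ * ‖A₁ l‖ * ‖N l‖ :=
            (norm_mul_le _ _).trans (mul_le_mul_of_nonneg_right (norm_mul_le _ _) (norm_nonneg _))
        _ ≤ K ^ 2 * C * C * K := by rw [norm_neg]; gcongr
        _ = _ := by ring
    have t2 : ‖N l * A₁ l * -(N l * A₁ l * N l)‖ ≤ K ^ 3 * C ^ 2 := by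
      calc _ ≤ ‖N l‖ * ‖A₁ l‖ * ‖-(N l * A₁ l * N l)‖ :=
            (norm_mul_le _ _).trans (mul_le_mul_of_nonneg_right (norm_mul_le _ _) (norm_nonneg _))
        _ ≤ K * C * (K ^ 2 * C) := by rw [norm_neg]; gcongr
        _ = _ := by ring
    have t3 : l * ‖N l * A₂ l * N l‖ ≤ K ^ 2 * C := by
      calc _ ≤ l * (‖N l‖ * ‖A₂ l‖ * ‖N l‖) := by
            gcongr
            exact (norm_mul_le _ _).trans
              (mul_le_mul_of_nonneg_right (norm_mul_le _ _) (norm_nonneg _))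
        _ ≤ l * (K * ‖A₂ l‖ * K) := by gcongr
        _ = K ^ 2 * (l * ‖A₂ l‖) := by ring
        _ ≤ _ := by gcongr
    rw [norm_neg, add_mul, pow_one]
    have t4 := (norm_add_le (-(N l * A₁ l * N l) * A₁ l * N l + N l * A₂ l * N l)
      (N l * A₁ l * -(N l * A₁ l * N l))).trans (add_le_add_left (norm_add_le _ _) _)
    have hl1 : l ≤ 1 := hm.2.le.trans hle1
    have t5 : 0 ≤ K ^ 3 * C ^ 2 := by positivity
    have t6 := mul_le_mul_of_nonneg_left t4 (sq_nonneg l)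
    have t7 : l * (K ^ 3 * C ^ 2) ≤ K ^ 3 * C ^ 2 := mul_le_of_le_one_left t5 hl1
    have t8 : l ^ 2 * (‖-(N l * A₁ l * N l) * A₁ l * N l‖ + ‖N l * A₂ l * N l‖ +
        ‖N l * A₁ l * -(N l * A₁ l * N l)‖) ≤ C₁ * l := by
      calc _ = l * (l * ‖-(N l * A₁ l * N l) * A₁ l * N l‖ + l * ‖N l * A₂ l * N l‖ +
          l * ‖N l * A₁ l * -(N l * A₁ l * N l)‖) := by ring
        _ ≤ l * (l * (K ^ 3 * C ^ 2) + K ^ 2 * C + l * (K ^ 3 * C ^ 2)) := by gcongr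
        _ ≤ l * C₁ := by
          apply mul_le_mul_of_nonneg_left _ hpos.le
          simp only [C₁]; linarith
        _ = _ := mul_comm _ _
    exact t6.trans t8

/-! ### Pointwise expansion of the free resolvent kernel -/

section pointwise

variable {a : ℂ} {f : ℕ → ℝ → ℂ} {C : ℝ}

theorem IsProfile.nonneg (h : IsProfile a f C) : 0 ≤ C :=
  (norm_nonneg _).trans (h.bound 0 (by norm_num) 0 le_rfl)

theorem IsProfile.hasDerivAt_scale (h : IsProfile a f C) (j : ℕ) (r l : ℝ) :
    HasDerivAt (fun l : ℝ => f j (l * r)) (r * f (j + 1) (l * r)) l := by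
  have h1 : HasDerivAt (fun l : ℝ => l * r) r l := by
    simpa using (hasDerivAt_id l).mul_const r
  have h2 := (h.hasDerivAt j (l * r)).scomp l h1
  rw [Complex.real_smul] at h2
  exact h2

theorem hasDerivAt_ofReal_inv {l : ℝ} (hl : l ≠ 0) :
    HasDerivAt (fun l : ℝ => (l : ℂ)⁻¹) (-((l : ℂ) ^ 2)⁻¹) l := by
  have hlc : (l : ℂ) ≠ 0 := by exact_mod_cast hl
  exact (hasDerivAt_inv hlc).comp_ofReal

theorem norm_ofReal_of_nonneg {l : ℝ} (hl : 0 ≤ l) : ‖(l : ℂ)‖ = l := by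
  rw [Complex.norm_real, Real.norm_of_nonneg hl]

/-- The difference quotient `(f(λr) - f(0)) / λ` is `O₂(r)`. -/
theorem IsProfile.symBd_quot (h : IsProfile a f C) {r : ℝ} (hr : 0 ≤ r) (l₀ : ℝ) :
    SymBd l₀ 0 (5 * C * r) fun l : ℝ => (l : ℂ)⁻¹ * (f 0 (l * r) - a) := by
  have hC := h.nonneg
  refine ⟨fun l => (l : ℂ)⁻¹ * (r * f 1 (l * r)) - ((l : ℂ) ^ 2)⁻¹ * (f 0 (l * r) - a),
    fun l => (l : ℂ)⁻¹ * (r * (r * f 2 (l * r))) - 2 * ((l : ℂ) ^ 2)⁻¹ * (r * f 1 (l * r)) +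
      2 * ((l : ℂ) ^ 3)⁻¹ * (f 0 (l * r) - a), fun l hm => ?_⟩
  have hl := hm.1
  have hl0 : l ≠ 0 := hl.ne'
  have hlc : (l : ℂ) ≠ 0 := by exact_mod_cast hl0
  have d0 := (h.hasDerivAt_scale 0 r l).sub_const a
  have d1 := h.hasDerivAt_scale 1 r l
  have di := hasDerivAt_ofReal_inv hl0
  have di2 : HasDerivAt (fun l : ℝ => ((l : ℂ) ^ 2)⁻¹) (-2 * ((l : ℂ) ^ 3)⁻¹) l := by
    have := di.mul di
    refine (this.congr_of_eventuallyEq (Eventually.of_forall fun t => ?_)).congr_deriv ?_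
    · simp [pow_two]
    · field_simp
      ring
  have hs : 0 ≤ l * r := mul_nonneg hl.le hr
  have b0 : ‖f 0 (l * r) - a‖ ≤ C * (l * r) := by
    have := h.lipschitz hs (le_refl (0 : ℝ))
    rwa [h.zero_zero, sub_zero, abs_of_nonneg hs] at this
  have b1 : ‖f 1 (l * r)‖ ≤ C := h.bound 1 (by norm_num) _ hs
  have b2 : l * r * ‖f 2 (l * r)‖ ≤ C := h.bound_mul 2 (by norm_num) _ hs
  have hCr : 0 ≤ C * r := mul_nonneg hC hr
  refine ⟨?_, ?_, ?_, ?_, ?_, ?_⟩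
  · refine (di.mul d0).congr_deriv ?_
    ring
  · refine ((di.mul (d1.const_mul (r : ℂ))).sub (di2.mul d0)).congr_deriv ?_
    ring
  · have c0 := d0.continuousAt
    have c1 := d1.continuousAt
    have c2 := (h.hasDerivAt_scale 2 r l).continuousAt
    have hp : ∀ n : ℕ, ContinuousAt (fun l : ℝ => ((l : ℂ) ^ n)⁻¹) l := fun n =>
      ContinuousAt.inv₀ (by fun_prop) (pow_ne_zero n hlc)
    exact ((di.continuousAt.mul (continuousAt_const.mul (continuousAt_const.mul c2))).sub
      ((continuousAt_const.mul (hp 2)).mul (continuousAt_const.mul c1))).add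
      ((continuousAt_const.mul (hp 3)).mul c0)
  · rw [norm_mul, norm_inv, norm_ofReal_of_nonneg hl.le, pow_zero, mul_one]
    calc l⁻¹ * ‖f 0 (l * r) - a‖ ≤ l⁻¹ * (C * (l * r)) := by gcongr
      _ = C * r := by field_simp
      _ ≤ _ := by linarith
  · rw [pow_zero, mul_one]
    have e1 : l * ‖(l : ℂ)⁻¹ * (r * f 1 (l * r))‖ ≤ C * r := by
      rw [norm_mul, norm_inv, norm_ofReal_of_nonneg hl.le, norm_mul, norm_ofReal_of_nonneg hr]
      calc _ = r * ‖f 1 (l * r)‖ := by field_simp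
        _ ≤ r * C := by gcongr
        _ = _ := mul_comm _ _
    have e2 : l * ‖((l : ℂ) ^ 2)⁻¹ * (f 0 (l * r) - a)‖ ≤ C * r := by
      rw [norm_mul, norm_inv, norm_pow, norm_ofReal_of_nonneg hl.le]
      calc _ ≤ l * ((l ^ 2)⁻¹ * (C * (l * r))) := by gcongr
        _ = _ := by field_simp
    have := mul_le_mul_of_nonneg_left (norm_sub_le ((l : ℂ)⁻¹ * (r * f 1 (l * r)))
      (((l : ℂ) ^ 2)⁻¹ * (f 0 (l * r) - a))) hl.le
    linarith
  · rw [pow_zero, mul_one]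
    have e1 : l ^ 2 * ‖(l : ℂ)⁻¹ * (r * (r * f 2 (l * r)))‖ ≤ C * r := by
      rw [norm_mul, norm_inv, norm_ofReal_of_nonneg hl.le, norm_mul, norm_mul,
        norm_ofReal_of_nonneg hr]
      calc _ = r * (l * r * ‖f 2 (l * r)‖) := by field_simp
        _ ≤ r * C := by gcongr
        _ = _ := mul_comm _ _
    have e2 : l ^ 2 * ‖2 * ((l : ℂ) ^ 2)⁻¹ * (r * f 1 (l * r))‖ ≤ 2 * C * r := by
      rw [norm_mul, norm_mul, norm_inv, norm_pow, norm_ofReal_of_nonneg hl.le, norm_mul,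
        norm_ofReal_of_nonneg hr, Complex.norm_ofNat]
      calc _ = 2 * r * ‖f 1 (l * r)‖ := by field_simp
        _ ≤ 2 * r * C := by gcongr
        _ = _ := by ring
    have e3 : l ^ 2 * ‖2 * ((l : ℂ) ^ 3)⁻¹ * (f 0 (l * r) - a)‖ ≤ 2 * C * r := by
      rw [norm_mul, norm_mul, norm_inv, norm_pow, norm_ofReal_of_nonneg hl.le,
        Complex.norm_ofNat]
      calc _ ≤ l ^ 2 * (2 * (l ^ 3)⁻¹ * (C * (l * r))) := by gcongr
        _ = _ := by field_simp
    have t1 := norm_add_le ((l : ℂ)⁻¹ * (r * (r * f 2 (l * r))) -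
      2 * ((l : ℂ) ^ 2)⁻¹ * (r * f 1 (l * r))) (2 * ((l : ℂ) ^ 3)⁻¹ * (f 0 (l * r) - a))
    have t2 := norm_sub_le ((l : ℂ)⁻¹ * (r * (r * f 2 (l * r))))
      (2 * ((l : ℂ) ^ 2)⁻¹ * (r * f 1 (l * r)))
    have := mul_le_mul_of_nonneg_left (t1.trans (add_le_add_left t2 _)) (sq_nonneg l)
    linarith

/-- A second difference of a function whose derivative is `O(s)`. -/
theorem norm_triple_le {Q Q' : ℝ → ℂ} (hd : ∀ s, HasDerivAt Q (Q' s) s)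
    (hb : ∀ s, 0 ≤ s → ‖Q' s‖ ≤ C * s) (hQ0 : Q 0 = 0) (hC : 0 ≤ C) {s₁ s₂ s₃ : ℝ} (h1 : 0 ≤ s₁)
    (h2 : 0 ≤ s₂) (h3 : 0 ≤ s₃) (h12 : |s₁ - s₂| ≤ s₃) (h13 : |s₁ - s₃| ≤ s₂) :
    ‖Q s₁ - Q s₂ - Q s₃‖ ≤ 3 * C * (s₂ * s₃) := by
  have hL : ∀ {s t B : ℝ}, 0 ≤ s → 0 ≤ t → s ≤ B → t ≤ B → ‖Q s - Q t‖ ≤ C * B * |s - t| := by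
    intro s t B hs ht hsB htB
    exact (convex_Icc (0 : ℝ) B).norm_image_sub_le_of_norm_hasDerivWithin_le
      (fun x _ => (hd x).hasDerivWithinAt)
      (fun x hx => (hb x hx.1).trans (mul_le_mul_of_nonneg_left hx.2 hC)) ⟨ht, htB⟩ ⟨hs, hsB⟩
  have hQ : ∀ {s : ℝ}, 0 ≤ s → ‖Q s‖ ≤ C * (s * s) := by
    intro s hs
    have := hL hs le_rfl le_rfl hs
    rw [hQ0, sub_zero, sub_zero, abs_of_nonneg hs] at this
    linarith
  have key : ∀ {s t : ℝ}, 0 ≤ s → 0 ≤ t → t ≤ s → |s₁ - s| ≤ t → |s₁ - t| ≤ s →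
      ‖Q s₁ - Q s - Q t‖ ≤ 3 * C * (s * t) := by
    intro s t hs ht hts hs1 ht1
    have e1 := hL (B := 2 * s) h1 hs (by linarith [(abs_le.mp hs1).2]) (by linarith)
    have e2 := hQ ht
    have e3 : C * (2 * s) * |s₁ - s| ≤ C * (2 * s) * t := by gcongr
    have e4 : C * (t * t) ≤ C * (s * t) := by gcongr
    have := norm_sub_le (Q s₁ - Q s) (Q t)
    linarith
  rcases le_total s₃ s₂ with h | h
  · exact key h2 h3 h h12 h13
  · have := key h3 h2 h h13 h12
    rw [show Q s₁ - Q s₂ - Q s₃ = Q s₁ - Q s₃ - Q s₂ by ring, mul_comm s₂ s₃]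
    exact this

/-- The profile with its first two Taylor terms removed. -/
def gProf (a : ℂ) (f : ℕ → ℝ → ℂ) (s : ℝ) : ℂ := f 0 s - a + s / (8 * Real.pi)

/-- The combinations of derivatives of the reduced profile `g` that arise from differentiating
`λ⁻¹ g(λ r)` in `λ`. -/
def gComb (a : ℂ) (f : ℕ → ℝ → ℂ) (j : ℕ) (s : ℝ) : ℂ :=
  match j with
  | 0 => gProf a f s
  | 1 => s * (f 1 s + 1 / (8 * Real.pi)) - gProf a f s
  | _ => s ^ 2 * f 2 s - 2 * (s * (f 1 s + 1 / (8 * Real.pi))) + 2 * gProf a f s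

/-- The derivatives of `gComb`. -/
def gComb' (f : ℕ → ℝ → ℂ) (j : ℕ) (s : ℝ) : ℂ :=
  match j with
  | 0 => f 1 s + 1 / (8 * Real.pi)
  | 1 => s * f 2 s
  | _ => s ^ 2 * f 3 s

theorem IsProfile.hasDerivAt_gProf (h : IsProfile a f C) (s : ℝ) :
    HasDerivAt (gProf a f) (f 1 s + 1 / (8 * Real.pi)) s :=
  ((h.hasDerivAt 0 s).sub_const a).add
    ((Complex.ofRealCLM.hasDerivAt (x := s)).div_const (8 * (Real.pi : ℂ)))

theorem IsProfile.hasDerivAt_gComb (h : IsProfile a f C) (j : ℕ) (s : ℝ) :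
    HasDerivAt (gComb a f j) (gComb' f j s) s := by
  have d0 := h.hasDerivAt_gProf s
  have d1 := (h.hasDerivAt 1 s).add_const (1 / (8 * (Real.pi : ℂ)))
  have d2 := h.hasDerivAt 2 s
  have ds : HasDerivAt (fun s : ℝ => (s : ℂ)) 1 s := Complex.ofRealCLM.hasDerivAt (x := s)
  match j with
  | 0 => exact d0
  | 1 =>
    refine ((ds.mul d1).sub d0).congr_deriv ?_
    simp only [gComb']
    ring
  | j + 2 =>
    refine (((((hasDerivAt_pow 2 (s : ℂ)).comp_ofReal).mul d2).sub ((ds.mul d1).const_mul 2)).add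
      (d0.const_mul 2)).congr_deriv ?_
    simp only [gComb']
    push_cast
    ring

theorem IsProfile.norm_gComb'_le (h : IsProfile a f C) (j : ℕ) {s : ℝ} (hs : 0 ≤ s) :
    ‖gComb' f j s‖ ≤ C * s := by
  match j with
  | 0 =>
    have := (convex_Ici (0 : ℝ)).norm_image_sub_le_of_norm_hasDerivWithin_le (f := f 1)
      (fun x _ => (h.hasDerivAt 1 x).hasDerivWithinAt)
      (fun x hx => h.bound 2 (by norm_num) x hx) (le_refl (0 : ℝ)) hs
    rw [h.one_zero, sub_zero, Real.norm_of_nonneg hs] at this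
    rw [show gComb' f 0 s = f 1 s - -1 / (8 * Real.pi) by simp only [gComb']; ring]
    exact this
  | 1 =>
    simp only [gComb']
    rw [norm_mul, norm_ofReal_of_nonneg hs, mul_comm]
    gcongr
    exact h.bound 2 (by norm_num) s hs
  | j + 2 =>
    simp only [gComb']
    rw [norm_mul, norm_pow, norm_ofReal_of_nonneg hs, pow_two, mul_assoc, mul_comm]
    gcongr
    exact h.bound_mul 3 (by norm_num) s hs

theorem IsProfile.gComb_zero (h : IsProfile a f C) (j : ℕ) : gComb a f j 0 = 0 := by
  have h0 : gProf a f 0 = 0 := by simp [gProf, h.zero_zero]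
  match j with
  | 0 => exact h0
  | 1 => simp [gComb, h0]
  | j + 2 => simp [gComb, h0]

/-- The second difference of `λ⁻¹ f(λ·)`, with its value at `λ = 0` removed, is
`O₂(λ r₂ r₃)`. -/
theorem IsProfile.symBd_triple (h : IsProfile a f C) {r₁ r₂ r₃ : ℝ} (h1 : 0 ≤ r₁)
    (h2 : 0 ≤ r₂) (h3 : 0 ≤ r₃) (h12 : |r₁ - r₂| ≤ r₃) (h13 : |r₁ - r₃| ≤ r₂) (l₀ : ℝ) :
    SymBd l₀ 1 (3 * C * (r₂ * r₃)) fun l : ℝ =>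
      (l : ℂ)⁻¹ * (gProf a f (l * r₁) - gProf a f (l * r₂) - gProf a f (l * r₃)) := by
  set D : ℕ → ℝ → ℂ := fun j l => ((l : ℂ) ^ (j + 1))⁻¹ *
    (gComb a f j (l * r₁) - gComb a f j (l * r₂) - gComb a f j (l * r₃)) with hD
  have hsc : ∀ (j : ℕ) (r l : ℝ), HasDerivAt (fun l : ℝ => gComb a f j (l * r))
      (r * gComb' f j (l * r)) l := by
    intro j r l
    have h1 : HasDerivAt (fun l : ℝ => l * r) r l := by
      simpa using (hasDerivAt_id l).mul_const r
    have h2 := (h.hasDerivAt_gComb j (l * r)).scomp l h1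
    rw [Complex.real_smul] at h2
    exact h2
  have hcomb : ∀ (j : ℕ) (l : ℝ), HasDerivAt (fun l : ℝ =>
      gComb a f j (l * r₁) - gComb a f j (l * r₂) - gComb a f j (l * r₃))
      (r₁ * gComb' f j (l * r₁) - r₂ * gComb' f j (l * r₂) - r₃ * gComb' f j (l * r₃)) l :=
    fun j l => ((hsc j r₁ l).sub (hsc j r₂ l)).sub (hsc j r₃ l)
  have hpw : ∀ (j : ℕ) (l : ℝ), 0 < l → HasDerivAt (fun l : ℝ => ((l : ℂ) ^ (j + 1))⁻¹)
      (-(j + 1) * ((l : ℂ) ^ (j + 2))⁻¹) l := by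
    intro j l hl
    have hlc : (l : ℂ) ≠ 0 := by exact_mod_cast hl.ne'
    have e := ((hasDerivAt_pow (j + 1) (l : ℂ)).comp_ofReal).inv (pow_ne_zero _ hlc)
    refine e.congr_deriv ?_
    push_cast
    field_simp
    ring
  have hbd : ∀ (j : ℕ) (l : ℝ), 0 < l → l ^ j * ‖D j l‖ ≤ 3 * C * (r₂ * r₃) * l ^ 1 := by
    intro j l hl
    have hm : ∀ {r : ℝ}, 0 ≤ r → 0 ≤ l * r := fun hr => mul_nonneg hl.le hr
    have hab : ∀ {r r' r'' : ℝ}, |r - r'| ≤ r'' → |l * r - l * r'| ≤ l * r'' := by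
      intro r r' r'' h
      rw [← mul_sub, abs_mul, abs_of_pos hl]
      gcongr
    have := norm_triple_le (h.hasDerivAt_gComb j) (fun s hs => h.norm_gComb'_le j hs)
      (h.gComb_zero j) h.nonneg (hm h1) (hm h2) (hm h3) (hab h12) (hab h13)
    simp only [hD]
    rw [norm_mul, norm_inv, norm_pow, norm_ofReal_of_nonneg hl.le]
    calc _ ≤ l ^ j * ((l ^ (j + 1))⁻¹ * (3 * C * ((l * r₂) * (l * r₃)))) := by gcongr
      _ = _ := by rw [pow_succ]; field_simp
  have hstep : ∀ l : ℝ, 0 < l → HasDerivAt (D 0) (D 1 l) l ∧ HasDerivAt (D 1) (D 2 l) l := by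
    intro l hl
    have hlc : (l : ℂ) ≠ 0 := by exact_mod_cast hl.ne'
    constructor
    · refine ((hpw 0 l hl).mul (hcomb 0 l)).congr_deriv ?_
      simp only [hD, gComb, gComb']
      push_cast
      field_simp
      ring
    · refine ((hpw 1 l hl).mul (hcomb 1 l)).congr_deriv ?_
      simp only [hD, gComb, gComb']
      push_cast
      field_simp
      ring
  refine ⟨D 1, D 2, fun l hm => ⟨?_, (hstep l hm.1).2, ?_, ?_, ?_, hbd 2 l hm.1⟩⟩
  · refine (hstep l hm.1).1.congr_of_eventuallyEq (Eventually.of_forall fun t => ?_)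
    simp [hD, gComb]
  · exact ((hpw 2 l hm.1).mul (hcomb 2 l)).continuousAt
  · have := hbd 0 l hm.1
    simpa [hD, gComb] using this
  · have := hbd 1 l hm.1
    simpa only [pow_one] using this

end pointwise

/-! ### Smooth paths of bounded continuous functions -/

section paths

variable {X : Type*} [TopologicalSpace X] {l₀ : ℝ}

/-- A path of bounded continuous functions is differentiable if it is so pointwise, with a
derivative that is continuous for the uniform norm. -/
theorem bcf_hasDerivAt {A A' : ℝ → BoundedContinuousFunction X ℂ} {l : ℝ}
    (h : ∀ᶠ t in 𝓝 l, ∀ x, HasDerivAt (fun t => A t x) (A' t x) t) (hc : ContinuousAt A' l) :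
    HasDerivAt A (A' l) l := by
  rw [hasDerivAt_iff_isLittleO, Asymptotics.isLittleO_iff]
  intro ε hε
  have h1 : ∀ᶠ t in 𝓝 l, ‖A' t - A' l‖ ≤ ε := by
    have := tendsto_iff_norm_sub_tendsto_zero.mp hc.tendsto
    exact this.eventually (ge_mem_nhds hε)
  obtain ⟨δ, hδ, hb⟩ := Metric.eventually_nhds_iff_ball.mp (h.and h1)
  filter_upwards [Metric.ball_mem_nhds l hδ] with t ht
  rw [BoundedContinuousFunction.norm_le (by positivity)]
  intro x
  have hd : ∀ s ∈ Metric.ball l δ, HasDerivWithinAt (fun s : ℝ => A s x - s • A' l x)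
      (A' s x - A' l x) (Metric.ball l δ) s := by
    intro s hs
    have e := ((hb s hs).1 x).sub ((hasDerivAt_id s).smul_const (A' l x))
    rw [one_smul] at e
    exact e.hasDerivWithinAt
  have := (convex_ball l δ).norm_image_sub_le_of_norm_hasDerivWithin_le hd
    (fun s hs => ((A' s - A' l).norm_coe_le_norm x).trans (hb s hs).2) (Metric.mem_ball_self hδ) ht
  refine le_trans (le_of_eq ?_) this
  simp only [BoundedContinuousFunction.coe_sub, BoundedContinuousFunction.coe_smul, Pi.sub_apply]
  congr 1
  rw [sub_smul]
  abel

/-- A path of bounded continuous functions whose pointwise derivatives are uniformly bounded is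
continuous for the uniform norm. -/
theorem bcf_continuousAt {A : ℝ → BoundedContinuousFunction X ℂ} {D : ℝ → X → ℂ} {l M : ℝ}
    (h : ∀ᶠ t in 𝓝 l, ∀ x, HasDerivAt (fun t => A t x) (D t x) t ∧ ‖D t x‖ ≤ M) (hM : 0 ≤ M) :
    ContinuousAt A l := by
  obtain ⟨δ, hδ, hb⟩ := Metric.eventually_nhds_iff_ball.mp h
  rw [ContinuousAt, tendsto_iff_norm_sub_tendsto_zero]
  have h0 : Tendsto (fun t : ℝ => M * ‖t - l‖) (𝓝 l) (𝓝 0) := by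
    have : Tendsto (fun t : ℝ => ‖t - l‖) (𝓝 l) (𝓝 0) :=
      tendsto_iff_norm_sub_tendsto_zero.mp tendsto_id
    simpa using this.const_mul M
  refine squeeze_zero' (Eventually.of_forall fun _ => norm_nonneg _) ?_ h0
  filter_upwards [Metric.ball_mem_nhds l hδ] with t ht
  rw [BoundedContinuousFunction.norm_le (by positivity)]
  intro x
  exact (convex_ball l δ).norm_image_sub_le_of_norm_hasDerivWithin_le
    (fun s hs => ((hb s hs x).1).hasDerivWithinAt) (fun s hs => (hb s hs x).2)
    (Metric.mem_ball_self hδ) ht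

/-- A path of bounded continuous functions with two pointwise derivatives that are bounded
continuous functions, and a third one that is bounded uniformly away from zero, is twice
continuously differentiable for the uniform norm. -/
theorem bcf_contDiffOn {A₀ A₁ A₂ : ℝ → BoundedContinuousFunction X ℂ} {D : ℝ → X → ℂ} {M : ℝ}
    (h0 : ∀ t ∈ Ioo 0 l₀, ∀ x, HasDerivAt (fun t => A₀ t x) (A₁ t x) t)
    (h1 : ∀ t ∈ Ioo 0 l₀, ∀ x, HasDerivAt (fun t => A₁ t x) (A₂ t x) t)
    (h2 : ∀ t ∈ Ioo 0 l₀, ∀ x, HasDerivAt (fun t => A₂ t x) (D t x) t)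
    (hD : ∀ t ∈ Ioo 0 l₀, ∀ x, ‖D t x‖ ≤ M / t) (hM : 0 ≤ M) :
    ContDiffOn ℝ 2 A₀ (Ioo 0 l₀) := by
  have hn : ∀ {l : ℝ}, l ∈ Ioo 0 l₀ → ∀ᶠ t in 𝓝 l, t ∈ Ioo 0 l₀ :=
    fun hm => isOpen_Ioo.mem_nhds hm
  have c2 : ∀ l ∈ Ioo 0 l₀, ContinuousAt A₂ l := by
    intro l hm
    have hl := hm.1
    refine bcf_continuousAt (D := D) (M := M / (l / 2)) ?_ (by positivity)
    filter_upwards [hn hm, lt_mem_nhds (half_lt_self hl)] with t ht ht2 x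
    refine ⟨h2 t ht x, (hD t ht x).trans ?_⟩
    gcongr
  have d1 : ∀ l ∈ Ioo 0 l₀, HasDerivAt A₁ (A₂ l) l := by
    intro l hm
    apply bcf_hasDerivAt _ (c2 l hm)
    filter_upwards [hn hm] with t ht using h1 t ht
  have d0 : ∀ l ∈ Ioo 0 l₀, HasDerivAt A₀ (A₁ l) l := by
    intro l hm
    apply bcf_hasDerivAt _ (d1 l hm).continuousAt
    filter_upwards [hn hm] with t ht using h0 t ht
  exact contDiffOn_two_iff.mpr ⟨A₁, A₂, fun l hm => ⟨d0 l hm, d1 l hm, c2 l hm⟩⟩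

end paths

/-! ### The weighted free kernel and its regular part -/

theorem sq_jb (x : E3) : jb x ^ 2 = 1 + ‖x‖ ^ 2 := Real.sq_sqrt (by positivity)

/-- The weight `⟨x⟩⁻²⟨y⟩⁻²`. -/
def jw (p : E3 × E3) : ℝ := (jb p.1 ^ 2)⁻¹ * (jb p.2 ^ 2)⁻¹

theorem jw_pos (p : E3 × E3) : 0 < jw p := by
  have := jb_pos p.1
  have := jb_pos p.2
  unfold jw
  positivity

theorem continuous_inv_sq_jb : Continuous fun x : E3 => (jb x ^ 2)⁻¹ :=
  (continuous_jb.pow 2).inv₀ fun x => (pow_pos (jb_pos x) 2).ne'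

theorem continuous_jw : Continuous jw :=
  (continuous_inv_sq_jb.comp continuous_fst).mul (continuous_inv_sq_jb.comp continuous_snd)

/-- The weight absorbs up to two factors `|x-y|`, that is, two derivatives in `λ` of `f(λ|x-y|)`. -/
theorem pow_mul_jw_le {j : ℕ} (hj : j ≤ 2) (p : E3 × E3) : ‖p.1 - p.2‖ ^ j * jw p ≤ 2 := by
  have hx := sq_jb p.1
  have hy := sq_jb p.2
  have h1 : 0 < jb p.1 ^ 2 := pow_pos (jb_pos _) 2
  have h2 : 0 < jb p.2 ^ 2 := pow_pos (jb_pos _) 2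
  have hr := norm_sub_le p.1 p.2
  have hr0 := norm_nonneg (p.1 - p.2)
  rw [jw, ← mul_inv, ← div_eq_mul_inv, div_le_iff₀ (by positivity), hx, hy]
  set r := ‖p.1 - p.2‖
  have h3 : r ^ 2 ≤ 2 * (‖p.1‖ ^ 2 + ‖p.2‖ ^ 2) := by
    have : r ^ 2 ≤ (‖p.1‖ + ‖p.2‖) ^ 2 := by gcongr
    nlinarith [sq_nonneg (‖p.1‖ - ‖p.2‖)]
  have h4 : 0 ≤ ‖p.1‖ ^ 2 * ‖p.2‖ ^ 2 := by positivity
  interval_cases j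
  · nlinarith [sq_nonneg ‖p.1‖, sq_nonneg ‖p.2‖]
  · nlinarith [sq_nonneg ‖p.1‖, sq_nonneg ‖p.2‖, sq_nonneg (r - 1)]
  · nlinarith

/-- The `j`-th derivative in `λ` of `f(λ|x-y|)`, weighted by `⟨x⟩⁻²⟨y⟩⁻²`. -/
def profPath (f : ℕ → ℝ → ℂ) (j : ℕ) (l : ℝ) : B2 :=
  mkB fun p => ((‖p.1 - p.2‖ ^ j * jw p : ℝ) : ℂ) * f j (l * ‖p.1 - p.2‖)

section

variable {a : ℂ} {f : ℕ → ℝ → ℂ} {C : ℝ}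

theorem IsProfile.profPath_apply (h : IsProfile a f C) {j : ℕ} (hj : j ≤ 2) {l : ℝ} (hl : 0 < l)
    (p : E3 × E3) :
    profPath f j l p = ((‖p.1 - p.2‖ ^ j * jw p : ℝ) : ℂ) * f j (l * ‖p.1 - p.2‖) := by
  have hc := h.continuous j
  have hw := continuous_jw
  refine mkB_apply (by fun_prop) (C := 2 * C) (fun p => ?_) p
  rw [norm_mul, norm_ofReal_of_nonneg (mul_nonneg (by positivity) (jw_pos p).le)]
  exact mul_le_mul (pow_mul_jw_le hj p) (h.bound j (by omega) _ (by positivity)) (norm_nonneg _)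
    (by norm_num)

/-- The weighted kernels `f(λ|x-y|)` form a twice continuously differentiable path for the uniform
norm. The third derivative has a factor `|x-y|³` that the weight does not absorb; one power is
paid for by the decay of the third derivative of `f`, at the price of a factor `λ⁻¹`. -/
theorem IsProfile.contDiffOn_profPath (h : IsProfile a f C) (l₀ : ℝ) :
    ContDiffOn ℝ 2 (profPath f 0) (Ioo 0 l₀) := by
  have hd : ∀ j ≤ 2, ∀ t ∈ Ioo 0 l₀, ∀ p : E3 × E3, HasDerivAt (fun t => profPath f j t p)
      (((‖p.1 - p.2‖ ^ (j + 1) * jw p : ℝ) : ℂ) * f (j + 1) (t * ‖p.1 - p.2‖)) t := by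
    intro j hj t ht p
    have e := (h.hasDerivAt_scale j ‖p.1 - p.2‖ t).const_mul
      ((‖p.1 - p.2‖ ^ j * jw p : ℝ) : ℂ)
    refine (e.congr_of_eventuallyEq ?_).congr_deriv ?_
    · filter_upwards [isOpen_Ioo.mem_nhds ht] with s hs using h.profPath_apply hj hs.1 p
    · push_cast
      ring
  have hD : ∀ t ∈ Ioo 0 l₀, ∀ p : E3 × E3,
      ‖((‖p.1 - p.2‖ ^ 3 * jw p : ℝ) : ℂ) * f 3 (t * ‖p.1 - p.2‖)‖ ≤ 2 * C / t := by
    intro t ht p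
    have e1 := pow_mul_jw_le le_rfl p
    have e2 := h.bound_mul 3 le_rfl (t * ‖p.1 - p.2‖) (mul_nonneg ht.1.le (norm_nonneg _))
    have hw := (jw_pos p).le
    have hr := norm_nonneg (p.1 - p.2)
    generalize ‖p.1 - p.2‖ = r at *
    rw [norm_mul, norm_ofReal_of_nonneg (mul_nonneg (pow_nonneg hr 3) hw), le_div_iff₀ ht.1]
    -- `|x-y|² jw` is bounded by the weight, `t |x-y| f₃(t|x-y|)` by the decay of the profile
    calc _ = (r ^ 2 * jw p) * (t * r * ‖f 3 (t * r)‖) := by ring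
      _ ≤ _ := mul_le_mul e1 e2 (mul_nonneg (mul_nonneg ht.1.le hr) (norm_nonneg _)) (by norm_num)
  have d0 : ∀ t ∈ Ioo 0 l₀, ∀ p, HasDerivAt (fun t => profPath f 0 t p) (profPath f 1 t p) t :=
    fun t ht p => (hd 0 (by norm_num) t ht p).congr_deriv
      (h.profPath_apply (j := 1) (by norm_num) ht.1 p).symm
  have d1 : ∀ t ∈ Ioo 0 l₀, ∀ p, HasDerivAt (fun t => profPath f 1 t p) (profPath f 2 t p) t :=
    fun t ht p => (hd 1 (by norm_num) t ht p).congr_deriv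
      (h.profPath_apply (j := 2) le_rfl ht.1 p).symm
  exact bcf_contDiffOn d0 d1 (hd 2 le_rfl) hD (mul_nonneg two_pos.le h.nonneg)

end

/-- Composition with a continuous map, as an operator `C_b(ℝ³) → C_b(ℝ³ × ℝ³)`. -/
def pullL (φ : C(E3 × E3, E3)) : B1 →L[ℂ] B2 :=
  LinearMap.mkContinuous
    { toFun := fun h => h.compContinuous φ
      map_add' := fun _ _ => rfl
      map_smul' := fun _ _ => rfl } 1 fun h => by
    rw [one_mul, BoundedContinuousFunction.norm_le (norm_nonneg _)]
    exact fun p => h.norm_coe_le_norm _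

@[simp] theorem pullL_apply (φ : C(E3 × E3, E3)) (h : B1) (p : E3 × E3) :
    pullL φ h p = h (φ p) := rfl

/-- The function `p_λ(x) = f(λ|x|) / f(0)`, weighted by `⟨x⟩⁻²`. -/
def hatP (a : ℂ) (f : ℕ → ℝ → ℂ) (l : ℝ) : B1 := a⁻¹ • sliceL 0 (profPath f 0 l)

/-- The regular part `λ⁻¹ (f(λ|x-y|) - f(λ|x|) f(λ|y|) / f(0))` of the free resolvent kernel,
weighted by `⟨x⟩⁻²⟨y⟩⁻²`. -/
def hatK (a : ℂ) (f : ℕ → ℝ → ℂ) (l : ℝ) : B2 :=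
  (l : ℂ)⁻¹ • (profPath f 0 l - a⁻¹ • (pullL ContinuousMap.fst (sliceL 0 (profPath f 0 l)) *
    pullL ContinuousMap.snd (sliceL 0 (profPath f 0 l))))

/-- The limit `-(|x-y| - |x| - |y|) / (8π)` of the regular part of the free resolvent kernel. -/
def regKer (x y : E3) : ℂ := (((‖x‖ + ‖y‖ - ‖x - y‖) / (8 * Real.pi) : ℝ) : ℂ)

/-- `regKer`, weighted by `⟨x⟩⁻²⟨y⟩⁻²`. -/
def hatK₀ : B2 := mkB fun p => (jw p : ℂ) * regKer p.1 p.2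

/-- The weight `⟨x⟩⁻²`. -/
def hatP₀ : B1 := mkB fun x => (((jb x ^ 2)⁻¹ : ℝ) : ℂ)

theorem norm_regKer_le (x y : E3) : ‖regKer x y‖ ≤ jb x * jb y := by
  have h1 : ‖x‖ + ‖y‖ - ‖x - y‖ ≤ 2 * jb y := by
    have := norm_sub_norm_le x y
    linarith [norm_le_jb y]
  have h0 : 0 ≤ ‖x‖ + ‖y‖ - ‖x - y‖ := by linarith [norm_sub_le x y]
  have hpi := Real.pi_gt_three
  rw [regKer, norm_ofReal_of_nonneg (by positivity), div_le_iff₀ (by positivity)]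
  have h2 : jb y ≤ jb x * jb y := le_mul_of_one_le_left (jb_pos y).le (one_le_jb x)
  have h3 : 0 < jb x * jb y := mul_pos (jb_pos x) (jb_pos y)
  nlinarith

theorem jb_div_sq_le (x : E3) : (jb x ^ 2)⁻¹ * jb x ≤ 1 := by
  have h := one_le_jb x
  have h0 := jb_pos x
  rw [inv_mul_le_iff₀ (by positivity)]
  nlinarith

theorem jw_mul_le (x y : E3) : jw (x, y) * (jb x * jb y) ≤ 1 := by
  have h1 := jb_div_sq_le x
  have h2 := jb_div_sq_le y
  have := jb_pos x
  have := jb_pos y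
  calc jw (x, y) * (jb x * jb y) = ((jb x ^ 2)⁻¹ * jb x) * ((jb y ^ 2)⁻¹ * jb y) := by
        simp only [jw]; ring
    _ ≤ 1 * 1 := by gcongr
    _ = 1 := one_mul 1

theorem norm_jw_mul_le (x y : E3) : ‖(jw (x, y) : ℂ) * regKer x y‖ ≤ 1 := by
  rw [norm_mul, norm_ofReal_of_nonneg (jw_pos _).le]
  exact (mul_le_mul_of_nonneg_left (norm_regKer_le x y) (jw_pos _).le).trans (jw_mul_le x y)

theorem hatK₀_apply (x y : E3) : hatK₀ (x, y) = (jw (x, y) : ℂ) * regKer x y := by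
  have hw := continuous_jw
  refine mkB_apply (h := fun p : E3 × E3 => (jw p : ℂ) * regKer p.1 p.2) ?_ (C := 1)
    (fun p => norm_jw_mul_le p.1 p.2) (x, y)
  unfold regKer
  fun_prop

theorem inv_sq_jb_le (x : E3) : (jb x ^ 2)⁻¹ ≤ 1 :=
  inv_le_one_of_one_le₀ (one_le_pow₀ (one_le_jb x))

theorem inv_sq_jb_pos (x : E3) : 0 < (jb x ^ 2)⁻¹ := inv_pos.mpr (pow_pos (jb_pos x) 2)

theorem hatP₀_apply (x : E3) : hatP₀ x = (((jb x ^ 2)⁻¹ : ℝ) : ℂ) := by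
  have hw := continuous_inv_sq_jb
  refine mkB_apply (by fun_prop) (C := 1) (fun x => ?_) x
  rw [norm_ofReal_of_nonneg (inv_sq_jb_pos x).le]
  exact inv_sq_jb_le x

section

variable {a : ℂ} {f : ℕ → ℝ → ℂ} {C : ℝ}

theorem IsProfile.slice_profPath_apply (h : IsProfile a f C) {l : ℝ} (hl : 0 < l) (x : E3) :
    sliceL 0 (profPath f 0 l) x = (((jb x ^ 2)⁻¹ : ℝ) : ℂ) * f 0 (l * ‖x‖) := by
  rw [sliceL_apply, h.profPath_apply (by norm_num) hl]
  simp [jw, jb]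

/-- The function `p_λ(x) = f(λ|x|) / f(0)`. -/
def regP (a : ℂ) (f : ℕ → ℝ → ℂ) (l : ℝ) (x : E3) : ℂ := a⁻¹ * f 0 (l * ‖x‖)

/-- The regular part `λ⁻¹ (f(λ|x-y|) - f(λ|x|) f(λ|y|) / f(0))` of the free resolvent kernel. -/
def regF (a : ℂ) (f : ℕ → ℝ → ℂ) (l : ℝ) (x y : E3) : ℂ :=
  (l : ℂ)⁻¹ * (f 0 (l * ‖x - y‖) - a⁻¹ * (f 0 (l * ‖x‖) * f 0 (l * ‖y‖)))

theorem IsProfile.hatP_apply (h : IsProfile a f C) {l : ℝ} (hl : 0 < l) (x : E3) :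
    hatP a f l x = (((jb x ^ 2)⁻¹ : ℝ) : ℂ) * regP a f l x := by
  rw [hatP, BoundedContinuousFunction.smul_apply, h.slice_profPath_apply hl, smul_eq_mul, regP]
  ring

theorem IsProfile.hatK_apply (h : IsProfile a f C) {l : ℝ} (hl : 0 < l) (x y : E3) :
    hatK a f l (x, y) = (jw (x, y) : ℂ) * regF a f l x y := by
  rw [hatK, BoundedContinuousFunction.smul_apply, BoundedContinuousFunction.sub_apply,
    BoundedContinuousFunction.smul_apply, BoundedContinuousFunction.mul_apply, pullL_apply,
    pullL_apply, h.profPath_apply (by norm_num) hl]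
  simp only [ContinuousMap.fst_apply, ContinuousMap.snd_apply, h.slice_profPath_apply hl,
    smul_eq_mul, regF, jw, pow_zero, one_mul]
  push_cast
  ring

theorem IsProfile.contDiffOn_hatP (h : IsProfile a f C) (l₀ : ℝ) :
    ContDiffOn ℝ 2 (hatP a f) (Ioo 0 l₀) :=
  ((a⁻¹ • sliceL 0 : B2 →L[ℂ] B1).restrictScalars ℝ).contDiff.comp_contDiffOn
    (h.contDiffOn_profPath l₀)

theorem contDiffOn_ofReal_inv (l₀ : ℝ) :
    ContDiffOn ℝ 2 (fun l : ℝ => (l : ℂ)⁻¹) (Ioo 0 l₀) :=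
  (Complex.ofRealCLM.contDiff.contDiffOn).inv fun l hl => by simpa using hl.1.ne'

theorem IsProfile.contDiffOn_hatK (h : IsProfile a f C) (l₀ : ℝ) :
    ContDiffOn ℝ 2 (hatK a f) (Ioo 0 l₀) := by
  have h0 := h.contDiffOn_profPath l₀
  have h1 : ∀ φ : C(E3 × E3, E3), ContDiffOn ℝ 2
      (fun l => pullL φ (sliceL 0 (profPath f 0 l))) (Ioo 0 l₀) := fun φ =>
    (((pullL φ).comp (sliceL 0)).restrictScalars ℝ).contDiff.comp_contDiffOn h0
  have h2 : ContDiffOn ℝ 2 (fun l => a⁻¹ • (pullL ContinuousMap.fst (sliceL 0 (profPath f 0 l)) *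
      pullL ContinuousMap.snd (sliceL 0 (profPath f 0 l)))) (Ioo 0 l₀) :=
    ((a⁻¹ • ContinuousLinearMap.id ℂ B2).restrictScalars ℝ).contDiff.comp_contDiffOn
      ((h1 ContinuousMap.fst).mul (h1 ContinuousMap.snd))
  exact (contDiffOn_ofReal_inv l₀).smul (h0.sub h2)

end

/-! ### Functions with a limit at zero energy -/

section SymLim

variable {Y Z W : Type*} [NormedAddCommGroup Y] [NormedSpace ℝ Y] [NormedAddCommGroup Z]
  [NormedSpace ℝ Z] [NormedAddCommGroup W] [NormedSpace ℝ W]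

/-- `A = A₀ + O₂(λ)` on `(0, l₀)`, where `C` bounds both `A₀` and the error term. -/
def SymLim (l₀ C : ℝ) (A : ℝ → Y) (A₀ : Y) : Prop :=
  SymBd l₀ 1 C (fun l => A l - A₀) ∧ ‖A₀‖ ≤ C

theorem SymLim.mono {l₀ l₁ C C' : ℝ} {A : ℝ → Y} {A₀ : Y} (h : SymLim l₀ C A A₀) (hC : C ≤ C')
    (hl : l₁ ≤ l₀) : SymLim l₁ C' A A₀ := ⟨h.1.mono hC hl, h.2.trans hC⟩

theorem SymLim.add {l₀ C C' : ℝ} {A B : ℝ → Y} {A₀ B₀ : Y} (hA : SymLim l₀ C A A₀)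
    (hB : SymLim l₀ C' B B₀) : SymLim l₀ (C + C') (fun l => A l + B l) (A₀ + B₀) :=
  ⟨(hA.1.add hB.1).congr fun _ _ => (add_sub_add_comm _ _ _ _).symm,
    (norm_add_le _ _).trans (add_le_add hA.2 hB.2)⟩

theorem symLim_const {l₀ C : ℝ} {A₀ : Y} (h : ‖A₀‖ ≤ C) : SymLim l₀ C (fun _ => A₀) A₀ :=
  ⟨(symBd_smul_const (c := (0 : Y)) (by simpa using (norm_nonneg _).trans h)).congr
    fun l _ => by simp, h⟩

theorem SymLim.clm {l₀ C : ℝ} {A : ℝ → Y} {A₀ : Y} (hA : SymLim l₀ C A A₀) (L : Y →L[ℝ] Z) {M : ℝ}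
    (hL : ‖L‖ ≤ M) : SymLim l₀ (M * C) (fun l => L (A l)) (L A₀) :=
  ⟨(hA.1.clm L hL).congr fun _ _ => map_sub L _ _, (L.le_of_opNorm_le hL _).trans
    (mul_le_mul_of_nonneg_left hA.2 ((norm_nonneg _).trans hL))⟩

/-- The product rule for functions with a limit at zero energy. -/
theorem SymLim.bilin {l₀ C C' : ℝ} {A : ℝ → Y} {A₀ : Y} {B : ℝ → Z} {B₀ : Z}
    (hA : SymLim l₀ C A A₀) (hB : SymLim l₀ C' B B₀) (L : Y →L[ℝ] Z →L[ℝ] W) {M : ℝ}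
    (hL : ‖L‖ ≤ M) (hl : l₀ ≤ 1) :
    SymLim l₀ (12 * M * C * C') (fun l => L (A l) (B l)) (L A₀ B₀) := by
  have hM : 0 ≤ M := L.opNorm_nonneg.trans hL
  have hC : 0 ≤ C := (norm_nonneg _).trans hA.2
  have hC' : 0 ≤ C' := (norm_nonneg _).trans hB.2
  have hK : 0 ≤ M * C * C' := by positivity
  constructor
  · have h1 := (hA.1.bilin hB.1 L hL).lower hl
    have h2 := hA.1.bilin (symBd_const (l₀ := l₀) hB.2) L hL
    have h3 := (symBd_const (l₀ := l₀) hA.2).bilin hB.1 L hL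
    refine (((h1.add h2).add h3).congr fun l _ => ?_).mono (by linarith) le_rfl
    simp only [map_sub, sub_apply]
    abel
  · calc ‖L A₀ B₀‖ ≤ ‖L‖ * ‖A₀‖ * ‖B₀‖ := L.le_opNorm₂ _ _
      _ ≤ M * C * C' := by
        gcongr
        · exact hA.2
        · exact hB.2
      _ ≤ _ := by linarith

end SymLim

theorem SymLim.clmApply {Y Z : Type*} [NormedAddCommGroup Y] [NormedSpace ℂ Y]
    [NormedAddCommGroup Z] [NormedSpace ℂ Z] {l₀ C C' : ℝ} {A : ℝ → (Y →L[ℂ] Z)} {A₀ : Y →L[ℂ] Z}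
    {B : ℝ → Y} {B₀ : Y} (hA : SymLim l₀ C A A₀) (hB : SymLim l₀ C' B B₀) (hl : l₀ ≤ 1) :
    SymLim l₀ (12 * C * C') (fun l => A l (B l)) (A₀ B₀) := by
  have := hA.bilin hB (ContinuousLinearMap.restrictScalarsL ℂ Y Z ℝ ℝ) (M := 1) ?_ hl
  · simpa using this
  · refine ContinuousLinearMap.opNorm_le_bound _ zero_le_one fun T => ?_
    rw [one_mul]
    exact le_of_eq (ContinuousLinearMap.norm_restrictScalars T)

theorem SymBd.const_mul {l₀ C M : ℝ} {n : ℕ} {A : ℝ → ℂ} (hA : SymBd l₀ n C A) (c : ℂ)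
    (hc : ‖c‖ ≤ M) : SymBd l₀ n (M * C) fun l => c * A l :=
  hA.clm (ContinuousLinearMap.mul ℝ ℂ c) ((ContinuousLinearMap.opNorm_mul_apply_le ℝ ℂ c).trans hc)

/-! ### The low-energy limit of the free resolvent kernel -/

section

variable {a : ℂ} {f : ℕ → ℝ → ℂ} {C : ℝ}

/-- `p_λ(x) = 1 + O₂(λ⟨x⟩)`. -/
theorem IsProfile.symLim_regP (h : IsProfile a f C) :
    ∃ K, 0 ≤ K ∧ ∀ x, SymLim 1 (K * jb x) (fun l => regP a f l x) 1 := by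
  have hC := h.nonneg
  refine ⟨20 * C * ‖a⁻¹‖ + 1, by positivity, fun x => ⟨?_, ?_⟩⟩
  · have h1 := h.symBd_quot (norm_nonneg x) 1
    have h2 := (symBd_smul_const (l₀ := 1) (le_refl ‖a⁻¹‖)).bilin h1 (ContinuousLinearMap.mul ℝ ℂ)
      (ContinuousLinearMap.opNorm_mul_le ℝ ℂ)
    refine (h2.congr fun l hl => ?_).mono ?_ le_rfl
    · have hl0 : (l : ℂ) ≠ 0 := by exact_mod_cast hl.1.ne'
      have ha := h.ne_zero
      simp only [ContinuousLinearMap.mul_apply', Complex.real_smul, regP]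
      field_simp
    · have := norm_le_jb x
      have : 20 * C * ‖a⁻¹‖ * ‖x‖ ≤ 20 * C * ‖a⁻¹‖ * jb x := by gcongr
      linarith [jb_pos x]
  · rw [norm_one]
    have := one_le_jb x
    have : 0 ≤ 20 * C * ‖a⁻¹‖ * jb x := by have := jb_pos x; positivity
    linarith

/-- `F_λ(x,y) = (|x| + |y| - |x-y|) / (8π) + O₂(λ⟨x⟩⟨y⟩)`. The error consists of the second
difference of the reduced profile and of the product of the difference quotients at `x` and `y`.
-/
theorem IsProfile.symLim_regF (h : IsProfile a f C) :
    ∃ K, 0 ≤ K ∧ ∀ x y, SymLim 1 (K * (jb x * jb y)) (fun l => regF a f l x y) (regKer x y) := by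
  have hC := h.nonneg
  refine ⟨3 * C + 4 * 1 * ‖a⁻¹‖ * (4 * 1 * 5 * C * (5 * C)) + 1, by positivity, fun x y => ?_⟩
  have hx := norm_le_jb x
  have hy := norm_le_jb y
  have hx0 := jb_pos x
  have hy0 := jb_pos y
  have hxy : ‖x‖ * ‖y‖ ≤ jb x * jb y := by gcongr
  constructor
  · have h1 := h.symBd_triple (norm_nonneg (x - y)) (norm_nonneg x) (norm_nonneg y)
      (by
        refine (abs_norm_sub_norm_le _ _).trans_eq ?_
        rw [sub_sub_cancel_left, norm_neg])
      (by
        rw [← norm_neg y]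
        refine (abs_norm_sub_norm_le _ _).trans_eq ?_
        rw [sub_neg_eq_add, sub_add_cancel]) 1
    have h2 := (h.symBd_quot (norm_nonneg x) 1).bilin (h.symBd_quot (norm_nonneg y) 1)
      (ContinuousLinearMap.mul ℝ ℂ) (ContinuousLinearMap.opNorm_mul_le ℝ ℂ)
    have h3 := (symBd_smul_const (l₀ := 1) (le_refl ‖a⁻¹‖)).bilin h2 (ContinuousLinearMap.mul ℝ ℂ)
      (ContinuousLinearMap.opNorm_mul_le ℝ ℂ)
    refine ((h1.sub h3).congr fun l hl => ?_).mono ?_ le_rfl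
    · have hl0 : (l : ℂ) ≠ 0 := by exact_mod_cast hl.1.ne'
      have ha := h.ne_zero
      simp only [ContinuousLinearMap.mul_apply', Complex.real_smul, regF, regKer, gProf]
      push_cast
      field_simp
      ring
    · have e : 3 * C * (‖x‖ * ‖y‖) + 4 * 1 * ‖a⁻¹‖ * (4 * 1 * (5 * C * ‖x‖) * (5 * C * ‖y‖)) =
        (3 * C + 4 * 1 * ‖a⁻¹‖ * (4 * 1 * 5 * C * (5 * C))) * (‖x‖ * ‖y‖) := by ring
      rw [e]
      refine mul_le_mul ?_ hxy (by positivity) (by positivity)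
      linarith
  · refine (norm_regKer_le x y).trans (le_mul_of_one_le_left (by positivity) ?_)
    have : 0 ≤ 3 * C + 4 * 1 * ‖a⁻¹‖ * (4 * 1 * 5 * C * (5 * C)) := by positivity
    linarith

theorem norm_hatP₀_le : ‖hatP₀‖ ≤ 1 := by
  rw [BoundedContinuousFunction.norm_le zero_le_one]
  intro x
  rw [hatP₀_apply, norm_ofReal_of_nonneg (inv_sq_jb_pos x).le]
  exact inv_sq_jb_le x

theorem norm_hatK₀_le : ‖hatK₀‖ ≤ 1 := by
  rw [BoundedContinuousFunction.norm_le zero_le_one]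
  rintro ⟨x, y⟩
  rw [hatK₀_apply]
  exact norm_jw_mul_le x y

/-- The expansion of the weighted `p_λ` in the uniform norm. -/
theorem IsProfile.symLim_hatP (h : IsProfile a f C) : ∃ K, SymLim 1 K (hatP a f) hatP₀ := by
  obtain ⟨K, hK0, hK⟩ := h.symLim_regP
  refine ⟨K + 1, ?_, norm_hatP₀_le.trans (by linarith)⟩
  apply symBd_of_pointwise ((h.contDiffOn_hatP 1).sub contDiffOn_const)
  intro x
  have h1 := (hK x).1.const_mul (((jb x ^ 2)⁻¹ : ℝ) : ℂ) le_rfl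
  refine (h1.congr fun l hl => ?_).mono ?_ le_rfl
  · rw [BoundedContinuousFunction.sub_apply, h.hatP_apply hl.1, hatP₀_apply]
    ring
  · rw [norm_ofReal_of_nonneg (inv_sq_jb_pos x).le]
    have := mul_le_mul_of_nonneg_left (jb_div_sq_le x) hK0
    linarith

/-- The expansion of the weighted regular part in the uniform norm. -/
theorem IsProfile.symLim_hatK (h : IsProfile a f C) : ∃ K, SymLim 1 K (hatK a f) hatK₀ := by
  obtain ⟨K, hK0, hK⟩ := h.symLim_regF
  refine ⟨K + 1, ?_, norm_hatK₀_le.trans (by linarith)⟩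
  apply symBd_of_pointwise ((h.contDiffOn_hatK 1).sub contDiffOn_const)
  rintro ⟨x, y⟩
  have h1 := (hK x y).1.const_mul (jw (x, y) : ℂ) le_rfl
  refine (h1.congr fun l hl => ?_).mono ?_ le_rfl
  · rw [BoundedContinuousFunction.sub_apply, h.hatK_apply hl.1, hatK₀_apply]
    ring
  · rw [norm_ofReal_of_nonneg (jw_pos _).le]
    have := mul_le_mul_of_nonneg_left (jw_mul_le x y) hK0
    linarith

/-- The slice `κ(y, ·)` of a weighted kernel, with the weight in `y` removed. -/
def unwt (y : E3) : B2 →L[ℂ] B1 := ((jb y ^ 2 : ℝ) : ℂ) • sliceL y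

theorem unwt_apply (y : E3) (κ : B2) (x : E3) :
    unwt y κ x = ((jb y ^ 2 : ℝ) : ℂ) * κ (y, x) := rfl

theorem sq_mul_jw_left (x y : E3) : jb y ^ 2 * jw (y, x) = (jb x ^ 2)⁻¹ := by
  rw [jw, mul_inv_cancel_left₀ (pow_pos (jb_pos y) 2).ne']

/-- With the weight removed in one variable, the expansion of the regular part holds in the
uniform norm of the other variable, with a constant of size `⟨y⟩`. -/
theorem IsProfile.symLim_unwt (h : IsProfile a f C) :
    ∃ K, 0 ≤ K ∧ ∀ y, SymLim 1 (K * jb y) (fun l => unwt y (hatK a f l)) (unwt y hatK₀) := by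
  obtain ⟨K, hK0, hK⟩ := h.symLim_regF
  refine ⟨K, hK0, fun y => ?_⟩
  have hy := jb_pos y
  have hb : ∀ x, (jb x ^ 2)⁻¹ * (K * (jb y * jb x)) ≤ K * jb y := by
    intro x
    have := mul_le_mul_of_nonneg_left (jb_div_sq_le x) (mul_nonneg hK0 hy.le)
    linarith
  have hw : ∀ (x : E3) (z : ℂ), ((jb y ^ 2 : ℝ) : ℂ) * ((jw (y, x) : ℂ) * z) =
      (((jb x ^ 2)⁻¹ : ℝ) : ℂ) * z := by
    intro x z
    rw [← mul_assoc, ← Complex.ofReal_mul, sq_mul_jw_left]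
  constructor
  · have hd : ContDiffOn ℝ 2 (fun l => unwt y (hatK a f l)) (Ioo 0 1) :=
      ((unwt y).restrictScalars ℝ).contDiff.comp_contDiffOn (h.contDiffOn_hatK 1)
    apply symBd_of_pointwise (hd.sub contDiffOn_const)
    intro x
    have h1 := (hK y x).1.const_mul (((jb x ^ 2)⁻¹ : ℝ) : ℂ) le_rfl
    refine (h1.congr fun l hl => ?_).mono ?_ le_rfl
    · rw [BoundedContinuousFunction.sub_apply, unwt_apply, unwt_apply,
        h.hatK_apply hl.1, hatK₀_apply, hw, hw]
      ring
    · rw [norm_ofReal_of_nonneg (inv_sq_jb_pos x).le]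
      exact hb x
  · rw [BoundedContinuousFunction.norm_le (by positivity)]
    intro x
    rw [unwt_apply, hatK₀_apply, hw, norm_mul, norm_ofReal_of_nonneg (inv_sq_jb_pos x).le]
    exact (mul_le_mul_of_nonneg_left (hK y x).2 (inv_sq_jb_pos x).le).trans (hb x)

end

/-! ### The bordered operator -/

/-- The weight `w = ⟨·⟩² |V|^{1/2}`. -/
def wC (V : E3 → ℝ) (x : E3) : ℂ := vC V x * ((jb x ^ 2 : ℝ) : ℂ)

section schur

variable {H : Type*} [NormedAddCommGroup H] [NormedSpace ℂ H]

/-- The operator `(φ, c) ↦ (T φ + c g, m φ + d c)` on `H × ℂ`. -/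
def bord (T : H →L[ℂ] H) (g : H) (m : H →L[ℂ] ℂ) (d : ℂ) : H × ℂ →L[ℂ] H × ℂ :=
  (T.comp (ContinuousLinearMap.fst ℂ H ℂ) +
    (ContinuousLinearMap.snd ℂ H ℂ).smulRight g).prod
  (m.comp (ContinuousLinearMap.fst ℂ H ℂ) + d • ContinuousLinearMap.snd ℂ H ℂ)

theorem bord_apply (T : H →L[ℂ] H) (g : H) (m : H →L[ℂ] ℂ) (d : ℂ) (p : H × ℂ) :
    bord T g m d p = (T p.1 + p.2 • g, m p.1 + d * p.2) := rfl

variable {T M : H →L[ℂ] H} {g : H} {m : H →L[ℂ] ℂ} {α : ℂ}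

/-- Solving with the bordered operator solves with its Schur complement `M = T + α g ⊗ m`. -/
theorem schur_of_bord (hα : α ≠ 0) (hM : ∀ φ, M φ = T φ + (α * m φ) • g) {X : H × ℂ} {b : H}
    {d : ℂ} (hX : bord T (-g) m α⁻¹ X = (b, d)) : M X.1 = b + (α * d) • g := by
  rw [bord_apply, Prod.mk.injEq] at hX
  rw [hM, ← hX.1, ← hX.2, mul_add, mul_inv_cancel_left₀ hα, add_smul, smul_neg]
  abel

/-- The Schur complement of an invertible bordered operator is invertible. -/
theorem isUnit_schur [CompleteSpace H] (hα : α ≠ 0) (hM : ∀ φ, M φ = T φ + (α * m φ) • g)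
    (hS : IsUnit (bord T (-g) m α⁻¹)) : IsUnit M := by
  rw [ContinuousLinearMap.isUnit_iff_bijective] at hS ⊢
  constructor
  · rw [injective_iff_map_eq_zero]
    intro φ hφ
    have h1 : bord T (-g) m α⁻¹ (φ, -(α * m φ)) = 0 := by
      rw [bord_apply, Prod.mk_eq_zero]
      constructor
      · rw [← hφ, hM, smul_neg, neg_smul, neg_neg]
      · simp only
        field_simp
        ring
    exact congrArg Prod.fst ((injective_iff_map_eq_zero _).mp hS.1 _ h1)
  · intro b
    obtain ⟨X, hX⟩ := hS.2 (b, 0)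
    refine ⟨X.1, ?_⟩
    rw [schur_of_bord hα hM hX, mul_zero, zero_smul, add_zero]

/-- The solution of the bordered system with right-hand side `(b, d)`: its first component is
`M⁻¹` of `b + α d g`, and its second component follows from the second equation. -/
theorem inverse_schur [CompleteSpace H] (hα : α ≠ 0) (hM : ∀ φ, M φ = T φ + (α * m φ) • g)
    (hS : IsUnit (bord T (-g) m α⁻¹)) (b : H) (d : ℂ) :
    Ring.inverse M (b + (α * d) • g) = (Ring.inverse (bord T (-g) m α⁻¹) (b, d)).1 ∧
      m (Ring.inverse (bord T (-g) m α⁻¹) (b, d)).1 +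
        α⁻¹ * (Ring.inverse (bord T (-g) m α⁻¹) (b, d)).2 = d := by
  have h1 : bord T (-g) m α⁻¹ (Ring.inverse (bord T (-g) m α⁻¹) (b, d)) = (b, d) := by
    rw [← mul_apply_eq_comp, Ring.mul_inverse_cancel _ hS,
      one_apply_eq_self]
  refine ⟨?_, congrArg Prod.snd h1⟩
  rw [← schur_of_bord hα hM h1, ← mul_apply_eq_comp,
    Ring.inverse_mul_cancel _ (isUnit_schur hα hM hS), one_apply_eq_self]

/-- The inverse of the Schur complement `M`, paired with `ℓ + α q m`, in terms of the inverse of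
the bordered operator. -/
theorem pairing_schur [CompleteSpace H] (hα : α ≠ 0) (hM : ∀ φ, M φ = T φ + (α * m φ) • g)
    {S : H × ℂ →L[ℂ] H × ℂ} (hST : S = bord T (-g) m α⁻¹) (hS : IsUnit S) (b : H) (d q : ℂ)
    (ℓ : H →L[ℂ] ℂ) :
    (ℓ + (α * q) • m) (Ring.inverse M (b + (α * d) • g)) =
      ℓ (Ring.inverse S (b, d)).1 - q * (Ring.inverse S (b, d)).2 + α * q * d := by
  rw [hST] at hS ⊢
  obtain ⟨h1, h2⟩ := inverse_schur hα hM hS b d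
  rw [h1, add_apply, smul_apply, smul_eq_mul, eq_sub_iff_add_eq.mpr h2]
  field_simp
  ring

variable {B : Type*} [NormedAddCommGroup B] [NormedSpace ℂ B]

/-- The functional `(φ, c) ↦ L h φ - p c`, for `θ = (h, p)`. -/
def evL (L : B →L[ℂ] H →L[ℂ] ℂ) : B × ℂ →L[ℂ] H × ℂ →L[ℂ] ℂ :=
  (((ContinuousLinearMap.compL ℂ (H × ℂ) H ℂ).flip (ContinuousLinearMap.fst ℂ H ℂ)).comp
    L).comp (ContinuousLinearMap.fst ℂ B ℂ) -
  (ContinuousLinearMap.snd ℂ B ℂ).smulRight (ContinuousLinearMap.snd ℂ H ℂ)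

theorem evL_apply (L : B →L[ℂ] H →L[ℂ] ℂ) (θ : B × ℂ) (X : H × ℂ) :
    evL L θ X = L θ.1 X.1 - θ.2 * X.2 := rfl

/-- The vector `(L h, p)`, for `θ = (h, p)`. -/
def srcL (L : B →L[ℂ] H) : B × ℂ →L[ℂ] H × ℂ := L.prodMap (ContinuousLinearMap.id ℂ ℂ)

theorem srcL_apply (L : B →L[ℂ] H) (θ : B × ℂ) : srcL L θ = (L θ.1, θ.2) := rfl

end schur

section

variable {V : E3 → ℝ} (hV : Measurable V) (hv : MemLp (vC V) 2 (volume : Measure E3))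
  (hw : MemLp (wC V) 2 (volume : Measure E3))

/-- The weight `⟨·⟩²` may be moved from the function to `v`. -/
theorem vecL_unweight {h h' : B1} (hh : ∀ x, h x = ((jb x ^ 2 : ℝ) : ℂ) * h' x) :
    vecL (vC V) hv h = vecL (wC V) hw h' := by
  apply Lp.ext
  filter_upwards [vecL_ae _ hv h, vecL_ae _ hw h'] with x h1 h2
  rw [h1, h2, hh, wC]
  ring

theorem pairL_unweight {h h' : B1} (hh : ∀ x, h x = ((jb x ^ 2 : ℝ) : ℂ) * h' x) (ψ : L2) :
    pairL (vC V) hv h ψ = pairL (wC V) hw h' ψ := by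
  rw [pairL_apply, pairL_apply]
  congr 1
  ext x
  rw [hh, wC]
  ring

/-- A kernel that is a rank-one kernel plus a regular part gives the corresponding sum of
operators. -/
theorem opL_unweight {κ κ' : B2} {p : B1} {α : ℂ}
    (h : ∀ x y, κ (x, y) = ((jb x ^ 2 * jb y ^ 2 : ℝ) : ℂ) * (κ' (x, y) + α * (p x * p y)))
    (φ : L2) : opL (vC V) hv κ φ =
      opL (wC V) hw κ' φ + (α * pairL (wC V) hw p φ) • vecL (wC V) hw p := by
  apply Lp.ext
  filter_upwards [opL_ae _ hv κ φ, opL_ae _ hw κ' φ, vecL_ae _ hw p,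
    Lp.coeFn_add (opL (wC V) hw κ' φ) ((α * pairL (wC V) hw p φ) • vecL (wC V) hw p),
    Lp.coeFn_smul (α * pairL (wC V) hw p φ) (vecL (wC V) hw p)] with x h1 h2 h3 h4 h5
  rw [h4, Pi.add_apply, h5, Pi.smul_apply, h1, h2, h3, smul_eq_mul, pairL_apply]
  have e : ∀ y, κ (x, y) * (vC V y * φ y) = ((jb x ^ 2 : ℝ) : ℂ) *
      (sliceL x κ' y * (wC V y * φ y) + α * p x * (p y * (wC V y * φ y))) := by
    intro y
    rw [h, sliceL_apply, wC]
    push_cast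
    ring
  simp only [e]
  rw [integral_const_mul, integral_add (integrable_bcf_mul _ hw _ φ)
    ((integrable_bcf_mul _ hw p φ).const_mul _), integral_const_mul, wC]
  simp only [sliceL_apply]
  ring

/-- The bordered operator whose Schur complement is `U + v κ v`, for
`κ = ⟨x⟩²⟨y⟩² (κ' + d⁻¹ p ⊗ p)`. -/
def bordOp (κ' : B2) (p : B1) (d : ℂ) : L2 × ℂ →L[ℂ] L2 × ℂ :=
  bord (sgnL hV + opL (wC V) hw κ') (-vecL (wC V) hw p) (pairL (wC V) hw p) d

/-- When the free kernel is a rank-one kernel plus a regular part, `U + v κ v` is a Schur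
complement. -/
theorem birman_eq {κ κ' : B2} {p : B1} {α : ℂ}
    (h : ∀ x y, κ (x, y) = ((jb x ^ 2 * jb y ^ 2 : ℝ) : ℂ) * (κ' (x, y) + α * (p x * p y)))
    (φ : L2) : birman hV hv κ φ = (sgnL hV + opL (wC V) hw κ') φ +
      (α * pairL (wC V) hw p φ) • vecL (wC V) hw p := by
  rw [birman, add_apply, add_apply, opL_unweight hv hw h, add_assoc]

/-- The resolvent kernel in terms of the inverse `N` of the bordered operator; for `N` the inverse
at zero energy this is the leading term `C₀` of the expansion. -/
def bordKer (κ' : B2) (p : B1) (N : L2 × ℂ →L[ℂ] L2 × ℂ) (x y : E3) : ℂ :=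
  ((jb x ^ 2 * jb y ^ 2 : ℝ) : ℂ) * κ' (x, y) -
    evL (pairL (wC V) hw) (unwt x κ', ((jb x ^ 2 : ℝ) : ℂ) * p x)
      (N (srcL (vecL (wC V) hw) (unwt y κ', ((jb y ^ 2 : ℝ) : ℂ) * p y)))

theorem isUnit_birman_of_bordOp {κ κ' : B2} {p : B1} {α : ℂ} (hα : α ≠ 0)
    (h : ∀ x y, κ (x, y) = ((jb x ^ 2 * jb y ^ 2 : ℝ) : ℂ) * (κ' (x, y) + α * (p x * p y)))
    (hS : IsUnit (bordOp hV hw κ' p α⁻¹)) : IsUnit (birman hV hv κ) :=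
  isUnit_schur hα (birman_eq hV hv hw h) hS

set_option maxHeartbeats 800000 in
/-- The resolvent kernel in terms of the inverse of the bordered operator; the terms containing
the large factor `α` cancel. -/
theorem resKer_eq_bordKer {κ κ' : B2} {p : B1} {α : ℂ} (hα : α ≠ 0)
    (h : ∀ x y, κ (x, y) = ((jb x ^ 2 * jb y ^ 2 : ℝ) : ℂ) * (κ' (x, y) + α * (p x * p y)))
    (hS : IsUnit (bordOp hV hw κ' p α⁻¹)) (x y : E3) :
    resKer hV hv κ x y = bordKer hw κ' p (Ring.inverse (bordOp hV hw κ' p α⁻¹)) x y := by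
  set q : E3 → ℂ := fun y => ((jb y ^ 2 : ℝ) : ℂ) * p y with hq
  have hsl : ∀ x z, sliceL x κ z = ((jb z ^ 2 : ℝ) : ℂ) * (unwt x κ' + (α * q x) • p) z := by
    intro x z
    rw [sliceL_apply, h, BoundedContinuousFunction.add_apply, BoundedContinuousFunction.smul_apply,
      unwt_apply, hq, smul_eq_mul]
    push_cast
    ring
  have hb : vecL (vC V) hv (sliceL y κ) =
      vecL (wC V) hw (unwt y κ') + (α * q y) • vecL (wC V) hw p := by
    rw [vecL_unweight hv hw (hsl y), map_add, map_smul]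
  have hl : pairL (vC V) hv (sliceL x κ) =
      pairL (wC V) hw (unwt x κ') + (α * q x) • pairL (wC V) hw p := by
    ext ψ
    rw [pairL_unweight hv hw (hsl x), map_add, map_smul]
  have key := pairing_schur (S := bordOp hV hw κ' p α⁻¹)
    (T := sgnL hV + opL (wC V) hw κ') (M := birman hV hv κ)
    (g := vecL (wC V) hw p) (m := pairL (wC V) hw p) hα (birman_eq hV hv hw h) rfl hS
    (vecL (wC V) hw (unwt y κ')) (q y) (q x) (pairL (wC V) hw (unwt x κ'))
  rw [resKer, hb, hl, key, bordKer, evL_apply, srcL_apply, h]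
  simp only [hq]
  push_cast
  ring

end

/-! ### Invertibility of the bordered operator at zero energy -/

/-- If the compression of `T` to the kernel of `m` along `g` is bijective, the operator `T`
bordered by `g` and `m` is invertible. -/
theorem isUnit_bord_zero {H : Type*} [NormedAddCommGroup H] [NormedSpace ℂ H] [CompleteSpace H]
    {T : H →L[ℂ] H} {g : H} {m : H →L[ℂ] ℂ} (hn : m g ≠ 0)
    (hT : ∀ f, m f = 0 → ∃! ψ, m ψ = 0 ∧ T ψ - (m (T ψ) / m g) • g = f) :
    IsUnit (bord T (-g) m 0) := by
  rw [ContinuousLinearMap.isUnit_iff_bijective]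
  have hg : g ≠ 0 := by
    rintro rfl
    simp at hn
  constructor
  · rw [injective_iff_map_eq_zero]
    rintro ⟨φ, c⟩ h
    rw [bord_apply, Prod.mk_eq_zero] at h
    simp only [zero_mul, add_zero, smul_neg, ← sub_eq_add_neg, sub_eq_zero] at h
    obtain ⟨h1, h2⟩ := h
    have h3 : T φ - (m (T φ) / m g) • g = 0 := by
      rw [h1, map_smul, smul_eq_mul, mul_div_cancel_right₀ _ hn, sub_self]
    have h4 : φ = 0 := (hT 0 (map_zero m)).unique ⟨h2, h3⟩ ⟨map_zero m, by simp⟩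
    rw [h4, map_zero] at h1
    rw [h4, Prod.mk_eq_zero]
    exact ⟨rfl, (smul_eq_zero.mp h1.symm).resolve_right hg⟩
  · rintro ⟨b, d⟩
    -- `φ₁` takes care of the second component; the rest is solved in the kernel of `m`
    set φ₁ := (d / m g) • g with hφ₁
    set b' := b - T φ₁ with hb'
    obtain ⟨ψ, ⟨h1, h2⟩, -⟩ := hT (b' - (m b' / m g) • g) (by
      rw [map_sub, map_smul, smul_eq_mul, div_mul_cancel₀ _ hn, sub_self])
    refine ⟨(φ₁ + ψ, m (T ψ) / m g - m b' / m g), ?_⟩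
    rw [bord_apply, Prod.mk.injEq]
    constructor
    · have : T ψ = b' - (m b' / m g) • g + (m (T ψ) / m g) • g := by rw [← h2, sub_add_cancel]
      simp only
      rw [map_add, smul_neg, sub_smul]
      nth_rewrite 1 [this]
      rw [hb']
      abel
    · simp only [zero_mul, add_zero, map_add, h1, hφ₁, map_smul, smul_eq_mul]
      exact div_mul_cancel₀ _ hn

section

variable {V : E3 → ℝ} (hV : Measurable V) (hv : MemLp (vC V) 2 (volume : Measure E3))
  (hw : MemLp (wC V) 2 (volume : Measure E3))

theorem inv_sq_mul_wC (x : E3) : (((jb x ^ 2)⁻¹ : ℝ) : ℂ) * wC V x = vC V x := by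
  have : ((jb x : ℝ) : ℂ) ≠ 0 := by exact_mod_cast (jb_pos x).ne'
  rw [wC]
  push_cast
  field_simp

theorem vecL_hatP₀ : vecL (wC V) hw hatP₀ =ᵐ[volume] vC V := by
  filter_upwards [vecL_ae (wC V) hw hatP₀] with x hx
  rw [hx, hatP₀_apply, mul_comm, inv_sq_mul_wC]

theorem pairL_hatP₀ (ψ : L2) : pairL (wC V) hw hatP₀ ψ = ∫ y, ψ y * (sqrtAbs V y : ℂ) := by
  rw [pairL_apply]
  congr 1
  ext y
  rw [hatP₀_apply, ← mul_assoc, inv_sq_mul_wC, vC, mul_comm]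

theorem vC_mul_self (x : E3) : vC V x * vC V x = ((|V x| : ℝ) : ℂ) := by
  rw [vC, ← Complex.ofReal_mul, sqrtAbs, Real.mul_self_sqrt (abs_nonneg _)]

theorem pairL_vecL_hatP₀ :
    pairL (wC V) hw hatP₀ (vecL (wC V) hw hatP₀) = ((∫ y, |V y| : ℝ) : ℂ) := by
  rw [pairL_hatP₀, ← integral_complex_ofReal]
  apply integral_congr_ae
  filter_upwards [vecL_hatP₀ hw] with x hx
  rw [hx]
  exact vC_mul_self x

include hv in
theorem integral_abs_ne_zero (hne : ¬ ∀ᵐ x ∂(volume : Measure E3), V x = 0) :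
    ∫ y, |V y| ≠ 0 := by
  have hi : Integrable (fun x => |V x|) volume := by
    refine ((memLp_two_iff_integrable_sq_norm hv.1).mp hv).congr (Eventually.of_forall fun x => ?_)
    simp only
    rw [pow_two, ← norm_mul, vC_mul_self, norm_ofReal_of_nonneg (abs_nonneg _)]
  intro h
  rw [integral_eq_zero_iff_of_nonneg (fun x => abs_nonneg _) hi] at h
  apply hne
  filter_upwards [h] with x hx
  simpa using hx

theorem opQ_apply (ψ : E3 → ℂ) (x : E3) :
    opQ V ψ x = ψ x - vC V x * (∫ y, ψ y * (sqrtAbs V y : ℂ)) / ((∫ y, |V y| : ℝ) : ℂ) := rfl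

include hv in
/-- `Q L²` is the orthogonal complement of `v`. That `Q ψ = ψ` forces `⟨ψ, v⟩ = 0` uses `v ≠ 0`. -/
theorem mem_QL2_iff (hne : ¬ ∀ᵐ x ∂(volume : Measure E3), V x = 0) (ψ : L2) :
    ψ ∈ QL2 V ↔ pairL (wC V) hw hatP₀ ψ = 0 := by
  have hn : ((∫ y, |V y| : ℝ) : ℂ) ≠ 0 := by exact_mod_cast integral_abs_ne_zero hv hne
  rw [pairL_hatP₀]
  constructor
  · intro h
    by_contra h0
    apply hne
    have h : opQ V ψ =ᵐ[volume] ψ := h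
    filter_upwards [h] with x hx
    rw [opQ_apply, sub_eq_self, div_eq_zero_iff, mul_eq_zero] at hx
    have h1 : vC V x = 0 := (hx.resolve_right hn).resolve_right h0
    have h2 := vC_mul_self (V := V) x
    rw [h1, mul_zero] at h2
    exact abs_eq_zero.mp (by exact_mod_cast h2.symm)
  · intro h
    change opQ V ψ =ᵐ[volume] ψ
    refine Eventually.of_forall fun x => ?_
    rw [opQ_apply, h, mul_zero, zero_div, sub_zero]

include hv in
/-- On the orthogonal complement of `v`, the kernels `G₀` and `regKer` give the same operator up
to a multiple of `v`. -/
theorem opT_ae {ψ : L2} (h : pairL (wC V) hw hatP₀ ψ = 0) :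
    ∃ b : ℂ, opT V ψ =ᵐ[volume]
      ((sgnL hV + opL (wC V) hw hatK₀) ψ - b • vecL (wC V) hw hatP₀ : L2) := by
  rw [pairL_hatP₀] at h
  have hpi : (Real.pi : ℂ) ≠ 0 := by exact_mod_cast Real.pi_ne_zero
  have i1 : Integrable (fun y => vC V y * ψ y) volume := integrable_weight_mul _ hv ψ
  have i2 : Integrable (fun y => ((‖y‖ / (8 * Real.pi) : ℝ) : ℂ) * (vC V y * ψ y)) volume := by
    refine ((integrable_weight_mul _ hw ψ).norm).mono' ?_ (Eventually.of_forall fun y => ?_)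
    · have : Continuous fun y : E3 => ((‖y‖ / (8 * Real.pi) : ℝ) : ℂ) := by fun_prop
      exact this.aestronglyMeasurable.mul i1.1
    · rw [wC, norm_mul, norm_mul (vC V y * _), norm_mul (vC V y) (((jb y ^ 2 : ℝ)) : ℂ), norm_mul,
        norm_ofReal_of_nonneg (by positivity), norm_ofReal_of_nonneg (by positivity)]
      have h1 : ‖y‖ / (8 * Real.pi) ≤ jb y ^ 2 := by
        have h2 := norm_le_jb y
        have h3 := one_le_jb y
        have h4 := Real.pi_gt_three
        rw [div_le_iff₀ (by positivity)]
        nlinarith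
      calc _ ≤ jb y ^ 2 * (‖vC V y‖ * ‖ψ y‖) := by gcongr
        _ = _ := by ring
  have hvi : ∫ y, vC V y * ψ y = 0 := by
    rw [← h]
    congr 1
    ext y
    rw [vC, mul_comm]
  refine ⟨∫ y, ((‖y‖ / (8 * Real.pi) : ℝ) : ℂ) * (vC V y * ψ y), ?_⟩
  set b := ∫ y, ((‖y‖ / (8 * Real.pi) : ℝ) : ℂ) * (vC V y * ψ y)
  rw [add_apply]
  filter_upwards [Lp.coeFn_sub (sgnL hV ψ + opL (wC V) hw hatK₀ ψ) (b • vecL (wC V) hw hatP₀),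
    Lp.coeFn_add (sgnL hV ψ) (opL (wC V) hw hatK₀ ψ), Lp.coeFn_smul b (vecL (wC V) hw hatP₀),
    vecL_hatP₀ hw, sgnL_ae hV ψ, opL_ae _ hw hatK₀ ψ] with x e1 e2 e3 e4 e5 e6
  rw [e1, Pi.sub_apply, e2, Pi.add_apply, e3, Pi.smul_apply, e4, e5, e6, opT, smul_eq_mul]
  have i3 := (integrable_bcf_mul _ hw (sliceL x hatK₀) ψ).const_mul ((jb x ^ 2 : ℝ) : ℂ)
  have i4 : Integrable (fun y => ((jb x ^ 2 : ℝ) : ℂ) * (sliceL x hatK₀ y * (wC V y * ψ y)) -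
      ((‖x‖ / (8 * Real.pi) : ℝ) : ℂ) * (vC V y * ψ y)) volume := i3.sub (i1.const_mul _)
  have e7 : ∀ y, (G0 x y : ℂ) * (sqrtAbs V y : ℂ) * ψ y =
      ((jb x ^ 2 : ℝ) : ℂ) * (sliceL x hatK₀ y * (wC V y * ψ y)) -
        ((‖x‖ / (8 * Real.pi) : ℝ) : ℂ) * (vC V y * ψ y) -
        ((‖y‖ / (8 * Real.pi) : ℝ) : ℂ) * (vC V y * ψ y) := by
    intro y
    have hx0 : ((jb x : ℝ) : ℂ) ≠ 0 := by exact_mod_cast (jb_pos x).ne'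
    have hy0 : ((jb y : ℝ) : ℂ) ≠ 0 := by exact_mod_cast (jb_pos y).ne'
    rw [sliceL_apply, hatK₀_apply, jw, regKer, G0, wC, vC]
    push_cast
    field_simp
    ring
  have e8 : ∫ y, (G0 x y : ℂ) * (sqrtAbs V y : ℂ) * ψ y =
      ((jb x ^ 2 : ℝ) : ℂ) * (∫ y, hatK₀ (x, y) * (wC V y * ψ y)) - b := by
    simp only [e7]
    rw [integral_sub i4 i2, integral_sub i3 (i1.const_mul _),
      integral_const_mul, integral_const_mul, hvi, mul_zero, sub_zero]
    rfl
  rw [e8, wC, vC]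
  ring

include hv in
set_option maxHeartbeats 800000 in
/-- On the orthogonal complement of `v`, the operator `Q T Q` is the compression of `U + w hatK₀
w`: the multiple of `v` by which the two differ is annihilated by `Q`. -/
theorem opQ_opT_ae (hne : ¬ ∀ᵐ x ∂(volume : Measure E3), V x = 0) {ψ : L2}
    (h : pairL (wC V) hw hatP₀ ψ = 0) {T : L2 →L[ℂ] L2} (hT : T = sgnL hV + opL (wC V) hw hatK₀)
    {m : L2 →L[ℂ] ℂ} (hm : m = pairL (wC V) hw hatP₀) {g : L2} (hg : g = vecL (wC V) hw hatP₀) :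
    opQ V (opT V (opQ V ψ)) =ᵐ[volume] (T ψ - (m (T ψ) / m g) • g : L2) := by
  have hn : ((∫ y, |V y| : ℝ) : ℂ) ≠ 0 := by exact_mod_cast integral_abs_ne_zero hv hne
  have h1 : opQ V ψ = ψ := by
    ext x
    rw [opQ_apply, ← pairL_hatP₀ hw, h, mul_zero, zero_div, sub_zero]
  obtain ⟨b, hb⟩ := opT_ae hV hv hw h
  rw [← hT, ← hg] at hb
  have hmg : m g = ((∫ y, |V y| : ℝ) : ℂ) := by rw [hm, hg, pairL_vecL_hatP₀]
  have h2 : ∫ y, opT V ψ y * (sqrtAbs V y : ℂ) = m (T ψ) - b * m g := by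
    rw [← smul_eq_mul b, ← map_smul, ← map_sub, hm, pairL_hatP₀]
    apply integral_congr_ae
    filter_upwards [hb] with y hy
    rw [hy]
  have hgv : g =ᵐ[volume] vC V := by rw [hg]; exact vecL_hatP₀ hw
  rw [h1]
  filter_upwards [hb, hgv, Lp.coeFn_sub (T ψ) (b • g), Lp.coeFn_smul b g,
    Lp.coeFn_sub (T ψ) ((m (T ψ) / m g) • g), Lp.coeFn_smul (m (T ψ) / m g) g]
    with x e1 e2 e3 e4 e5 e6
  rw [opQ_apply, h2, e1, e3, e5, Pi.sub_apply, Pi.sub_apply, e4, e6, Pi.smul_apply, Pi.smul_apply,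
    e2, smul_eq_mul, smul_eq_mul, ← hmg]
  rw [← hmg] at hn
  field_simp
  ring

include hv in
/-- If zero is a regular point, the bordered operator at zero energy is invertible. -/
theorem isUnit_bordOp_zero (hne : ¬ ∀ᵐ x ∂(volume : Measure E3), V x = 0)
    (hreg : ZeroIsRegular V) : IsUnit (bordOp hV hw hatK₀ hatP₀ 0) := by
  have hn : ((∫ y, |V y| : ℝ) : ℂ) ≠ 0 := by exact_mod_cast integral_abs_ne_zero hv hne
  refine isUnit_bord_zero (by rw [pairL_vecL_hatP₀]; exact hn) fun f hf => ?_
  have hiff : ∀ ψ : L2, (ψ ∈ QL2 V ∧ opQ V (opT V (opQ V ψ)) =ᵐ[volume] f) ↔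
      (pairL (wC V) hw hatP₀ ψ = 0 ∧ (sgnL hV + opL (wC V) hw hatK₀) ψ -
        (pairL (wC V) hw hatP₀ ((sgnL hV + opL (wC V) hw hatK₀) ψ) /
          pairL (wC V) hw hatP₀ (vecL (wC V) hw hatP₀)) • vecL (wC V) hw hatP₀ = f) := by
    intro ψ
    rw [mem_QL2_iff hv hw hne]
    refine and_congr_right fun h => ?_
    have := opQ_opT_ae hV hv hw hne h rfl rfl rfl
    rw [Lp.ext_iff]
    exact ⟨fun h' => this.symm.trans h', fun h' => this.trans h'⟩
  simpa only [hiff] using hreg f ((mem_QL2_iff hv hw hne f).mpr hf)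

end

/-! ### Expansion of the resolvent kernel -/

theorem SymLim.congr {Y : Type*} [NormedAddCommGroup Y] [NormedSpace ℝ Y] {l₀ C : ℝ} {A B : ℝ → Y}
    {A₀ : Y} (h : SymLim l₀ C A A₀) (hAB : ∀ l ∈ Ioo 0 l₀, A l = B l) : SymLim l₀ C B A₀ :=
  ⟨h.1.congr fun l hl => by rw [hAB l hl], h.2⟩

theorem SymLim.prodMk {Y Z : Type*} [NormedAddCommGroup Y] [NormedSpace ℝ Y]
    [NormedAddCommGroup Z] [NormedSpace ℝ Z] {l₀ C C' : ℝ} {A : ℝ → Y} {B : ℝ → Z} {A₀ : Y} {B₀ : Z}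
    (hA : SymLim l₀ C A A₀) (hB : SymLim l₀ C' B B₀) :
    SymLim l₀ (1 * C + 1 * C') (fun l => (A l, B l)) (A₀, B₀) := by
  simpa using (hA.clm (ContinuousLinearMap.inl ℝ Y Z)
    (ContinuousLinearMap.norm_inl_le_one ℝ Y Z)).add
    (hB.clm (ContinuousLinearMap.inr ℝ Y Z) (ContinuousLinearMap.norm_inr_le_one ℝ Y Z))

/-- A bordered operator has a limit at zero energy if its entries do. -/
theorem symLim_bord {H : Type*} [NormedAddCommGroup H] [NormedSpace ℂ H] {T : ℝ → H →L[ℂ] H}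
    {g : ℝ → H} {m : ℝ → H →L[ℂ] ℂ} {d : ℝ → ℂ} {T₀ : H →L[ℂ] H} {g₀ : H} {m₀ : H →L[ℂ] ℂ} {d₀ : ℂ}
    {l₀ C₁ C₂ C₃ C₄ : ℝ} (hT : SymLim l₀ C₁ T T₀) (hg : SymLim l₀ C₂ g g₀)
    (hm : SymLim l₀ C₃ m m₀) (hd : SymLim l₀ C₄ d d₀) :
    ∃ C, SymLim l₀ C (fun l => bord (T l) (g l) (m l) (d l)) (bord T₀ g₀ m₀ d₀) := by
  set b₁ := (ContinuousLinearMap.compL ℂ (H × ℂ) H (H × ℂ) (ContinuousLinearMap.inl ℂ H ℂ)).comp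
    ((ContinuousLinearMap.compL ℂ (H × ℂ) H H).flip (ContinuousLinearMap.fst ℂ H ℂ)) with hb₁
  set b₂ := (ContinuousLinearMap.compL ℂ (H × ℂ) H (H × ℂ) (ContinuousLinearMap.inl ℂ H ℂ)).comp
    (ContinuousLinearMap.smulRightL ℂ (H × ℂ) H (ContinuousLinearMap.snd ℂ H ℂ)) with hb₂
  set b₃ := (ContinuousLinearMap.compL ℂ (H × ℂ) ℂ (H × ℂ) (ContinuousLinearMap.inr ℂ H ℂ)).comp
    ((ContinuousLinearMap.compL ℂ (H × ℂ) H ℂ).flip (ContinuousLinearMap.fst ℂ H ℂ)) with hb₃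
  set b₄ := (ContinuousLinearMap.id ℂ ℂ).smulRight
    ((ContinuousLinearMap.inr ℂ H ℂ).comp (ContinuousLinearMap.snd ℂ H ℂ)) with hb₄
  have key : ∀ (T : H →L[ℂ] H) (g : H) (m : H →L[ℂ] ℂ) (d : ℂ),
      bord T g m d = b₁ T + b₂ g + (b₃ m + b₄ d) := by
    intro T g m d
    apply ContinuousLinearMap.ext
    rintro ⟨φ, c⟩
    rw [bord_apply]
    simp [hb₁, hb₂, hb₃, hb₄]
  simp only [key]
  exact ⟨_, ((hT.clm (b₁.restrictScalars ℝ) le_rfl).add (hg.clm (b₂.restrictScalars ℝ) le_rfl)).add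
    ((hm.clm (b₃.restrictScalars ℝ) le_rfl).add (hd.clm (b₄.restrictScalars ℝ) le_rfl))⟩

/-- Matrix elements of the form that gives the resolvent kernel have a limit if their constituents
do, with a constant that is the product of the three constants. This is how the factors `⟨x⟩` and
`⟨y⟩` of the two sources end up in the error bound. -/
theorem symLim_evL {H B : Type*} [NormedAddCommGroup H] [NormedSpace ℂ H] [NormedAddCommGroup B]
    [NormedSpace ℂ B] (L : B →L[ℂ] H →L[ℂ] ℂ) (L' : B →L[ℂ] H) :
    ∃ M, 0 ≤ M ∧ ∀ (l₀ C₁ C₂ C₃ : ℝ) (θ θ' : ℝ → B × ℂ) (θ₀ θ₀' : B × ℂ)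
      (N : ℝ → H × ℂ →L[ℂ] H × ℂ) (N₀ : H × ℂ →L[ℂ] H × ℂ), l₀ ≤ 1 → SymLim l₀ C₁ θ θ₀ →
      SymLim l₀ C₂ N N₀ → SymLim l₀ C₃ θ' θ₀' →
      SymLim l₀ (M * C₁ * C₂ * C₃) (fun l => evL L (θ l) (N l (srcL L' (θ' l))))
        (evL L θ₀ (N₀ (srcL L' θ₀'))) := by
  refine ⟨144 * ‖(evL L).restrictScalars ℝ‖ * ‖(srcL L').restrictScalars ℝ‖, by positivity, ?_⟩
  intro l₀ C₁ C₂ C₃ θ θ' θ₀ θ₀' N N₀ hl h1 h2 h3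
  have e1 := h1.clm ((evL L).restrictScalars ℝ) le_rfl
  have e3 := h3.clm ((srcL L').restrictScalars ℝ) le_rfl
  exact (e1.clmApply (h2.clmApply e3 hl) hl).mono (le_of_eq (by ring)) le_rfl

section

variable {V : E3 → ℝ} (hV : Measurable V) (hv : MemLp (vC V) 2 (volume : Measure E3))
  (hw : MemLp (wC V) 2 (volume : Measure E3)) {a : ℂ} {f : ℕ → ℝ → ℂ} {C : ℝ}

theorem sq_jb_mul_inv (x : E3) (z : ℂ) :
    ((jb x ^ 2 : ℝ) : ℂ) * ((((jb x ^ 2)⁻¹ : ℝ) : ℂ) * z) = z := by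
  have : ((jb x : ℝ) : ℂ) ≠ 0 := by exact_mod_cast (jb_pos x).ne'
  push_cast
  field_simp

theorem sq_mul_sq_mul_jw (x y : E3) (z : ℂ) :
    ((jb x ^ 2 * jb y ^ 2 : ℝ) : ℂ) * ((jw (x, y) : ℂ) * z) = z := by
  have : ((jb x : ℝ) : ℂ) ≠ 0 := by exact_mod_cast (jb_pos x).ne'
  have : ((jb y : ℝ) : ℂ) ≠ 0 := by exact_mod_cast (jb_pos y).ne'
  rw [jw]
  push_cast
  field_simp

/-- The free resolvent kernel is a rank-one kernel of size `λ⁻¹` plus a regular part. -/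
theorem IsProfile.profKer_decomp (h : IsProfile a f C) {l : ℝ} (hl : 0 < l) (x y : E3) :
    profKer f l (x, y) = ((jb x ^ 2 * jb y ^ 2 : ℝ) : ℂ) *
      (hatK a f l (x, y) + a / l * (hatP a f l x * hatP a f l y)) := by
  have hl0 : (l : ℂ) ≠ 0 := by exact_mod_cast hl.ne'
  have ha := h.ne_zero
  have hp : hatP a f l x * hatP a f l y = (jw (x, y) : ℂ) * (regP a f l x * regP a f l y) := by
    rw [h.hatP_apply hl, h.hatP_apply hl, jw]
    push_cast
    ring
  rw [h.hatK_apply hl, hp, h.profKer_apply hl, mul_left_comm (a / l : ℂ), ← mul_add,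
    sq_mul_sq_mul_jw, regF, regP, regP]
  field_simp
  ring

/-- The limit of the bordered operator at zero energy does not depend on the profile. -/
theorem IsProfile.symLim_bordOp (h : IsProfile a f C) :
    ∃ K, SymLim 1 K (fun l : ℝ => bordOp hV hw (hatK a f l) (hatP a f l) (a / l)⁻¹)
      (bordOp hV hw hatK₀ hatP₀ 0) := by
  obtain ⟨K₁, h1⟩ := h.symLim_hatK
  obtain ⟨K₂, h2⟩ := h.symLim_hatP
  have hd : SymLim 1 ‖a⁻¹‖ (fun l : ℝ => (a / l : ℂ)⁻¹) 0 := by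
    refine ⟨(symBd_smul_const (le_refl ‖a⁻¹‖)).congr fun l _ => ?_, by simp⟩
    simp only
    rw [Complex.real_smul, inv_div, sub_zero, div_eq_mul_inv]
  exact symLim_bord
    ((symLim_const (le_refl ‖sgnL hV‖)).add (h1.clm ((opL (wC V) hw).restrictScalars ℝ) le_rfl))
    (h2.clm ((-vecL (wC V) hw).restrictScalars ℝ) le_rfl)
    (h2.clm ((pairL (wC V) hw).restrictScalars ℝ) le_rfl) hd

/-- The pair `(⟨y⟩² κ(y, ·), ⟨y⟩² p(y))` on which the inverse of the bordered operator acts has a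
limit, with a constant of size `⟨y⟩`. -/
theorem IsProfile.symLim_source (h : IsProfile a f C) :
    ∃ K, 0 ≤ K ∧ ∀ y, SymLim 1 (K * jb y)
      (fun l => (unwt y (hatK a f l), ((jb y ^ 2 : ℝ) : ℂ) * hatP a f l y))
      (unwt y hatK₀, ((jb y ^ 2 : ℝ) : ℂ) * hatP₀ y) := by
  obtain ⟨K₁, h1, hK₁⟩ := h.symLim_unwt
  obtain ⟨K₂, h2, hK₂⟩ := h.symLim_regP
  refine ⟨K₁ + K₂, add_nonneg h1 h2, fun y => ?_⟩
  have e : ((jb y ^ 2 : ℝ) : ℂ) * hatP₀ y = 1 := by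
    rw [hatP₀_apply, ← mul_one (((jb y ^ 2)⁻¹ : ℝ) : ℂ), sq_jb_mul_inv]
  rw [e]
  refine ((hK₁ y).prodMk ((hK₂ y).congr fun l hl => ?_)).mono (le_of_eq (by ring)) le_rfl
  rw [h.hatP_apply hl.1, sq_jb_mul_inv]

set_option maxHeartbeats 1000000 in
/-- The expansion `R_V(λ⁴) = C₀ + O₂(λ⟨x⟩⟨y⟩)`, for either choice of sign. -/
theorem IsProfile.resKer_expansion (h : IsProfile a f C)
    (hS : IsUnit (bordOp hV hw hatK₀ hatP₀ 0)) :
    ∃ l₁ K, 0 < l₁ ∧ (∀ l ∈ Ioo 0 l₁, IsUnit (birman hV hv (profKer f l))) ∧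
      ∀ x y, SymBd l₁ 1 (K * (jb x * jb y)) fun l => resKer hV hv (profKer f l) x y -
        bordKer hw hatK₀ hatP₀ (Ring.inverse (bordOp hV hw hatK₀ hatP₀ 0)) x y := by
  obtain ⟨K₁, hK₁⟩ := h.symLim_bordOp hV hw
  obtain ⟨l₁, K₂, hl₁, -, hl₁', hunit, hinv⟩ := hK₁.1.ringInverse one_pos hS
  obtain ⟨K₃, hK₃, h3⟩ := h.symLim_source
  obtain ⟨K₄, hK₄, h4⟩ := h.symLim_regF
  obtain ⟨M, hM, hev⟩ := symLim_evL (pairL (wC V) hw) (vecL (wC V) hw)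
  set N₀ := Ring.inverse (bordOp hV hw hatK₀ hatP₀ 0) with hN₀
  have hN : SymLim l₁ (K₂ + ‖N₀‖) (fun l : ℝ =>
      Ring.inverse (bordOp hV hw (hatK a f l) (hatP a f l) (a / l)⁻¹)) N₀ :=
    ⟨hinv.mono (le_add_of_nonneg_right (norm_nonneg _)) le_rfl,
      le_add_of_nonneg_left (hinv.nonneg hl₁)⟩
  have hα : ∀ l ∈ Ioo 0 l₁, (a / l : ℂ) ≠ 0 := fun l hl =>
    div_ne_zero h.ne_zero (by exact_mod_cast hl.1.ne')
  refine ⟨l₁, K₄ + M * K₃ * (K₂ + ‖N₀‖) * K₃, hl₁, fun l hl =>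
    isUnit_birman_of_bordOp hV hv hw (hα l hl) (h.profKer_decomp hl.1) (hunit l hl), fun x y => ?_⟩
  have e1 := (h4 x y).mono le_rfl hl₁'
  have e2 := hev l₁ _ _ _ _ _ _ _ _ _ hl₁' ((h3 x).mono le_rfl hl₁') hN ((h3 y).mono le_rfl hl₁')
  refine ((e1.1.sub e2.1).congr fun l hl => ?_).mono (le_of_eq (by ring)) le_rfl
  rw [resKer_eq_bordKer hV hv hw (hα l hl) (h.profKer_decomp hl.1) (hunit l hl), bordKer, bordKer,
    h.hatK_apply hl.1, hatK₀_apply, sq_mul_sq_mul_jw, sq_mul_sq_mul_jw]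
  abel

end

/-! ### Decay of the potential -/

section

variable {V : E3 → ℝ} {C β : ℝ}

/-- `⟨·⟩ⁿ |V|^{1/2} ∈ L²` when `|V| ≤ C⟨·⟩^{-β}` with `β > 2n + 3`. -/
theorem memLp_weight (hV : Measurable V) (hC : ∀ x, |V x| ≤ C * jb x ^ (-β)) {n : ℕ}
    (hβ : 2 * n + 3 < β) :
    MemLp (fun x => vC V x * ((jb x ^ n : ℝ) : ℂ)) 2 (volume : Measure E3) := by
  have hm : AEStronglyMeasurable (fun x => vC V x * ((jb x ^ n : ℝ) : ℂ))
      (volume : Measure E3) :=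
    ((Complex.measurable_ofReal.comp (measurable_sqrtAbs hV)).mul (Complex.measurable_ofReal.comp
      ((continuous_jb.pow n).measurable))).aestronglyMeasurable
  rw [memLp_two_iff_integrable_sq_norm hm]
  refine ((integrable_jb_rpow (r := 2 * n - β) (by linarith)).const_mul C).mono'
    (hm.norm.pow 2) (Eventually.of_forall fun x => ?_)
  have hx := jb_pos x
  rw [Real.norm_of_nonneg (by positivity), norm_mul, mul_pow, pow_two ‖vC V x‖, ← norm_mul,
    vC_mul_self, norm_ofReal_of_nonneg (abs_nonneg _), norm_ofReal_of_nonneg (by positivity)]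
  calc |V x| * (jb x ^ n) ^ 2 ≤ C * jb x ^ (-β) * (jb x ^ n) ^ 2 := by gcongr; exact hC x
    _ = _ := by
      rw [mul_assoc, ← pow_mul, ← Real.rpow_natCast (jb x) (n * 2), ← Real.rpow_add hx]
      congr 2
      push_cast
      ring

theorem bounded_of_decay (hC : ∀ x, |V x| ≤ C * jb x ^ (-β)) (hβ : 0 ≤ β) (x : E3) :
    |V x| ≤ C := by
  have hx := one_le_jb x
  have h1 : jb x ^ (-β) ≤ 1 := Real.rpow_le_one_of_one_le_of_nonpos hx (by linarith)
  have h2 : 0 < jb x ^ (-β) := Real.rpow_pos_of_pos (jb_pos x) _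
  have h0 : 0 ≤ C := nonneg_of_mul_nonneg_left ((abs_nonneg _).trans (hC x)) h2
  exact (hC x).trans (mul_le_of_le_one_right h0 h1)

end

end FourthOrder

end

open FourthOrder in
theorem proposition3p1
    (V : FourthOrder.E3 → ℝ) (hVmeas : Measurable V)
    (hVne : ¬ (∀ᵐ x ∂(volume : Measure FourthOrder.E3), V x = 0))
    (β : ℝ) (hβ : 7 < β)
    (hVdecay : ∃ C : ℝ, ∀ x, |V x| ≤ C * FourthOrder.jb x ^ (-β))
    (hreg : FourthOrder.ZeroIsRegular V) :
    ∃ lam0 : ℝ, 0 < lam0 ∧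
    ∃ (C0 : FourthOrder.E3 → FourthOrder.E3 → ℂ)
      (Kp Km : ℝ → FourthOrder.E3 → FourthOrder.E3 → ℂ),
      (∀ lam ∈ Ioo 0 lam0, FourthOrder.IsLimitingKernel V 1 lam (Kp lam)) ∧
      (∀ lam ∈ Ioo 0 lam0, FourthOrder.IsLimitingKernel V (-1) lam (Km lam)) ∧
      FourthOrder.IsOk 2 lam0 (fun lam x y => Kp lam x y - C0 x y)
        (fun lam x y => lam * FourthOrder.jb x * FourthOrder.jb y) ∧
      FourthOrder.IsOk 2 lam0 (fun lam x y => Km lam x y - C0 x y)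
        (fun lam x y => lam * FourthOrder.jb x * FourthOrder.jb y) ∧
      FourthOrder.IsOk 2 lam0 (fun lam x y => Kp lam x y - Km lam x y)
        (fun lam x y => lam * FourthOrder.jb x * FourthOrder.jb y) := by
  obtain ⟨C, hC⟩ := hVdecay
  -- the weight `⟨·⟩² v` is in `L²` because `2 * 2 + 3 < β`
  have hw : MemLp (wC V) 2 (volume : Measure E3) :=
    memLp_weight (n := 2) hVmeas hC (by norm_num; exact hβ)
  have hv : MemLp (vC V) 2 (volume : Measure E3) := by
    simpa using memLp_weight (n := 0) hVmeas hC (by norm_num; linarith)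
  have hb := bounded_of_decay hC (by linarith)
  have hS := isUnit_bordOp_zero hVmeas hv hw hVne hreg
  obtain ⟨l₁, K₁, hl₁, hu₁, hK₁⟩ := isProfile_prof.resKer_expansion hVmeas hv hw hS
  obtain ⟨l₂, K₂, hl₂, hu₂, hK₂⟩ := isProfile_prof.conj.resKer_expansion hVmeas hv hw hS
  have hp := fun x y => (hK₁ x y).mono le_rfl (min_le_left l₁ l₂)
  have hm := fun x y => (hK₂ x y).mono le_rfl (min_le_right l₁ l₂)
  refine ⟨min l₁ l₂, lt_min hl₁ hl₂, bordKer hw hatK₀ hatP₀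
    (Ring.inverse (bordOp hVmeas hw hatK₀ hatP₀ 0)),
    fun l => resKer hVmeas hv (profKer (fun j s => prof j s) l),
    fun l => resKer hVmeas hv (profKer (fun j s => starRingEnd ℂ (prof j s)) l),
    fun l hl => isLimitingKernel_plus hVmeas hv hb hl.1
      (hu₁ l ⟨hl.1, hl.2.trans_le (min_le_left _ _)⟩),
    fun l hl => isLimitingKernel_minus hVmeas hv hb hl.1
      (hu₂ l ⟨hl.1, hl.2.trans_le (min_le_right _ _)⟩),
    isOk_of_symBd hp, isOk_of_symBd hm, isOk_of_symBd (C := K₁ + K₂) fun x y => ?_⟩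
  refine (((hp x y).sub (hm x y)).congr fun l _ => ?_).mono (le_of_eq (by ring)) le_rfl
  abel
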